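/- All manifolds are smooth, finite-dimensional and Hausdorff, and all functions, vector fields, tensors and connections are smooth, unless said otherwise. A triple $(M,g,\nabla)$, where $g$ is a pseudo-Riemannian metric (a symmetric nondegenerate $(0,2)$-tensor) and $\nabla$ is an affine connection on $M$, is a *statistical manifold admitting torsion* (SMAT) if $(g,\nabla)$ is *torsion coupled*: $$(\nabla_Xg)(Y,Z)-(\nabla_Yg)(X,Z)=-g(\mathrm{Tor}^\nabla(X,Y),Z)\qquad\text{for all vector fields }X,Y,Z,$$ where $(\nabla_Xg)(Y,Z)=X(g(Y,Z))-g(\nabla_XY,Z)-g(Y,\nabla_XZ)$ and $\mathrm{Tor}^\nabla(X,Y)=\nabla_XY-\nabla_YX-[X,Y]$. Let $r\ge 0$ be an integer and let $T^rM$ be the manifold of $r$-jets $[\gamma]_r$ at $0$ of smooth curves $\gamma:\mathbb R\to M$; local coordinates $(x^i)$ on $M$ induce the coordinates $(x^i_k)_{0\le k\le r}$ on $T^rM$ given by $x^i(\gamma(t))=x^i_0+x^i_1t+\dots+x^i_rt^r+o(t^r)$. The lifts to $T^rM$ are as follows. * For $f\in C^\infty(M)$ and an integer $k\le r$: $f^{(k)}([\gamma]_r)=\frac1{k!}\frac{d^k}{dt^k}\big|_{t=0}(f\circ\gamma)(t)$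 if $k\ge 0$, and $f^{(k)}=0$ if $k<0$. * For a vector field $X$ on $M$ and an integer $k\le r$: $X^{(k)}$ is the vector field on $T^rM$ determined by $X^{(k)}f^{(m)}=(Xf)^{(k+m-r)}$ for all $f\in C^\infty(M)$ and $0\le m\le r$. * For a $(0,2)$-tensor $g$ on $M$: the complete lift $g^c$ is the $(0,2)$-tensor on $T^rM$ determined by $g^c=\sum_i\sum_{a+b+c=r}f_i^{(a)}\,dh_i^{(b)}\otimes dk_i^{(c)}$ over $U$ whenever $g=\sum_i f_i\,dh_i\otimes dk_i$ (a finite sum, with $f_i,h_i,k_i\in C^\infty(M)$) on an open set $U\subseteq M$. * For an affine connection $\nabla$ on $M$: the complete lift $\nabla^c$ is the affine connection on $T^rM$ determined by $\nabla^c_{X^{(l)}}Y^{(m)}=(\nabla_XY)^{(l+m-r)}$ for all vector fields $X,Y$ on $M$ and $0\le l,m\le r$. **Theorem.** If $(M,g,\nabla)$ is a SMAT, then complete lifts $g^c$ and $\nabla^c$ to $T^rM$ exist, and $(T^rM,g^c,\nabla^c)$ is a SMAT: $g^c$ is a pseudo-Riemannian metric, $\nabla^c$ is a smooth affine connection, and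 $(g^c,\nabla^c)$ is torsion coupled. -/

import Mathlib

open Set Filter Topology Manifold Bundle
open scoped ContDiff

/-! ## Taylor coefficients of curves -/

section Taylor

variable {E : Type*} [NormedAddCommGroup E] [NormedSpace ℝ E]
  {G : Type*} [NormedAddCommGroup G] [NormedSpace ℝ G]

/-- The coefficient of `t ^ k` in the Taylor expansion at `0` of a curve `c`. -/
noncomputable def taylorCoeff (k : ℕ) (c : ℝ → E) : E :=
  ((k.factorial : ℝ)⁻¹) • iteratedDeriv k c 0

theorem taylorCoeff_congr {k : ℕ} {c c' : ℝ → E} (h : c =ᶠ[𝓝 0] c') :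
    taylorCoeff k c = taylorCoeff k c' := by
  rw [taylorCoeff, taylorCoeff, h.iteratedDeriv_eq]

theorem taylorCoeff_zero (c : ℝ → E) : taylorCoeff 0 c = c 0 := by
  simp [taylorCoeff]

theorem taylorCoeff_eq_iff {k : ℕ} {c c' : ℝ → E} :
    taylorCoeff k c = taylorCoeff k c' ↔ iteratedDeriv k c 0 = iteratedDeriv k c' 0 := by
  have : ((k.factorial : ℝ)⁻¹) ≠ 0 := by positivity
  simp [taylorCoeff, this]

theorem taylorCoeff_clm {k : ℕ} {c : ℝ → E} (hc : ContDiffAt ℝ ∞ c 0) (l : E →L[ℝ] G) :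
    taylorCoeff k (fun t => l (c t)) = l (taylorCoeff k c) := by
  have h := l.iteratedFDeriv_comp_left (x := 0) (f := c) hc (i := k) (by exact_mod_cast le_top)
  simp only [taylorCoeff, iteratedDeriv_eq_iteratedFDeriv, map_smul]
  change _ • (iteratedFDeriv ℝ k (l ∘ c) 0) _ = _
  rw [h]; rfl

theorem taylorCoeff_comp {n : ℕ} {F : E → G} {c c' : ℝ → E}
    (hc : ContDiffAt ℝ ∞ c 0) (hc' : ContDiffAt ℝ ∞ c' 0) (hF : ContDiffAt ℝ ∞ F (c 0))
    (h : ∀ k ≤ n, taylorCoeff k c = taylorCoeff k c') :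
    taylorCoeff n (F ∘ c) = taylorCoeff n (F ∘ c') := by
  have h0 : c 0 = c' 0 := by simpa [taylorCoeff_zero] using h 0 (Nat.zero_le _)
  have key : ∀ k ≤ n, iteratedFDeriv ℝ k c 0 = iteratedFDeriv ℝ k c' 0 := by
    intro k hk
    ext
    rw [iteratedFDeriv_apply_eq_iteratedDeriv_mul_prod,
      iteratedFDeriv_apply_eq_iteratedDeriv_mul_prod, taylorCoeff_eq_iff.1 (h k hk)]
  rw [taylorCoeff_eq_iff]
  simp only [iteratedDeriv_eq_iteratedFDeriv]
  have hn : ((n : ℕ∞) : WithTop ℕ∞) ≤ ∞ := by exact_mod_cast le_top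
  rw [iteratedFDeriv_comp (hF.of_le hn) (hc.of_le hn) le_rfl,
    iteratedFDeriv_comp ((h0 ▸ hF).of_le hn) (hc'.of_le hn) le_rfl]
  simp only [FormalMultilinearSeries.taylorComp]
  congr 1
  refine Finset.sum_congr rfl fun p _ => ?_
  simp only [FormalMultilinearSeries.compAlongOrderedFinpartition, h0]
  congr 1
  funext m
  exact key _ (p.partSize_le m)

/-- The polynomial curve `t ↦ ∑ k, t ^ k • v k`. -/
def polyCurve {r : ℕ} (v : Fin (r + 1) → E) (t : ℝ) : E := ∑ k : Fin (r + 1), t ^ (k : ℕ) • v k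

theorem polyCurve_zero {r : ℕ} (v : Fin (r + 1) → E) : polyCurve v 0 = v 0 := by
  rw [polyCurve, Finset.sum_eq_single 0]
  · simp
  · intro b _ hb
    have : (b : ℕ) ≠ 0 := fun h => hb (Fin.ext h)
    simp [this]
  · simp

theorem contDiff_polyCurve {r : ℕ} :
    ContDiff ℝ ∞ (fun z : (Fin (r + 1) → E) × ℝ => polyCurve z.1 z.2) := by
  unfold polyCurve
  fun_prop

theorem contDiff_polyCurve_right {r : ℕ} (v : Fin (r + 1) → E) : ContDiff ℝ ∞ (polyCurve v) := by
  unfold polyCurve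
  fun_prop

theorem taylorCoeff_polyCurve {r : ℕ} (v : Fin (r + 1) → E) (k : Fin (r + 1)) :
    taylorCoeff k (polyCurve v) = v k := by
  have h1 : iteratedDeriv (k : ℕ) (polyCurve v) 0
      = ∑ i : Fin (r + 1), iteratedDeriv (k : ℕ) (fun t : ℝ => t ^ (i : ℕ) • v i) 0 := by
    unfold polyCurve
    exact iteratedDeriv_fun_sum fun i _ => by fun_prop
  have h2 : ∀ i : Fin (r + 1), iteratedDeriv (k : ℕ) (fun t : ℝ => t ^ (i : ℕ) • v i) 0
      = if k = i then ((k : ℕ).factorial : ℝ) • v i else 0 := by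
    intro i
    have h3 := iteratedDeriv_smul_const (𝕜 := ℝ) (n := (k : ℕ)) (x := 0)
      (f := fun t : ℝ => t ^ (i : ℕ)) (by fun_prop) (v i)
    have h4 : iteratedDeriv (k : ℕ) (fun t : ℝ => t ^ (i : ℕ) • v i) 0
      = iteratedDeriv (k : ℕ) (fun t : ℝ => t ^ (i : ℕ)) 0 • v i := h3
    rw [h4, iteratedDeriv_fun_pow_zero]
    by_cases hki : k = i
    · subst hki; simp
    · have : (k : ℕ) ≠ i := fun h => hki (Fin.ext h)
      simp [hki, this]
  rw [taylorCoeff, h1]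
  simp only [h2]
  rw [Finset.sum_ite_eq]
  simp [smul_smul, Nat.factorial_ne_zero]

theorem contDiffOn_iteratedDeriv_param {P : Type*} [NormedAddCommGroup P] [NormedSpace ℝ P]
    {H : P × ℝ → G} {s : Set (P × ℝ)} (hs : IsOpen s) (hH : ContDiffOn ℝ ∞ H s) (k : ℕ) :
    ContDiffOn ℝ ∞ (fun z : P × ℝ => iteratedDeriv k (fun t => H (z.1, t)) z.2) s := by
  induction k with
  | zero => simpa using hH
  | succ k ih =>
    have h1 := (ih.fderiv_of_isOpen hs (m := ∞) (by simp)).clm_apply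
      (contDiffOn_const (c := ((0 : P), (1 : ℝ))))
    refine h1.congr fun z hz => ?_
    rw [iteratedDeriv_succ]
    have h2 := (ih.contDiffAt (hs.mem_nhds hz)).differentiableAt (by simp)
    have h3 : HasDerivAt (fun t : ℝ => ((z.1, t) : P × ℝ)) ((0 : P), (1 : ℝ)) z.2 :=
      (hasDerivAt_const z.2 z.1).prodMk (hasDerivAt_id z.2)
    exact (h2.hasFDerivAt.comp_hasDerivAt z.2 h3).deriv

theorem contDiffOn_taylorCoeff_polyCurve {r : ℕ} {F : E → G} {D : Set E} (hD : IsOpen D)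
    (hF : ContDiffOn ℝ ∞ F D) (k : ℕ) :
    ContDiffOn ℝ ∞ (fun v : Fin (r + 1) → E => taylorCoeff k (F ∘ polyCurve v))
      {v | v 0 ∈ D} := by
  have hs : IsOpen {z : (Fin (r + 1) → E) × ℝ | polyCurve z.1 z.2 ∈ D} :=
    hD.preimage contDiff_polyCurve.continuous
  have h1 : ContDiffOn ℝ ∞ (fun z : (Fin (r + 1) → E) × ℝ => F (polyCurve z.1 z.2))
      {z | polyCurve z.1 z.2 ∈ D} := hF.comp contDiff_polyCurve.contDiffOn fun z hz => hz
  have h2 := contDiffOn_iteratedDeriv_param hs h1 k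
  have h3 : ContDiffOn ℝ ∞ (fun v : Fin (r + 1) → E => (v, (0 : ℝ))) {v | v 0 ∈ D} := by fun_prop
  have h4 := h2.comp h3 fun v hv => by
    simpa [polyCurve_zero] using hv
  exact contDiffOn_const.smul h4

end Taylor

/-! ## The higher tangent bundle -/

section Jets

variable (E : Type*) [NormedAddCommGroup E] [NormedSpace ℝ E]
  (M : Type*) [TopologicalSpace M] [ChartedSpace E M] (r : ℕ)

/-- Two smooth curves have the same `r`-jet at `0` if, composed with any smooth function on `M`,
they have the same derivatives at `0` up to order `r`. -/
def jetSetoid : Setoid C^∞⟮𝓘(ℝ, ℝ), ℝ; 𝓘(ℝ, E), M⟯ where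
  r γ₁ γ₂ := ∀ f : M → ℝ, ContMDiff 𝓘(ℝ, E) 𝓘(ℝ, ℝ) ∞ f →
    ∀ k ≤ r, iteratedDeriv k (f ∘ γ₁) 0 = iteratedDeriv k (f ∘ γ₂) 0
  iseqv :=
    { refl := fun _ _ _ _ _ => rfl
      symm := fun h f hf k hk => (h f hf k hk).symm
      trans := fun h h' f hf k hk => (h f hf k hk).trans (h' f hf k hk) }

/-- The `r`-th tangent bundle `T^r M`: the `r`-jets at `0` of smooth curves in `M`. -/
def HigherTangentBundle : Type _ := Quotient (jetSetoid E M r)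

variable {E M}

/-- The `r`-jet at `0` of a smooth curve. -/
def jet (γ : C^∞⟮𝓘(ℝ, ℝ), ℝ; 𝓘(ℝ, E), M⟯) : HigherTangentBundle E M r :=
  Quotient.mk (jetSetoid E M r) γ

variable {r}

/-- A smooth curve representing a jet. -/
noncomputable def HigherTangentBundle.rep (p : HigherTangentBundle E M r) :
    C^∞⟮𝓘(ℝ, ℝ), ℝ; 𝓘(ℝ, E), M⟯ := Quotient.out p

@[simp] theorem jet_rep (p : HigherTangentBundle E M r) : jet r p.rep = p := Quotient.out_eq p

/-- The canonical projection `T^r M → M`, `[γ] ↦ γ 0`. -/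
noncomputable def HigherTangentBundle.proj (p : HigherTangentBundle E M r) : M := p.rep 0

theorem jet_eq_jet {γ₁ γ₂ : C^∞⟮𝓘(ℝ, ℝ), ℝ; 𝓘(ℝ, E), M⟯} :
    jet r γ₁ = jet r γ₂ ↔ ∀ f : M → ℝ, ContMDiff 𝓘(ℝ, E) 𝓘(ℝ, ℝ) ∞ f →
      ∀ k ≤ r, taylorCoeff k (f ∘ γ₁) = taylorCoeff k (f ∘ γ₂) := by
  simp only [taylorCoeff_eq_iff]
  exact Quotient.eq (r := jetSetoid E M r)

section Curves

theorem contDiffAt_comp_curve {G : Type*} [NormedAddCommGroup G] [NormedSpace ℝ G] {f : M → G}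
    (γ : C^∞⟮𝓘(ℝ, ℝ), ℝ; 𝓘(ℝ, E), M⟯) (hf : ContMDiffAt 𝓘(ℝ, E) 𝓘(ℝ, G) ∞ f (γ 0)) :
    ContDiffAt ℝ ∞ (f ∘ γ) 0 :=
  (hf.comp (0 : ℝ) γ.contMDiff.contMDiffAt).contDiffAt

theorem curve_eventually (γ : C^∞⟮𝓘(ℝ, ℝ), ℝ; 𝓘(ℝ, E), M⟯) {s : Set M} (hs : s ∈ 𝓝 (γ 0)) :
    ∀ᶠ t in 𝓝 (0 : ℝ), γ t ∈ s :=
  γ.contMDiff.continuous.continuousAt.eventually hs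

theorem exists_global_curve {η : ℝ → M} {δ : ℝ} (hδ : 0 < δ)
    (hη : ContMDiffOn 𝓘(ℝ, ℝ) 𝓘(ℝ, E) ∞ η (Metric.ball 0 δ)) :
    ∃ γ : C^∞⟮𝓘(ℝ, ℝ), ℝ; 𝓘(ℝ, E), M⟯, γ =ᶠ[𝓝 0] η := by
  let b : ContDiffBump (0 : ℝ) := ⟨δ / 4, δ / 2, by positivity, by linarith⟩
  let ρ : ℝ → ℝ := fun t => b t * t
  have hρ : ContMDiff 𝓘(ℝ, ℝ) 𝓘(ℝ, ℝ) ∞ ρ := (b.contDiff.mul contDiff_id).contMDiff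
  have hmem : ∀ t, ρ t ∈ Metric.ball (0 : ℝ) δ := by
    intro t
    rw [mem_ball_zero_iff, Real.norm_eq_abs, abs_mul, abs_of_nonneg b.nonneg]
    by_cases ht : t ∈ Metric.ball (0 : ℝ) (δ / 2)
    · have h1 : |t| < δ / 2 := by simpa using ht
      have h2 : b t ≤ 1 := b.le_one
      nlinarith [abs_nonneg t, b.nonneg (x := t)]
    · have : b t = 0 := by
        apply b.zero_of_le_dist
        simpa using ht
      simp [this, hδ]
  refine ⟨⟨η ∘ ρ, fun t => ?_⟩, ?_⟩
  · exact ((hη (ρ t) (hmem t)).contMDiffAt (Metric.isOpen_ball.mem_nhds (hmem t))).comp t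
      hρ.contMDiffAt
  · have h : ∀ᶠ t in 𝓝 (0 : ℝ), b t = 1 := b.eventuallyEq_one
    filter_upwards [h] with t ht
    change η (b t * t) = η t
    rw [ht, one_mul]

end Curves

variable [IsManifold 𝓘(ℝ, E) ∞ M]

theorem jet_eq_of_taylorCoeff_eq {γ₁ γ₂ : C^∞⟮𝓘(ℝ, ℝ), ℝ; 𝓘(ℝ, E), M⟯} (c : M)
    (h1 : γ₁ 0 ∈ (chartAt E c).source) (h2 : γ₂ 0 ∈ (chartAt E c).source)
    (h : ∀ k ≤ r, taylorCoeff k (chartAt E c ∘ γ₁) = taylorCoeff k (chartAt E c ∘ γ₂)) :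
    jet r γ₁ = jet r γ₂ := by
  refine jet_eq_jet.2 fun f hf k hk => ?_
  have hs : (chartAt E c).source ∈ 𝓝 (γ₁ 0) := (chartAt E c).open_source.mem_nhds h1
  have hφ := contMDiffOn_chart (I := 𝓘(ℝ, E)) (n := ∞) (x := c)
  have hφ' := contMDiffOn_chart_symm (I := 𝓘(ℝ, E)) (n := ∞) (x := c)
  have key : ∀ γ : C^∞⟮𝓘(ℝ, ℝ), ℝ; 𝓘(ℝ, E), M⟯, γ 0 ∈ (chartAt E c).source →
      f ∘ γ =ᶠ[𝓝 0] (f ∘ (chartAt E c).symm) ∘ (chartAt E c ∘ γ) := by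
    intro γ hγ
    filter_upwards [curve_eventually γ ((chartAt E c).open_source.mem_nhds hγ)] with t ht
    simp [(chartAt E c).left_inv ht]
  have hc : ∀ γ : C^∞⟮𝓘(ℝ, ℝ), ℝ; 𝓘(ℝ, E), M⟯, γ 0 ∈ (chartAt E c).source →
      ContDiffAt ℝ ∞ (chartAt E c ∘ γ) 0 := fun γ hγ =>
    contDiffAt_comp_curve γ ((hφ _ hγ).contMDiffAt ((chartAt E c).open_source.mem_nhds hγ))
  rw [taylorCoeff_congr (key γ₁ h1), taylorCoeff_congr (key γ₂ h2)]
  refine taylorCoeff_comp (hc _ h1) (hc _ h2) ?_ fun j hj => h j (hj.trans hk)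
  have ht : chartAt E c (γ₁ 0) ∈ (chartAt E c).target := (chartAt E c).map_source h1
  exact (hf.contMDiffAt.comp _ ((hφ' _ ht).contMDiffAt
    ((chartAt E c).open_target.mem_nhds ht))).contDiffAt

theorem exists_curve_of_mem_target (c : M) {v : Fin (r + 1) → E}
    (hv : v 0 ∈ (chartAt E c).target) :
    ∃ γ : C^∞⟮𝓘(ℝ, ℝ), ℝ; 𝓘(ℝ, E), M⟯, γ =ᶠ[𝓝 0] (chartAt E c).symm ∘ polyCurve v := by
  have hφ' := contMDiffOn_chart_symm (I := 𝓘(ℝ, E)) (n := ∞) (x := c)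
  have ho : IsOpen (polyCurve v ⁻¹' (chartAt E c).target) :=
    (chartAt E c).open_target.preimage (contDiff_polyCurve_right v).continuous
  obtain ⟨δ, hδ, hsub⟩ := Metric.isOpen_iff.1 ho 0 (by simpa [polyCurve_zero] using hv)
  exact exists_global_curve hδ
    (hφ'.comp (contDiff_polyCurve_right v).contMDiff.contMDiffOn hsub)

variable [FiniteDimensional ℝ E] [T2Space M]

theorem exists_global_extension {G : Type*} [NormedAddCommGroup G] [NormedSpace ℝ G] {s : Set M}
    (hs : IsOpen s) {f : M → G} (hf : ContMDiffOn 𝓘(ℝ, E) 𝓘(ℝ, G) ∞ f s) {x : M} (hx : x ∈ s) :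
    ∃ F : M → G, ContMDiff 𝓘(ℝ, E) 𝓘(ℝ, G) ∞ F ∧ F =ᶠ[𝓝 x] f := by
  obtain ⟨b, -, hb⟩ := (SmoothBumpFunction.nhds_basis_tsupport (I := 𝓘(ℝ, E)) x).mem_iff.1
    (hs.mem_nhds hx)
  refine ⟨fun y => b y • f y, ?_, ?_⟩
  · refine contMDiff_of_tsupport fun y hy => ?_
    have hy' : y ∈ s := hb (tsupport_smul_subset_left _ _ hy)
    exact b.contMDiffAt.smul ((hf y hy').contMDiffAt (hs.mem_nhds hy'))
  · filter_upwards [b.eventuallyEq_one] with y hy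
    simp [hy]

theorem curve_zero_eq_of_jet_eq {γ₁ γ₂ : C^∞⟮𝓘(ℝ, ℝ), ℝ; 𝓘(ℝ, E), M⟯}
    (h : jet r γ₁ = jet r γ₂) : γ₁ 0 = γ₂ 0 := by
  by_contra hne
  obtain ⟨b, -, hb⟩ := (SmoothBumpFunction.nhds_basis_tsupport (I := 𝓘(ℝ, E)) (γ₁ 0)).mem_iff.1
    (isOpen_compl_singleton.mem_nhds (show γ₁ 0 ∈ ({γ₂ 0}ᶜ : Set M) from hne))
  have h1 := jet_eq_jet.1 h b b.contMDiff 0 (Nat.zero_le _)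
  simp only [taylorCoeff_zero, Function.comp_apply, b.eq_one] at h1
  have h2 : γ₂ 0 ∉ tsupport b := fun h => hb h rfl
  exact one_ne_zero (h1.trans (image_eq_zero_of_notMem_tsupport h2))

@[simp] theorem proj_jet (γ : C^∞⟮𝓘(ℝ, ℝ), ℝ; 𝓘(ℝ, E), M⟯) : (jet r γ).proj = γ 0 :=
  curve_zero_eq_of_jet_eq (jet_rep (jet r γ))

/-- Jets determine the Taylor coefficients of the composition with any locally smooth map. -/
theorem taylorCoeff_eq_of_jet_eq {G : Type*} [NormedAddCommGroup G] [NormedSpace ℝ G] {s : Set M}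
    (hs : IsOpen s) {f : M → G} (hf : ContMDiffOn 𝓘(ℝ, E) 𝓘(ℝ, G) ∞ f s)
    {γ₁ γ₂ : C^∞⟮𝓘(ℝ, ℝ), ℝ; 𝓘(ℝ, E), M⟯} (h : jet r γ₁ = jet r γ₂) (h1 : γ₁ 0 ∈ s)
    {k : ℕ} (hk : k ≤ r) : taylorCoeff k (f ∘ γ₁) = taylorCoeff k (f ∘ γ₂) := by
  have h2 : γ₂ 0 ∈ s := curve_zero_eq_of_jet_eq h ▸ h1
  obtain ⟨F, hF, hFf⟩ := exists_global_extension hs hf h1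
  have hFf' : ∀ᶠ x in 𝓝 (γ₂ 0), F x = f x := curve_zero_eq_of_jet_eq h ▸ hFf
  have e1 : F ∘ γ₁ =ᶠ[𝓝 0] f ∘ γ₁ := curve_eventually γ₁ hFf
  have e2 : F ∘ γ₂ =ᶠ[𝓝 0] f ∘ γ₂ := curve_eventually γ₂ hFf'
  rw [← taylorCoeff_congr e1, ← taylorCoeff_congr e2]
  refine (SeparatingDual.eq_iff_forall_dual_eq (R := ℝ)).2 fun l => ?_
  rw [← taylorCoeff_clm (contDiffAt_comp_curve γ₁ hF.contMDiffAt) l,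
    ← taylorCoeff_clm (contDiffAt_comp_curve γ₂ hF.contMDiffAt) l]
  exact jet_eq_jet.1 h (fun x => l (F x)) (l.contMDiff.comp hF) k hk

open Classical in
/-- The chart of `T^r M` induced by the preferred chart `x` of `M` at a point `c`: its coordinates
`x_k`, `k = 0, …, r`, are given by `x (γ t) = x_0 + x_1 t + ⋯ + x_r t ^ r + o(t ^ r)`. -/
noncomputable def jetChart (r : ℕ) (c : M) :
    PartialEquiv (HigherTangentBundle E M r) (Fin (r + 1) → E) where
  toFun p k := taylorCoeff k (chartAt E c ∘ p.rep)
  invFun v := if h : v 0 ∈ (chartAt E c).target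
    then jet r (exists_curve_of_mem_target c h).choose else jet r (ContMDiffMap.const c)
  source := {p | p.proj ∈ (chartAt E c).source}
  target := {v | v 0 ∈ (chartAt E c).target}
  map_source' p hp := by
    simpa [taylorCoeff_zero] using (chartAt E c).map_source (show p.rep 0 ∈ _ from hp)
  map_target' v hv := by
    have hv' : v 0 ∈ (chartAt E c).target := hv
    have h := (exists_curve_of_mem_target c hv').choose_spec.self_of_nhds
    simp [hv', h, polyCurve_zero]
  left_inv' p hp := by
    have hp' : p.rep 0 ∈ (chartAt E c).source := hp
    set v : Fin (r + 1) → E := fun k => taylorCoeff k (chartAt E c ∘ p.rep) with hvdef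
    have hv : v 0 ∈ (chartAt E c).target := by
      simpa [v, taylorCoeff_zero] using (chartAt E c).map_source hp'
    have h := (exists_curve_of_mem_target c hv).choose_spec
    have h0 := h.self_of_nhds
    rw [dif_pos hv]
    conv_rhs => rw [← jet_rep p]
    refine jet_eq_of_taylorCoeff_eq c ?_ hp' fun k hk => ?_
    · rw [h0]; simpa [polyCurve_zero] using (chartAt E c).map_target hv
    · have ho : ∀ᶠ t in 𝓝 (0 : ℝ), polyCurve v t ∈ (chartAt E c).target :=
        (contDiff_polyCurve_right v).continuous.continuousAt.eventually
          ((chartAt E c).open_target.mem_nhds (by simpa [polyCurve_zero] using hv))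
      have e : chartAt E c ∘ (exists_curve_of_mem_target c hv).choose =ᶠ[𝓝 0] polyCurve v := by
        filter_upwards [h, ho] with t ht ht'
        simp [ht, (chartAt E c).right_inv ht']
      rw [taylorCoeff_congr e]
      exact taylorCoeff_polyCurve v ⟨k, Nat.lt_succ_of_le hk⟩
  right_inv' v hv := by
    have hv' : v 0 ∈ (chartAt E c).target := hv
    have h := (exists_curve_of_mem_target c hv').choose_spec
    have h0 := h.self_of_nhds
    have hs : (exists_curve_of_mem_target c hv').choose 0 ∈ (chartAt E c).source := by
      rw [h0]; simpa [polyCurve_zero] using (chartAt E c).map_target hv'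
    have ho : ∀ᶠ t in 𝓝 (0 : ℝ), polyCurve v t ∈ (chartAt E c).target :=
      (contDiff_polyCurve_right v).continuous.continuousAt.eventually
        ((chartAt E c).open_target.mem_nhds (by simpa [polyCurve_zero] using hv'))
    have e : chartAt E c ∘ (exists_curve_of_mem_target c hv').choose =ᶠ[𝓝 0] polyCurve v := by
      filter_upwards [h, ho] with t ht ht'
      simp [ht, (chartAt E c).right_inv ht']
    funext k
    rw [dif_pos hv']
    rw [taylorCoeff_eq_of_jet_eq (chartAt E c).open_source
      (contMDiffOn_chart (I := 𝓘(ℝ, E)) (n := ∞) (x := c)) (jet_rep _) (by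
        change (jet r _).proj ∈ _
        rwa [proj_jet]) (Nat.lt_succ_iff.1 k.2), taylorCoeff_congr e]
    exact taylorCoeff_polyCurve v k

theorem jetChart_jet (c : M) {γ : C^∞⟮𝓘(ℝ, ℝ), ℝ; 𝓘(ℝ, E), M⟯}
    (h : γ 0 ∈ (chartAt E c).source) (k : Fin (r + 1)) :
    jetChart r c (jet r γ) k = taylorCoeff k (chartAt E c ∘ γ) :=
  taylorCoeff_eq_of_jet_eq (chartAt E c).open_source
    (contMDiffOn_chart (I := 𝓘(ℝ, E)) (n := ∞) (x := c)) (jet_rep _) (by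
      change (jet r _).proj ∈ _
      rwa [proj_jet]) (Nat.lt_succ_iff.1 k.2)

theorem exists_jetChart_symm (c : M) {v : Fin (r + 1) → E}
    (hv : v 0 ∈ (chartAt E c).target) :
    ∃ γ : C^∞⟮𝓘(ℝ, ℝ), ℝ; 𝓘(ℝ, E), M⟯,
      γ =ᶠ[𝓝 0] (chartAt E c).symm ∘ polyCurve v ∧ (jetChart r c).symm v = jet r γ :=
  ⟨_, (exists_curve_of_mem_target c hv).choose_spec, dif_pos hv⟩

theorem proj_jetChart_symm (c : M) {v : Fin (r + 1) → E}
    (hv : v 0 ∈ (chartAt E c).target) :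
    ((jetChart r c).symm v).proj = (chartAt E c).symm (v 0) := by
  obtain ⟨γ, h1, h2⟩ := exists_jetChart_symm c hv
  rw [h2, proj_jet, h1.self_of_nhds]
  simp [polyCurve_zero]

theorem jetChart_trans_source (c c' : M) :
    ((jetChart (E := E) (M := M) r c).symm.trans (jetChart r c')).source =
      {v | v 0 ∈ ((chartAt E c).symm ≫ₕ chartAt E c').source} := by
  ext v
  have hs : ∀ v : Fin (r + 1) → E, v ∈ (jetChart (E := E) (M := M) r c).symm.source ↔
    v 0 ∈ (chartAt E c).target := fun v => Iff.rfl
  have hs' : ∀ p : HigherTangentBundle E M r, p ∈ (jetChart r c').source ↔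
    p.proj ∈ (chartAt E c').source := fun v => Iff.rfl
  simp only [PartialEquiv.trans_source, mem_inter_iff, mem_preimage, hs, hs', mem_ofPred_eq,
    OpenPartialHomeomorph.trans_source, OpenPartialHomeomorph.symm_source]
  refine and_congr_right fun hv => ?_
  rw [proj_jetChart_symm c hv]

theorem jetChart_trans_apply (c c' : M) {v : Fin (r + 1) → E}
    (hv : v 0 ∈ ((chartAt E c).symm ≫ₕ chartAt E c').source) (k : Fin (r + 1)) :
    jetChart (E := E) (M := M) r c' ((jetChart r c).symm v) k =
      taylorCoeff k (((chartAt E c).symm ≫ₕ chartAt E c') ∘ polyCurve v) := by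
  obtain ⟨γ, h1, h2⟩ := exists_jetChart_symm (r := r) c (v := v) hv.1
  rw [h2, jetChart_jet]
  · apply taylorCoeff_congr
    filter_upwards [h1] with t ht
    simp [ht]
  · rw [h1.self_of_nhds]
    simpa [polyCurve_zero] using hv.2

theorem contDiffOn_jetChart_trans (c c' : M) :
    ContDiffOn ℝ ∞ ((jetChart (E := E) (M := M) r c).symm.trans (jetChart r c'))
      ((jetChart (E := E) (M := M) r c).symm.trans (jetChart r c')).source := by
  rw [jetChart_trans_source]
  rw [contDiffOn_pi]
  intro k
  have hF : ContDiffOn ℝ ∞ ((chartAt E c).symm ≫ₕ chartAt E c')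
      ((chartAt E c).symm ≫ₕ chartAt E c').source := by
    have h := (contDiffGroupoid ∞ 𝓘(ℝ, E)).compatible (chart_mem_atlas E c) (chart_mem_atlas E c')
    rw [contDiffGroupoid, mem_groupoid_of_pregroupoid] at h
    simpa [contDiffPregroupoid] using h.1
  exact (contDiffOn_taylorCoeff_polyCurve (r := r)
    ((chartAt E c).symm ≫ₕ chartAt E c').open_source hF k).congr
      fun v hv => jetChart_trans_apply c c' hv k

variable (E M r) in
/-- The charted space structure on `T^r M`, as a compatible family of charts. -/
noncomputable def higherTangentBundleCore :
    ChartedSpaceCore (Fin (r + 1) → E) (HigherTangentBundle E M r) where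
  atlas := range (jetChart r)
  chartAt p := jetChart r p.proj
  mem_chart_source p := mem_chart_source E p.proj
  chart_mem_atlas p := mem_range_self p.proj
  open_source := by
    rintro _ _ ⟨c, rfl⟩ ⟨c', rfl⟩
    rw [jetChart_trans_source]
    exact ((chartAt E c).symm ≫ₕ chartAt E c').open_source.preimage (continuous_apply 0)
  continuousOn_toFun := by
    rintro _ _ ⟨c, rfl⟩ ⟨c', rfl⟩
    exact (contDiffOn_jetChart_trans c c').continuousOn

noncomputable instance : TopologicalSpace (HigherTangentBundle E M r) :=
  (higherTangentBundleCore E M r).toTopologicalSpace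

noncomputable instance : ChartedSpace (Fin (r + 1) → E) (HigherTangentBundle E M r) :=
  (higherTangentBundleCore E M r).toChartedSpace

/-- The chart `jetChart r c` as an open partial homeomorphism. -/
noncomputable def jetOpenChart (r : ℕ) (c : M) :
    OpenPartialHomeomorph (HigherTangentBundle E M r) (Fin (r + 1) → E) :=
  (higherTangentBundleCore E M r).openPartialHomeomorph (jetChart r c) (mem_range_self c)

theorem chartAt_higherTangentBundle (p : HigherTangentBundle E M r) :
    chartAt (Fin (r + 1) → E) p = jetOpenChart r p.proj := rfl

theorem mem_atlas_higherTangentBundle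
    {e : OpenPartialHomeomorph (HigherTangentBundle E M r) (Fin (r + 1) → E)} :
    e ∈ atlas (Fin (r + 1) → E) (HigherTangentBundle E M r) ↔
      ∃ c : M, e = jetOpenChart r c := by
  constructor
  · intro he
    obtain ⟨e', he'⟩ := mem_iUnion.1 he
    obtain ⟨⟨c, rfl⟩, h⟩ := mem_iUnion.1 he'
    exact ⟨c, h⟩
  · rintro ⟨c, rfl⟩
    exact mem_iUnion.2 ⟨jetChart r c, mem_iUnion.2 ⟨mem_range_self c, rfl⟩⟩

instance : IsManifold 𝓘(ℝ, Fin (r + 1) → E) ∞ (HigherTangentBundle E M r) := by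
  refine isManifold_of_contDiffOn _ _ _ fun e e' he he' => ?_
  obtain ⟨c, rfl⟩ := mem_atlas_higherTangentBundle.1 he
  obtain ⟨c', rfl⟩ := mem_atlas_higherTangentBundle.1 he'
  simpa using! contDiffOn_jetChart_trans (r := r) c c'

theorem continuous_proj : Continuous (HigherTangentBundle.proj (E := E) (M := M) (r := r)) := by
  rw [continuous_iff_continuousAt]
  intro p
  have hp : p ∈ (jetOpenChart r p.proj).source := mem_chart_source E p.proj
  have h1 : ContinuousAt (fun q => (chartAt E p.proj).symm (jetOpenChart r p.proj q 0)) p := by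
    refine ContinuousAt.comp (g := (chartAt E p.proj).symm) ?_
      ((continuous_apply 0).continuousAt.comp ((jetOpenChart r p.proj).continuousAt hp))
    exact (chartAt E p.proj).symm.continuousAt ((jetOpenChart r p.proj).map_source hp)
  refine h1.congr ?_
  filter_upwards [(jetOpenChart r p.proj).open_source.mem_nhds hp] with q hq
  change (chartAt E p.proj).symm (taylorCoeff _ _) = _
  have hq' : q.rep 0 ∈ (chartAt E p.proj).source := hq
  simp only [Fin.val_zero, taylorCoeff_zero, Function.comp_apply, (chartAt E p.proj).left_inv hq']
  rfl

instance : T2Space (HigherTangentBundle E M r) := by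
  refine ⟨fun p q hpq => ?_⟩
  by_cases h : p.proj = q.proj
  · have hp : p ∈ (jetOpenChart r p.proj).source := mem_chart_source E p.proj
    have hq : q ∈ (jetOpenChart r p.proj).source := by
      rw [h]; exact mem_chart_source E q.proj
    have hne : jetOpenChart r p.proj p ≠ jetOpenChart r p.proj q :=
      fun he => hpq ((jetOpenChart r p.proj).injOn hp hq he)
    obtain ⟨u, v, hu, hv, hpu, hqv, huv⟩ := t2_separation hne
    refine ⟨_, _, (jetOpenChart r p.proj).isOpen_inter_preimage hu,
      (jetOpenChart r p.proj).isOpen_inter_preimage hv, ⟨hp, hpu⟩, ⟨hq, hqv⟩, ?_⟩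
    exact (huv.preimage _).mono inter_subset_right inter_subset_right
  · obtain ⟨u, v, hu, hv, hpu, hqv, huv⟩ := t2_separation h
    exact ⟨_, _, hu.preimage continuous_proj, hv.preimage continuous_proj, hpu, hqv,
      huv.preimage _⟩

instance [SecondCountableTopology M] : SecondCountableTopology (HigherTangentBundle E M r) := by
  obtain ⟨s, hs, hs'⟩ := TopologicalSpace.countable_cover_nhds
    (fun x : M => (chartAt E x).open_source.mem_nhds (mem_chart_source E x))
  have : Countable s := hs.to_subtype
  have ho : ∀ c : s, SecondCountableTopology (jetOpenChart (E := E) r c.1).source :=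
    fun c => (jetOpenChart r c.1).secondCountableTopology_source
  refine TopologicalSpace.secondCountableTopology_of_countable_cover
    (U := fun c : s => (jetOpenChart (E := E) r c.1).source)
    (fun c => (jetOpenChart r c.1).open_source) ?_
  refine eq_univ_of_forall fun p => ?_
  obtain ⟨c, hc, hpc⟩ := mem_iUnion₂.1 (hs'.symm ▸ mem_univ p.proj)
  exact mem_iUnion.2 ⟨⟨c, hc⟩, hpc⟩

end Jets

/-! ## Statistical manifolds admitting torsion -/

section SMAT

variable {E : Type*} [NormedAddCommGroup E] [NormedSpace ℝ E]
  {M : Type*} [TopologicalSpace M] [ChartedSpace E M]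

/-- Vector fields on `M` (not necessarily smooth). -/
abbrev VectorFieldOn (E : Type*) [NormedAddCommGroup E] [NormedSpace ℝ E]
    (M : Type*) [TopologicalSpace M] [ChartedSpace E M] : Type _ :=
  (x : M) → TangentSpace 𝓘(ℝ, E) x

/-- Fields of bilinear forms on the tangent spaces of `M` (not necessarily smooth). -/
abbrev BilinFieldOn (E : Type*) [NormedAddCommGroup E] [NormedSpace ℝ E]
    (M : Type*) [TopologicalSpace M] [ChartedSpace E M] : Type _ :=
  (x : M) → TangentSpace 𝓘(ℝ, E) x →L[ℝ] TangentSpace 𝓘(ℝ, E) x →L[ℝ] ℝ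

/-- Affine connections on `M` (not necessarily smooth): `nab Y x (X x)` is `(∇_X Y)(x)`. -/
abbrev ConnectionOn (E : Type*) [NormedAddCommGroup E] [NormedSpace ℝ E]
    (M : Type*) [TopologicalSpace M] [ChartedSpace E M] [IsManifold 𝓘(ℝ, E) ∞ M] : Type _ :=
  CovariantDerivative 𝓘(ℝ, E) E (TangentSpace 𝓘(ℝ, E) : M → Type _)

variable [IsManifold 𝓘(ℝ, E) ∞ M]

/-- Smooth vector fields. -/
def IsSmoothVF (X : VectorFieldOn E M) : Prop :=
  ContMDiff 𝓘(ℝ, E) 𝓘(ℝ, E).tangent ∞ fun x => (⟨x, X x⟩ : TangentBundle 𝓘(ℝ, E) M)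

/-- The function `X f`. -/
noncomputable def derivAlong (X : VectorFieldOn E M) (f : M → ℝ) (x : M) : ℝ :=
  mvfderiv 𝓘(ℝ, E) f x (X x)

/-- The vector field `∇_X Y`. -/
noncomputable def covAlong (nab : ConnectionOn E M) (X Y : VectorFieldOn E M) : VectorFieldOn E M :=
  fun x => nab Y x (X x)

/-- The function `(∇_X g)(Y, Z) = X (g(Y, Z)) - g(∇_X Y, Z) - g(Y, ∇_X Z)`. -/
noncomputable def covDerivBilin (nab : ConnectionOn E M) (g : BilinFieldOn E M)
    (X Y Z : VectorFieldOn E M) (x : M) : ℝ :=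
  derivAlong X (fun y => g y (Y y) (Z y)) x
    - g x (covAlong nab X Y x) (Z x) - g x (Y x) (covAlong nab X Z x)

/-- Pseudo-Riemannian metrics: smooth fields of nondegenerate symmetric bilinear forms. -/
structure IsPseudoRiemannianMetric (g : BilinFieldOn E M) : Prop where
  symm : ∀ x v w, g x v w = g x w v
  nondegenerate : ∀ x v, (∀ w, g x v w = 0) → v = 0
  contMDiff : ContMDiff 𝓘(ℝ, E) (𝓘(ℝ, E).prod 𝓘(ℝ, E →L[ℝ] E →L[ℝ] ℝ)) ∞
    (fun x => TotalSpace.mk' (E →L[ℝ] E →L[ℝ] ℝ)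
      (E := fun x : M => TangentSpace 𝓘(ℝ, E) x →L[ℝ] TangentSpace 𝓘(ℝ, E) x →L[ℝ] ℝ) x (g x))

/-- `(g, ∇)` is torsion coupled:
`(∇_X g)(Y, Z) - (∇_Y g)(X, Z) = - g(Tor(X, Y), Z)` for all smooth vector fields `X, Y, Z`. -/
def TorsionCoupled [FiniteDimensional ℝ E] (g : BilinFieldOn E M) (nab : ConnectionOn E M) : Prop :=
  haveI : CompleteSpace E := FiniteDimensional.complete ℝ E
  ∀ X Y Z : VectorFieldOn E M, IsSmoothVF X → IsSmoothVF Y → IsSmoothVF Z → ∀ x : M,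
    covDerivBilin nab g X Y Z x - covDerivBilin nab g Y X Z x
      = - g x (nab.torsion x (X x) (Y x)) (Z x)

/-- `(M, g, ∇)` is a statistical manifold admitting torsion: `g` is a pseudo-Riemannian metric,
`∇` is a smooth affine connection, and `(g, ∇)` is torsion coupled. -/
structure IsSMAT [FiniteDimensional ℝ E] (g : BilinFieldOn E M) (nab : ConnectionOn E M) :
    Prop where
  metric : IsPseudoRiemannianMetric g
  smooth : nab.ContMDiffCovariantDerivative ∞
  torsionCoupled : TorsionCoupled g nab

end SMAT

/-! ## Lifts to the higher tangent bundle -/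

section Lifts

variable {E : Type*} [NormedAddCommGroup E] [NormedSpace ℝ E]
  {M : Type*} [TopologicalSpace M] [ChartedSpace E M]

/-- The `k`-lift `f^(k)` to `T^r M` of a smooth function `f` on `M`, for `k ≤ r`:
`f^(k) [γ] = (1 / k!) (d/dt)^k (f ∘ γ) (0)` if `0 ≤ k`, and `f^(k) = 0` if `k < 0`. -/
noncomputable def liftFun (r : ℕ) (k : ℤ) (f : M → ℝ) (p : HigherTangentBundle E M r) : ℝ :=
  if 0 ≤ k then taylorCoeff k.toNat (f ∘ p.rep) else 0

/-- The lift of a smooth function does not depend on the curve representing the jet. -/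
theorem liftFun_jet {r k : ℕ} (hk : k ≤ r) {f : M → ℝ}
    (hf : ContMDiff 𝓘(ℝ, E) 𝓘(ℝ, ℝ) ∞ f) (γ : C^∞⟮𝓘(ℝ, ℝ), ℝ; 𝓘(ℝ, E), M⟯) :
    liftFun r k f (jet r γ) = ((k.factorial : ℝ)⁻¹) * iteratedDeriv k (f ∘ γ) 0 := by
  have h := jet_eq_jet.1 (jet_rep (jet r γ)) f hf k hk
  simpa [liftFun, taylorCoeff] using h

variable [FiniteDimensional ℝ E] [IsManifold 𝓘(ℝ, E) ∞ M] [T2Space M]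

/-- The vector field `X'` on `T^r M` is the `k`-lift `X^(k)` of the vector field `X` on `M`:
`X^(k) f^(m) = (X f)^(k + m - r)` for all smooth functions `f` on `M` and `0 ≤ m ≤ r`. -/
def IsLiftVF (r : ℕ) (k : ℤ) (X : VectorFieldOn E M)
    (X' : VectorFieldOn (Fin (r + 1) → E) (HigherTangentBundle E M r)) : Prop :=
  IsSmoothVF X' ∧
    ∀ f : M → ℝ, ContMDiff 𝓘(ℝ, E) 𝓘(ℝ, ℝ) ∞ f → ∀ m : ℕ, m ≤ r →
      derivAlong X' (liftFun r m f) = liftFun r (k + m - r) (derivAlong X f)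

/-- The field of bilinear forms `g'` on `T^r M` is the complete lift of the field of bilinear forms
`g` on `M`. The lifting is local, linear, and satisfies the Leibniz rule
`(f dh ⊗ dk)^(r) = ∑_{a + b + c = r} f^(a) dh^(b) ⊗ dk^(c)`: whenever
`g = ∑ i, f i • dh i ⊗ dk i` on an open set `U`, the corresponding formula for `g'` holds over `U`. -/
def IsCompleteLiftBilin (r : ℕ) (g : BilinFieldOn E M)
    (g' : BilinFieldOn (Fin (r + 1) → E) (HigherTangentBundle E M r)) : Prop :=
  ∀ (U : Set M), IsOpen U → ∀ (n : ℕ) (f h k : Fin n → M → ℝ),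
    (∀ i, ContMDiff 𝓘(ℝ, E) 𝓘(ℝ, ℝ) ∞ (f i)) → (∀ i, ContMDiff 𝓘(ℝ, E) 𝓘(ℝ, ℝ) ∞ (h i)) →
    (∀ i, ContMDiff 𝓘(ℝ, E) 𝓘(ℝ, ℝ) ∞ (k i)) →
    (∀ x ∈ U, ∀ u v : TangentSpace 𝓘(ℝ, E) x, g x u v =
      ∑ i, f i x * mvfderiv 𝓘(ℝ, E) (h i) x u * mvfderiv 𝓘(ℝ, E) (k i) x v) →
    ∀ p : HigherTangentBundle E M r, p.proj ∈ U →
      ∀ u v : TangentSpace 𝓘(ℝ, Fin (r + 1) → E) p, g' p u v =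
        ∑ i, ∑ a ∈ Finset.HasAntidiagonal.antidiagonal r, ∑ b ∈ Finset.HasAntidiagonal.antidiagonal a.2,
          liftFun r a.1 (f i) p
            * mvfderiv 𝓘(ℝ, Fin (r + 1) → E) (liftFun r b.1 (h i)) p u
            * mvfderiv 𝓘(ℝ, Fin (r + 1) → E) (liftFun r b.2 (k i)) p v

/-- The affine connection `nab'` on `T^r M` is the complete lift of the affine connection `nab` on
`M`: `∇'_{X^(l)} Y^(m) = (∇_X Y)^(l + m - r)` for all smooth vector fields `X, Y` on `M` and
`0 ≤ l, m ≤ r`. -/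
def IsCompleteLiftConnection (r : ℕ) (nab : ConnectionOn E M)
    (nab' : ConnectionOn (Fin (r + 1) → E) (HigherTangentBundle E M r)) : Prop :=
  ∀ X Y : VectorFieldOn E M, IsSmoothVF X → IsSmoothVF Y → ∀ l m : ℕ, l ≤ r → m ≤ r →
    ∀ X' Y' Z', IsLiftVF r l X X' → IsLiftVF r m Y Y' →
      IsLiftVF r ((l : ℤ) + m - r) (covAlong nab X Y) Z' → covAlong nab' X' Y' = Z'

end Lifts

/-! Everything on `T^r M` is an identity on `M` read along a curve and truncated at order `r`. In
the chart centred at a jet `p`, the jet is a polynomial curve `γ(t)` in `E` (`chartCurve`). A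
tangent vector at `p` is an element of `Fin (r + 1) → E`, that is, an `r`-jet of a curve `u(t)` in
`E`. By differentiation under the Taylor coefficient, `u` sends `f^(m)` to the `t^m` coefficient of
`Df(γ(t)) u(t)` (`mvfderiv_taylorCoeff_comp_rep`).

In this picture the lift `X^(r-d)` is the jet of `t^d X(γ(t))`, the complete lift of `g` is the
`t^r` coefficient of `g_γ(t)(u(t), w(t))`, and the complete lift of `∇` has as Christoffel form the
Taylor coefficients of `Γ_γ(t)(u(t), w(t))`. Multiplication by `t^d` shifts Taylor coefficients, so
all operations are linear over the truncated polynomials in `t`. This gives the rules `X^(r-d) f^(m)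
= (X f)^(m-d)`, `[X^(r-d), Y^(r-d')] = [X, Y]^(r-d-d')`, `g^c(X^(r-d), Y^(r-d')) = (g(X,
Y))^(r-d-d')` and `∇^c_{X^(r-d)} Y^(r-d') = (∇_X Y)^(r-d-d')` (`derivAlong_liftVF`,
`mlieBracket_liftVF`, `liftBilin_liftVF`, `liftConn_liftVF`).

Torsion coupling is equivalent to the vanishing of an expression `torsionDefect` that is tensorial
in all three arguments. By the four rules its value on lifted fields is the lift of its value on
`M`, which is zero (`torsionDefect_liftVF`). The coordinate fields of `T^r M` are lifts of
coordinate fields of `M`, so lifts span every tangent space and the defect vanishes identically. The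
same frame gives smoothness of `g^c` and of any complete lift of `∇`. Nondegeneracy of `g^c` holds
because its matrix of blocks is zero beyond the antidiagonal and equals `g` on it. -/

/-! ### Taylor coefficients: Leibniz rule, shifts, and dependence on parameters. -/

section TaylorAlgebra

variable {E : Type*} [NormedAddCommGroup E] [NormedSpace ℝ E]
  {G : Type*} [NormedAddCommGroup G] [NormedSpace ℝ G]
  {H : Type*} [NormedAddCommGroup H] [NormedSpace ℝ H]

theorem taylorCoeff_add {k : ℕ} {c c' : ℝ → E} (hc : ContDiffAt ℝ ∞ c 0)
    (hc' : ContDiffAt ℝ ∞ c' 0) :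
    taylorCoeff k (fun t => c t + c' t) = taylorCoeff k c + taylorCoeff k c' := by
  have hk : ((k : ℕ∞) : WithTop ℕ∞) ≤ ∞ := by exact_mod_cast le_top
  have h : iteratedDeriv k (fun t => c t + c' t) 0 = _ :=
    iteratedDeriv_add (hc.of_le hk) (hc'.of_le hk)
  rw [taylorCoeff, h, smul_add]
  rfl

theorem taylorCoeff_sum {ι : Type*} {s : Finset ι} {k : ℕ} {c : ι → ℝ → E}
    (hc : ∀ i ∈ s, ContDiffAt ℝ ∞ (c i) 0) :
    taylorCoeff k (fun t => ∑ i ∈ s, c i t) = ∑ i ∈ s, taylorCoeff k (c i) := by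
  have hk : ((k : ℕ∞) : WithTop ℕ∞) ≤ ∞ := by exact_mod_cast le_top
  rw [taylorCoeff, iteratedDeriv_fun_sum fun i hi => (hc i hi).of_le hk, Finset.smul_sum]
  rfl

theorem taylorCoeff_pow_smul_const (k d : ℕ) (v : E) :
    taylorCoeff k (fun t : ℝ => t ^ d • v) = if k = d then v else 0 := by
  have h : iteratedDeriv k (fun t : ℝ => t ^ d • v) 0
      = iteratedDeriv k (fun t : ℝ => t ^ d) 0 • v :=
    iteratedDeriv_smul_const (f := fun t : ℝ => t ^ d) (by fun_prop) v
  rw [taylorCoeff, h, iteratedDeriv_fun_pow_zero]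
  by_cases hkd : k = d
  · subst hkd
    simp [smul_smul, Nat.factorial_ne_zero]
  · simp [hkd]

/-- The Taylor polynomial of a curve has the same Taylor coefficients up to its degree. -/
theorem taylorCoeff_polyCurve_taylorCoeff {r k : ℕ} (hk : k ≤ r) (c : ℝ → E) :
    taylorCoeff k (polyCurve fun j : Fin (r + 1) => taylorCoeff j c) = taylorCoeff k c :=
  taylorCoeff_polyCurve (fun j : Fin (r + 1) => taylorCoeff j c) ⟨k, Nat.lt_succ_of_le hk⟩

theorem taylorCoeff_prodMk {k : ℕ} {c : ℝ → E} {d : ℝ → G} (hc : ContDiffAt ℝ ∞ c 0)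
    (hd : ContDiffAt ℝ ∞ d 0) :
    taylorCoeff k (fun t => (c t, d t)) = (taylorCoeff k c, taylorCoeff k d) := by
  refine Prod.ext ?_ ?_
  · exact (taylorCoeff_clm (hc.prodMk hd) (ContinuousLinearMap.fst ℝ E G)).symm
  · exact (taylorCoeff_clm (hc.prodMk hd) (ContinuousLinearMap.snd ℝ E G)).symm

/-- The Taylor coefficients of a smooth function of two curves depend only on the Taylor
coefficients of the curves. -/
theorem taylorCoeff_bilin_congr {n : ℕ} (B : E →L[ℝ] G →L[ℝ] H) {f f' : ℝ → E} {g g' : ℝ → G}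
    (hf : ContDiffAt ℝ ∞ f 0) (hf' : ContDiffAt ℝ ∞ f' 0) (hg : ContDiffAt ℝ ∞ g 0)
    (hg' : ContDiffAt ℝ ∞ g' 0) (h : ∀ k ≤ n, taylorCoeff k f = taylorCoeff k f')
    (h' : ∀ k ≤ n, taylorCoeff k g = taylorCoeff k g') :
    taylorCoeff n (fun t => B (f t) (g t)) = taylorCoeff n (fun t => B (f' t) (g' t)) := by
  refine taylorCoeff_comp (F := fun z : E × G => B z.1 z.2) (hf.prodMk hg) (hf'.prodMk hg')
    (by fun_prop) fun k hk => ?_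
  rw [taylorCoeff_prodMk hf hg, taylorCoeff_prodMk hf' hg', h k hk, h' k hk]

/-- The Leibniz rule for Taylor coefficients. -/
theorem taylorCoeff_bilin (B : E →L[ℝ] G →L[ℝ] H) {f : ℝ → E} {g : ℝ → G}
    (hf : ContDiffAt ℝ ∞ f 0) (hg : ContDiffAt ℝ ∞ g 0) (n : ℕ) :
    taylorCoeff n (fun t => B (f t) (g t)) =
      ∑ a ∈ Finset.HasAntidiagonal.antidiagonal n, B (taylorCoeff a.1 f) (taylorCoeff a.2 g) := by
  -- Only the `n`-jets of `f` and `g` matter, so both may be replaced by their Taylor polynomials,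
  -- and the coefficient of `t ^ n` can be read off a finite double sum.
  rw [taylorCoeff_bilin_congr B hf (contDiff_polyCurve_right _).contDiffAt hg
    (contDiff_polyCurve_right _).contDiffAt
    (fun k hk => (taylorCoeff_polyCurve_taylorCoeff hk f).symm)
    (fun k hk => (taylorCoeff_polyCurve_taylorCoeff hk g).symm)]
  have h1 : (fun t => B (polyCurve (fun j : Fin (n + 1) => taylorCoeff j f) t)
      (polyCurve (fun j : Fin (n + 1) => taylorCoeff j g) t)) =
      fun t : ℝ => ∑ i : Fin (n + 1), ∑ j : Fin (n + 1),
        t ^ ((i : ℕ) + j) • B (taylorCoeff i f) (taylorCoeff j g) := by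
    funext t
    simp only [polyCurve, map_sum, map_smul, sum_apply, smul_apply, pow_add]
    rw [Finset.sum_comm]
    refine Finset.sum_congr rfl fun i _ => ?_
    rw [Finset.smul_sum]
    refine Finset.sum_congr rfl fun j _ => ?_
    rw [smul_smul, mul_comm]
  rw [h1, taylorCoeff_sum fun i _ => by fun_prop]
  have h2 : ∀ i : Fin (n + 1), taylorCoeff n (fun t : ℝ => ∑ j : Fin (n + 1),
        t ^ ((i : ℕ) + j) • B (taylorCoeff i f) (taylorCoeff j g)) =
        B (taylorCoeff i f) (taylorCoeff (n - i) g) := by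
    intro i
    rw [taylorCoeff_sum fun i _ => by fun_prop]
    simp only [taylorCoeff_pow_smul_const]
    rw [Finset.sum_eq_single ⟨n - i, by omega⟩]
    · rw [if_pos (by simp; omega)]
    · intro b _ hb
      rw [if_neg fun h => hb (Fin.ext (by simp; omega))]
    · simp
  simp only [h2]
  rw [Finset.Nat.sum_antidiagonal_eq_sum_range_succ
    (fun i j => B (taylorCoeff i f) (taylorCoeff j g)),
    Finset.sum_range (fun i => B (taylorCoeff i f) (taylorCoeff (n - i) g))]

/-- The case of the Leibniz rule that produces every index shift below; its zero branch matches the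
convention `f^(k) = 0` for `k < 0`. -/
theorem taylorCoeff_pow_smul {k d : ℕ} {f : ℝ → E} (hf : ContDiffAt ℝ ∞ f 0) :
    taylorCoeff k (fun t => t ^ d • f t) = if d ≤ k then taylorCoeff (k - d) f else 0 := by
  have h1 : ContDiffAt ℝ ∞ (fun t : ℝ => t ^ d) 0 := by fun_prop
  have h2 : ∀ i, taylorCoeff i (fun t : ℝ => t ^ d) = if i = d then 1 else 0 := fun i => by
    simpa using taylorCoeff_pow_smul_const i d (1 : ℝ)
  have h := taylorCoeff_bilin (ContinuousLinearMap.lsmul ℝ ℝ) h1 hf k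
  simp only [ContinuousLinearMap.lsmul_apply, h2] at h
  rw [h]
  split_ifs with hd
  · rw [Finset.sum_eq_single (d, k - d)]
    · simp
    · rintro ⟨i, j⟩ hij hne
      have : i ≠ d := fun e => hne (by
        subst e
        have := Finset.HasAntidiagonal.mem_antidiagonal.1 hij
        simp only at this
        ext <;> simp
        omega)
      simp [this]
    · intro hn
      exact absurd (Finset.HasAntidiagonal.mem_antidiagonal.2 (by simp; omega)) hn
  · refine Finset.sum_eq_zero ?_
    rintro ⟨i, j⟩ hij
    have := Finset.HasAntidiagonal.mem_antidiagonal.1 hij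
    have : i ≠ d := by simp only at this; omega
    simp [this]

/-- Parameter and time derivatives commute. Each step of the induction is one use of the symmetry of
the second derivative; the induction hypothesis is needed at all nearby times because it is
differentiated in `t`. -/
theorem fderiv_iteratedDeriv_param {P : Type*} [NormedAddCommGroup P] [NormedSpace ℝ P]
    {F : P × ℝ → G} {s : Set (P × ℝ)} (hs : IsOpen s) (hF : ContDiffOn ℝ ∞ F s) (k : ℕ) (w : P) :
    ∀ z ∈ s, fderiv ℝ (fun z : P × ℝ => iteratedDeriv k (fun t => F (z.1, t)) z.2) z (w, 0) =
      iteratedDeriv k (fun t => fderiv ℝ F (z.1, t) (w, 0)) z.2 := by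
  have hline : ∀ z : P × ℝ, HasDerivAt (fun t : ℝ => ((z.1, t) : P × ℝ)) ((0 : P), (1 : ℝ)) z.2 :=
    fun z => (hasDerivAt_const z.2 z.1).prodMk (hasDerivAt_id z.2)
  induction k with
  | zero => intro z _; simp
  | succ k ih =>
    intro z hz
    set Φ : P × ℝ → G := fun z => iteratedDeriv k (fun t => F (z.1, t)) z.2 with hΦ
    have hΦs : ContDiffOn ℝ ∞ Φ s := contDiffOn_iteratedDeriv_param hs hF k
    have hd : ∀ y ∈ s, iteratedDeriv (k + 1) (fun t => F (y.1, t)) y.2 = fderiv ℝ Φ y (0, 1) := by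
      intro y hy
      rw [iteratedDeriv_succ]
      exact (((hΦs.contDiffAt (hs.mem_nhds hy)).differentiableAt
        (by simp)).hasFDerivAt.comp_hasDerivAt y.2 (hline y)).deriv
    have e1 : (fun y : P × ℝ => iteratedDeriv (k + 1) (fun t => F (y.1, t)) y.2) =ᶠ[𝓝 z]
        fun y => fderiv ℝ Φ y (0, 1) := by
      filter_upwards [hs.mem_nhds hz] with y hy using hd y hy
    have hΦz : ContDiffAt ℝ ∞ Φ z := hΦs.contDiffAt (hs.mem_nhds hz)
    have hD : DifferentiableAt ℝ (fderiv ℝ Φ) z :=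
      (hΦz.fderiv_right (m := 1) (by norm_cast)).differentiableAt (by simp)
    rw [e1.fderiv_eq, fderiv_clm_apply hD (by fun_prop)]
    have hsymm : IsSymmSndFDerivAt ℝ Φ z := hΦz.isSymmSndFDerivAt (by simp; norm_cast)
    simp only [fderiv_fun_const, Pi.zero_apply, ContinuousLinearMap.comp_zero, zero_add,
      ContinuousLinearMap.flip_apply]
    rw [hsymm, iteratedDeriv_succ]
    have ho : ∀ᶠ t in 𝓝 z.2, ((z.1, t) : P × ℝ) ∈ s := by
      have : ContinuousAt (fun t : ℝ => ((z.1, t) : P × ℝ)) z.2 := by fun_prop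
      exact this (hs.mem_nhds hz)
    have e2 : iteratedDeriv k (fun t => fderiv ℝ F (z.1, t) (w, 0)) =ᶠ[𝓝 z.2]
        fun t => fderiv ℝ Φ (z.1, t) (w, 0) := by
      filter_upwards [ho] with t ht using (ih (z.1, t) ht).symm
    rw [e2.deriv_eq]
    have h3 := (hD.clm_apply (differentiableAt_const ((w, 0) : P × ℝ))).hasFDerivAt
    have h4 := h3.comp_hasDerivAt z.2 (hline z)
    have h5 := h4.deriv
    rw [fderiv_clm_apply hD (by fun_prop)] at h5
    simp only [Function.comp_def] at h5
    rw [h5]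
    simp

/-- The derivative of `v ↦ taylorCoeff k (F ∘ polyCurve v)`. -/
theorem fderiv_taylorCoeff_polyCurve {r : ℕ} {F : E → G} {D : Set E} (hD : IsOpen D)
    (hF : ContDiffOn ℝ ∞ F D) (k : ℕ) {v : Fin (r + 1) → E} (hv : v 0 ∈ D)
    (w : Fin (r + 1) → E) :
    fderiv ℝ (fun v : Fin (r + 1) → E => taylorCoeff k (F ∘ polyCurve v)) v w =
      taylorCoeff k (fun t => fderiv ℝ F (polyCurve v t) (polyCurve w t)) := by
  have hs : IsOpen {z : (Fin (r + 1) → E) × ℝ | polyCurve z.1 z.2 ∈ D} :=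
    hD.preimage contDiff_polyCurve.continuous
  have h1 : ContDiffOn ℝ ∞ (fun z : (Fin (r + 1) → E) × ℝ => F (polyCurve z.1 z.2))
      {z | polyCurve z.1 z.2 ∈ D} := hF.comp contDiff_polyCurve.contDiffOn fun z hz => hz
  have hz : (v, (0 : ℝ)) ∈ {z : (Fin (r + 1) → E) × ℝ | polyCurve z.1 z.2 ∈ D} := by
    simpa [polyCurve_zero] using hv
  have h2 := fderiv_iteratedDeriv_param hs h1 k w (v, 0) hz
  have h3 := (contDiffOn_iteratedDeriv_param hs h1 k).contDiffAt (hs.mem_nhds hz)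
  have h4 : HasFDerivAt (fun v : Fin (r + 1) → E => (v, (0 : ℝ)))
      (ContinuousLinearMap.inl ℝ (Fin (r + 1) → E) ℝ) v := hasFDerivAt_prodMk_left v 0
  have h5 := ((h3.differentiableAt (by simp)).hasFDerivAt.comp v h4).const_smul
    ((k.factorial : ℝ)⁻¹)
  have h6 : HasFDerivAt (fun v : Fin (r + 1) → E => taylorCoeff k (F ∘ polyCurve v)) _ v := h5
  rw [h6.fderiv]
  simp only [smul_apply, ContinuousLinearMap.comp_apply,
    ContinuousLinearMap.inl_apply, h2, taylorCoeff]
  congr 1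
  refine Filter.EventuallyEq.iteratedDeriv_eq k ?_
  have ho : ∀ᶠ t in 𝓝 (0 : ℝ), polyCurve v t ∈ D := by
    refine (contDiff_polyCurve_right v).continuous.continuousAt.eventually (hD.mem_nhds ?_)
    simpa [polyCurve_zero] using hv
  filter_upwards [ho] with t ht
  have hF' : HasFDerivAt F (fderiv ℝ F (polyCurve v t)) (polyCurve v t) :=
    ((hF.contDiffAt (hD.mem_nhds ht)).differentiableAt (by simp)).hasFDerivAt
  have hp : DifferentiableAt ℝ (fun z : (Fin (r + 1) → E) × ℝ => polyCurve z.1 z.2) (v, t) :=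
    contDiff_polyCurve.contDiffAt.differentiableAt (by simp)
  have h7 := HasFDerivAt.comp (v, t) (f := fun z : (Fin (r + 1) → E) × ℝ => polyCurve z.1 z.2)
    hF' hp.hasFDerivAt
  have h8 : fderiv ℝ (fun z : (Fin (r + 1) → E) × ℝ => polyCurve z.1 z.2) (v, t) (w, 0) =
      polyCurve w t := by
    have h9 := HasFDerivAt.comp v (f := fun e => (e, t)) hp.hasFDerivAt (hasFDerivAt_prodMk_left v t)
    -- For fixed `t` the map `v ↦ polyCurve v t` is linear, so its derivative in the direction `w`
    -- is `polyCurve w t`.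
    let L : (Fin (r + 1) → E) →L[ℝ] E :=
      ∑ k : Fin (r + 1), t ^ (k : ℕ) • ContinuousLinearMap.proj k
    have h10 : HasFDerivAt ((fun z : (Fin (r + 1) → E) × ℝ => polyCurve z.1 z.2) ∘
        fun e => (e, t)) L v := by
      have : ((fun z : (Fin (r + 1) → E) × ℝ => polyCurve z.1 z.2) ∘ fun e => (e, t)) = L := by
        funext e
        simp [L, polyCurve, sum_apply]
      rw [this]
      exact L.hasFDerivAt
    have h11 := congrArg (fun A => A w) (h9.unique h10)
    simpa [L, polyCurve, sum_apply] using h11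
  have h12 : HasFDerivAt (fun z : (Fin (r + 1) → E) × ℝ => F (polyCurve z.1 z.2)) _ (v, t) := h7
  rw [h12.fderiv, ContinuousLinearMap.comp_apply, h8]

end TaylorAlgebra

/-! ### Tangent vectors, derivations and Lie brackets in a chart. -/

section ChartCoordinates

variable {E : Type*} [NormedAddCommGroup E] [NormedSpace ℝ E]
  {M : Type*} [TopologicalSpace M] [ChartedSpace E M] [IsManifold 𝓘(ℝ, E) ∞ M]
  {G : Type*} [NormedAddCommGroup G] [NormedSpace ℝ G]

/-- The coordinates of tangent vectors at `x` in the preferred chart at `c`. -/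
noncomputable def chartVec (c x : M) : TangentSpace 𝓘(ℝ, E) x →L[ℝ] E :=
  (trivializationAt E (TangentSpace 𝓘(ℝ, E) : M → Type _) c).continuousLinearMapAt ℝ x

/-- The tangent vector at `x` with given coordinates in the preferred chart at `c`. -/
noncomputable def ofChartVec (c x : M) : E →L[ℝ] TangentSpace 𝓘(ℝ, E) x :=
  (trivializationAt E (TangentSpace 𝓘(ℝ, E) : M → Type _) c).symmL ℝ x

theorem chartVec_ofChartVec {c x : M} (hx : x ∈ (chartAt E c).source) (e : E) :
    chartVec c x (ofChartVec c x e) = e :=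
  (trivializationAt E (TangentSpace 𝓘(ℝ, E) : M → Type _) c).continuousLinearMapAt_symmL
    (by simpa using hx) e

theorem ofChartVec_chartVec {c x : M} (hx : x ∈ (chartAt E c).source)
    (u : TangentSpace 𝓘(ℝ, E) x) : ofChartVec c x (chartVec c x u) = u :=
  (trivializationAt E (TangentSpace 𝓘(ℝ, E) : M → Type _) c).symmL_continuousLinearMapAt
    (by simpa using hx) u

theorem chartVec_eq_mfderiv {c x : M} (hx : x ∈ (chartAt E c).source) :
    chartVec c x = mfderiv 𝓘(ℝ, E) 𝓘(ℝ, E) (extChartAt 𝓘(ℝ, E) c) x :=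
  TangentBundle.continuousLinearMapAt_trivializationAt hx

/-- A tangent space is the model space itself, identified through the preferred chart at its own
base point. Hence an element of `Fin (r + 1) → E` can be used directly as a tangent vector of `T^r
M`. -/
theorem chartVec_self (c : M) (u : TangentSpace 𝓘(ℝ, E) c) : chartVec c c u = u := by
  rw [chartVec_eq_mfderiv (mem_chart_source E c), mfderiv_extChartAt_self]
  rfl

theorem mvfderiv_eq_fderiv {f : M → G} {c x : M} (hx : x ∈ (chartAt E c).source)
    (hf : MDifferentiableAt 𝓘(ℝ, E) 𝓘(ℝ, G) f x) (u : TangentSpace 𝓘(ℝ, E) x) :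
    mvfderiv 𝓘(ℝ, E) f x u =
      fderiv ℝ (f ∘ (chartAt E c).symm) (chartAt E c x) (chartVec c x u) := by
  have hx' : chartAt E c x ∈ (chartAt E c).target := (chartAt E c).map_source hx
  have h1 : MDifferentiableAt 𝓘(ℝ, E) 𝓘(ℝ, E) (chartAt E c) x :=
    mdifferentiableAt_atlas (chart_mem_atlas E c) hx
  have h2 : MDifferentiableAt 𝓘(ℝ, E) 𝓘(ℝ, E) (chartAt E c).symm (chartAt E c x) :=
    mdifferentiableAt_atlas_symm (chart_mem_atlas E c) hx'
  have h3 : MDifferentiableAt 𝓘(ℝ, E) 𝓘(ℝ, G) (f ∘ (chartAt E c).symm) (chartAt E c x) := by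
    refine MDifferentiableAt.comp (chartAt E c x) ?_ h2
    rwa [(chartAt E c).left_inv hx]
  have h4 : f =ᶠ[𝓝 x] (f ∘ (chartAt E c).symm) ∘ chartAt E c := by
    filter_upwards [(chartAt E c).open_source.mem_nhds hx] with y hy
    simp [(chartAt E c).left_inv hy]
  have h5 := mfderiv_comp x h3 h1
  rw [chartVec_eq_mfderiv hx]
  have h6 : (extChartAt 𝓘(ℝ, E) c : M → E) = chartAt E c := by
    simp [mfld_simps]
  have h7 : mfderiv 𝓘(ℝ, E) 𝓘(ℝ, G) f x u =
      (mfderiv 𝓘(ℝ, E) 𝓘(ℝ, G) (f ∘ (chartAt E c).symm) (chartAt E c x))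
        (mfderiv 𝓘(ℝ, E) 𝓘(ℝ, E) (chartAt E c) x u) := by
    rw [h4.mfderiv_eq, h5]
    rfl
  rw [mfderiv_eq_fderiv] at h7
  rw [h6]
  exact h7

theorem contMDiffAt_vectorField_iff {X : VectorFieldOn E M} {c x : M}
    (hx : x ∈ (chartAt E c).source) :
    ContMDiffAt 𝓘(ℝ, E) 𝓘(ℝ, E).tangent ∞
        (fun x => (⟨x, X x⟩ : TangentBundle 𝓘(ℝ, E) M)) x ↔
      ContMDiffAt 𝓘(ℝ, E) 𝓘(ℝ, E) ∞ (fun y => chartVec c y (X y)) x := by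
  have hb : x ∈ (trivializationAt E (TangentSpace 𝓘(ℝ, E) : M → Type _) c).baseSet := by
    simpa using hx
  rw [(trivializationAt E (TangentSpace 𝓘(ℝ, E) : M → Type _) c).contMDiffAt_section_iff hb]
  refine Filter.EventuallyEq.contMDiffAt_iff ?_
  filter_upwards [(trivializationAt E (TangentSpace 𝓘(ℝ, E) : M → Type _) c).open_baseSet.mem_nhds
    hb] with y hy
  rw [chartVec, Trivialization.continuousLinearMapAt_apply, Trivialization.linearMapAt_apply,
    if_pos hy]

theorem contMDiffAt_iff_contDiffAt_chart {f : M → G} {c x : M} (hx : x ∈ (chartAt E c).source) :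
    ContMDiffAt 𝓘(ℝ, E) 𝓘(ℝ, G) ∞ f x ↔
      ContDiffAt ℝ ∞ (f ∘ (chartAt E c).symm) (chartAt E c x) := by
  have hx' : chartAt E c x ∈ (chartAt E c).target := (chartAt E c).map_source hx
  have hφ := (contMDiffOn_chart (I := 𝓘(ℝ, E)) (n := ∞) (x := c)).contMDiffAt
    ((chartAt E c).open_source.mem_nhds hx)
  have hφ' := (contMDiffOn_chart_symm (I := 𝓘(ℝ, E)) (n := ∞) (x := c)).contMDiffAt
    ((chartAt E c).open_target.mem_nhds hx')
  constructor
  · intro h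
    refine ContMDiffAt.contDiffAt (ContMDiffAt.comp (chartAt E c x) ?_ hφ')
    rwa [(chartAt E c).left_inv hx]
  · intro h
    refine (h.contMDiffAt.comp x hφ).congr_of_eventuallyEq ?_
    filter_upwards [(chartAt E c).open_source.mem_nhds hx] with y hy
    simp [(chartAt E c).left_inv hy]

theorem contMDiffAt_mvfderiv_apply {f : M → G} {X : VectorFieldOn E M} {x : M}
    (hf : ContMDiffAt 𝓘(ℝ, E) 𝓘(ℝ, G) ∞ f x)
    (hX : ContMDiffAt 𝓘(ℝ, E) 𝓘(ℝ, E).tangent ∞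
      (fun x => (⟨x, X x⟩ : TangentBundle 𝓘(ℝ, E) M)) x) :
    ContMDiffAt 𝓘(ℝ, E) 𝓘(ℝ, G) ∞ (fun y => mvfderiv 𝓘(ℝ, E) f y (X y)) x := by
  have hx := mem_chart_source E x
  have h1 := (contMDiffAt_iff_contDiffAt_chart hx).1 hf
  have h2 := (contMDiffAt_vectorField_iff hx).1 hX
  have h3 := (contMDiffAt_iff_contDiffAt_chart hx).1 h2
  have h4 : ContDiffAt ℝ ∞ (fderiv ℝ (f ∘ (chartAt E x).symm)) (chartAt E x x) :=
    h1.fderiv_right (by simp)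
  rw [contMDiffAt_iff_contDiffAt_chart hx]
  refine (h4.clm_apply h3).congr_of_eventuallyEq ?_
  -- Being `C^∞` at a point is not an open condition, whereas being `C^1` is; differentiability
  -- nearby is all that the chart formula requires.
  have h5 : ∀ᶠ y in 𝓝 (chartAt E x x), ContDiffAt ℝ 1 (f ∘ (chartAt E x).symm) y :=
    (h1.of_le (m := 1) (by norm_cast)).eventually (by simp)
  filter_upwards [h5, (chartAt E x).open_target.mem_nhds ((chartAt E x).map_source hx)] with y hy hyt
  have hys := (chartAt E x).map_target hyt
  have h6 : MDifferentiableAt 𝓘(ℝ, E) 𝓘(ℝ, G) f ((chartAt E x).symm y) := by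
    have hφ : MDifferentiableAt 𝓘(ℝ, E) 𝓘(ℝ, E) (chartAt E x) ((chartAt E x).symm y) :=
      mdifferentiableAt_atlas (chart_mem_atlas E x) hys
    have h7 : MDifferentiableAt 𝓘(ℝ, E) 𝓘(ℝ, G) (f ∘ (chartAt E x).symm)
        (chartAt E x ((chartAt E x).symm y)) := by
      rw [(chartAt E x).right_inv hyt]
      exact (hy.differentiableAt (by simp)).mdifferentiableAt
    refine (h7.comp _ hφ).congr_of_eventuallyEq ?_
    filter_upwards [(chartAt E x).open_source.mem_nhds hys] with z hz
    simp [(chartAt E x).left_inv hz]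
  simp only [Function.comp_apply]
  rw [mvfderiv_eq_fderiv hys h6, (chartAt E x).right_inv hyt]

theorem contMDiff_derivAlong {f : M → ℝ} {X : VectorFieldOn E M}
    (hf : ContMDiff 𝓘(ℝ, E) 𝓘(ℝ, ℝ) ∞ f) (hX : IsSmoothVF X) :
    ContMDiff 𝓘(ℝ, E) 𝓘(ℝ, ℝ) ∞ (derivAlong X f) :=
  fun x => contMDiffAt_mvfderiv_apply (hf x) (hX x)

theorem contMDiffAt_ofChartVec {c x : M} (hx : x ∈ (chartAt E c).source) (e : E) :
    ContMDiffAt 𝓘(ℝ, E) 𝓘(ℝ, E).tangent ∞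
      (fun x => (⟨x, ofChartVec c x e⟩ : TangentBundle 𝓘(ℝ, E) M)) x := by
  rw [contMDiffAt_vectorField_iff hx]
  refine (contMDiffAt_const (c := e)).congr_of_eventuallyEq ?_
  filter_upwards [(chartAt E c).open_source.mem_nhds hx] with y hy using chartVec_ofChartVec hy e

/-- The bracket on a manifold is the vector-space bracket of the pullbacks by the inverse chart, and
these pullbacks are the component functions of the fields. -/
theorem chartVec_mlieBracket [CompleteSpace E] {X Y : VectorFieldOn E M} (x : M) :
    chartVec x x (VectorField.mlieBracket 𝓘(ℝ, E) X Y x) =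
      VectorField.lieBracket ℝ
        (fun y => chartVec x ((chartAt E x).symm y) (X ((chartAt E x).symm y)))
        (fun y => chartVec x ((chartAt E x).symm y) (Y ((chartAt E x).symm y)))
        (chartAt E x x) := by
  have hx := mem_chart_source E x
  have hpull : ∀ X : VectorFieldOn E M,
      VectorField.mpullbackWithin 𝓘(ℝ, E) 𝓘(ℝ, E) (extChartAt 𝓘(ℝ, E) x).symm X
        (range 𝓘(ℝ, E)) =ᶠ[𝓝 (chartAt E x x)]
      fun y => chartVec x ((chartAt E x).symm y) (X ((chartAt E x).symm y)) := by
    intro X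
    filter_upwards [(chartAt E x).open_target.mem_nhds ((chartAt E x).map_source hx)] with y hy
    have hys := (chartAt E x).map_target hy
    have hy' : y ∈ (extChartAt 𝓘(ℝ, E) x).target := by simpa [mfld_simps] using hy
    rw [VectorField.mpullbackWithin_apply]
    have h1 := mfderivWithin_extChartAt_symm_comp_mfderiv_extChartAt hy'
    have h2 := mfderiv_extChartAt_comp_mfderivWithin_extChartAt_symm hy'
    rw [chartVec_eq_mfderiv hys, ContinuousLinearMap.inverse_eq h1 h2]
    simp only [mfld_simps]
    rfl
  rw [chartVec_eq_mfderiv hx, ← VectorField.mlieBracketWithin_univ,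
    VectorField.mlieBracketWithin_apply]
  rw [mfderiv_extChartAt_self]
  have e : (ContinuousLinearMap.id ℝ E).inverse = ContinuousLinearMap.id ℝ E :=
    ContinuousLinearMap.inverse_id
  refine (congrArg (fun A : E →L[ℝ] E => A _) e).trans ?_
  have h := Filter.EventuallyEq.lieBracket_vectorField_eq (𝕜 := ℝ) (hpull X) (hpull Y)
  have hw : ∀ s : Set E, s = univ → ∀ (V W : E → E) (y : E),
      VectorField.lieBracketWithin ℝ V W s y = VectorField.lieBracket ℝ V W y := by
    rintro s rfl V W y
    rw [VectorField.lieBracketWithin_univ]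
  exact (hw _ (by simp) _ _ _).trans h

/-- The Lie bracket is the commutator of derivations. -/
theorem derivAlong_mlieBracket [CompleteSpace E] {X Y : VectorFieldOn E M} {f : M → ℝ}
    (hX : IsSmoothVF X) (hY : IsSmoothVF Y) (hf : ContMDiff 𝓘(ℝ, E) 𝓘(ℝ, ℝ) ∞ f) (x : M) :
    derivAlong (VectorField.mlieBracket 𝓘(ℝ, E) X Y) f x =
      derivAlong X (derivAlong Y f) x - derivAlong Y (derivAlong X f) x := by
  have hx := mem_chart_source E x
  have hxt := (chartAt E x).map_source hx
  have key : ∀ X : VectorFieldOn E M, ∀ y ∈ (chartAt E x).target,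
      derivAlong X f ((chartAt E x).symm y) = fderiv ℝ (f ∘ (chartAt E x).symm) y
        (chartVec x ((chartAt E x).symm y) (X ((chartAt E x).symm y))) := by
    intro X y hy
    have := mvfderiv_eq_fderiv ((chartAt E x).map_target hy)
      ((hf ((chartAt E x).symm y)).mdifferentiableAt (by simp)) (X ((chartAt E x).symm y))
    rwa [(chartAt E x).right_inv hy] at this
  have h1 := (contMDiffAt_iff_contDiffAt_chart hx).1 (hf x)
  have h4 : DifferentiableAt ℝ (fderiv ℝ (f ∘ (chartAt E x).symm)) (chartAt E x x) :=
    (h1.fderiv_right (m := ∞) (by simp)).differentiableAt (by simp)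
  have hd : ∀ X : VectorFieldOn E M, IsSmoothVF X → DifferentiableAt ℝ
      (fun y => chartVec x ((chartAt E x).symm y) (X ((chartAt E x).symm y))) (chartAt E x x) :=
    fun X hX => ((contMDiffAt_iff_contDiffAt_chart hx).1
      ((contMDiffAt_vectorField_iff hx).1 (hX x))).differentiableAt (by simp)
  have key2 : ∀ X Y : VectorFieldOn E M, IsSmoothVF X → IsSmoothVF Y →
      derivAlong X (derivAlong Y f) x =
      fderiv ℝ (fun y => fderiv ℝ (f ∘ (chartAt E x).symm) y
        (chartVec x ((chartAt E x).symm y) (Y ((chartAt E x).symm y)))) (chartAt E x x)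
        (chartVec x x (X x)) := by
    intro X Y hX hY
    have hm := ((contMDiff_derivAlong hf hY) x).mdifferentiableAt (by simp)
    rw [derivAlong, mvfderiv_eq_fderiv hx hm]
    congr 1
    refine Filter.EventuallyEq.fderiv_eq ?_
    filter_upwards [(chartAt E x).open_target.mem_nhds hxt] with y hy using key Y y hy
  rw [key2 X Y hX hY, key2 Y X hY hX, fderiv_clm_apply h4 (hd X hX), fderiv_clm_apply h4 (hd Y hY),
    derivAlong, mvfderiv_eq_fderiv hx ((hf x).mdifferentiableAt (by simp)), chartVec_mlieBracket,
    VectorField.lieBracket]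
  have hsymm : IsSymmSndFDerivAt ℝ (f ∘ (chartAt E x).symm) (chartAt E x x) :=
    h1.isSymmSndFDerivAt (by simp; norm_cast)
  have hv : ∀ X : VectorFieldOn E M, chartVec x ((chartAt E x).symm (chartAt E x x))
      (X ((chartAt E x).symm (chartAt E x x))) = chartVec x x (X x) := fun X => by
    rw [(chartAt E x).left_inv hx]
  -- The second-order terms of `X (Y f)` and `Y (X f)` agree by symmetry; the remaining first-order
  -- terms form the derivative of `f` along the bracket.
  have := hsymm (chartVec x x (X x)) (chartVec x x (Y x))
  simp only [hv, add_apply, ContinuousLinearMap.comp_apply,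
    ContinuousLinearMap.flip_apply, map_sub]
  rw [this]
  ring

end ChartCoordinates

/-! ### Smoothness criteria for sections of bundles of linear maps. -/

section HomSections

variable {E : Type*} [NormedAddCommGroup E] [NormedSpace ℝ E] [FiniteDimensional ℝ E]
  {M : Type*} [TopologicalSpace M] [ChartedSpace E M] [IsManifold 𝓘(ℝ, E) ∞ M]
  {G : Type*} [NormedAddCommGroup G] [NormedSpace ℝ G]

omit [IsManifold 𝓘(ℝ, E) ∞ M] in
-- In finite dimension a linear map is a finite sum of rank-one maps built from its values on a
-- basis, and this reconstruction is linear in those values.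
theorem contMDiffAt_clm_of_apply {f : M → E →L[ℝ] G} {x : M}
    (h : ∀ e, ContMDiffAt 𝓘(ℝ, E) 𝓘(ℝ, G) ∞ (fun y => f y e) x) :
    ContMDiffAt 𝓘(ℝ, E) 𝓘(ℝ, E →L[ℝ] G) ∞ f x := by
  let b := Module.finBasis ℝ E
  let L : Fin (Module.finrank ℝ E) → (G →L[ℝ] E →L[ℝ] G) := fun i =>
    (ContinuousLinearMap.smulRightL ℝ E G) (LinearMap.toContinuousLinearMap (b.coord i))
  have hf : f = fun y => ∑ i, L i (f y (b i)) := by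
    funext y
    ext e
    have h1 := congrArg (f y) (b.sum_repr e).symm
    rw [map_sum] at h1
    rw [h1]
    simp [L]
  rw [hf]
  refine ContMDiffAt.sum fun i _ => ?_
  exact (L i).contMDiff.contMDiffAt.comp x (h (b i))

variable {V : M → Type*} [TopologicalSpace (TotalSpace G V)]
  [∀ x, AddCommGroup (V x)] [∀ x, Module ℝ (V x)] [∀ x, TopologicalSpace (V x)]
  [∀ x, IsTopologicalAddGroup (V x)] [∀ x, ContinuousSMul ℝ (V x)]
  [FiberBundle G V] [VectorBundle ℝ G V] [ContMDiffVectorBundle ∞ G V 𝓘(ℝ, E)]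

/-- A section of `Hom(TM, V)` is smooth if it maps the coordinate fields of a chart to smooth
sections of `V`. -/
theorem contMDiffAt_hom_of_apply_ofChartVec
    {φ : ∀ x : M, TangentSpace 𝓘(ℝ, E) x →L[ℝ] V x} {x : M}
    (h : ∀ e : E, ContMDiffAt 𝓘(ℝ, E) (𝓘(ℝ, E).prod 𝓘(ℝ, G)) ∞
      (fun y => TotalSpace.mk' G (E := V) y (φ y (ofChartVec x y e))) x) :
    ContMDiffAt 𝓘(ℝ, E) (𝓘(ℝ, E).prod 𝓘(ℝ, E →L[ℝ] G)) ∞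
      (fun y => TotalSpace.mk' (E →L[ℝ] G)
        (E := fun x : M => TangentSpace 𝓘(ℝ, E) x →L[ℝ] V x) y (φ y)) x := by
  rw [contMDiffAt_hom_bundle]
  refine ⟨contMDiffAt_id, contMDiffAt_clm_of_apply fun e => ?_⟩
  have hb : x ∈ (trivializationAt G V x).baseSet := FiberBundle.mem_baseSet_trivializationAt G V x
  refine (((trivializationAt G V x).contMDiffAt_section_iff hb).1 (h e)).congr_of_eventuallyEq ?_
  filter_upwards [(trivializationAt G V x).open_baseSet.mem_nhds hb] with y hy
  change (trivializationAt G V x).continuousLinearMapAt ℝ y (φ y (ofChartVec x y e)) = _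
  rw [Trivialization.continuousLinearMapAt_apply, Trivialization.linearMapAt_apply, if_pos hy]

/-- A field of bilinear forms is a section of `Hom(TM, Hom(TM, ℝ))`, so the preceding criterion
applies twice. -/
theorem contMDiffAt_bilin_of_apply_ofChartVec {g : BilinFieldOn E M} {x : M}
    (h : ∀ e e' : E, ContMDiffAt 𝓘(ℝ, E) 𝓘(ℝ, ℝ) ∞
      (fun y => g y (ofChartVec x y e) (ofChartVec x y e')) x) :
    ContMDiffAt 𝓘(ℝ, E) (𝓘(ℝ, E).prod 𝓘(ℝ, E →L[ℝ] E →L[ℝ] ℝ)) ∞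
    (fun x => TotalSpace.mk' (E →L[ℝ] E →L[ℝ] ℝ)
      (E := fun x : M => TangentSpace 𝓘(ℝ, E) x →L[ℝ] TangentSpace 𝓘(ℝ, E) x →L[ℝ] ℝ) x (g x)) x := by
  refine contMDiffAt_hom_of_apply_ofChartVec
    (V := fun x : M => TangentSpace 𝓘(ℝ, E) x →L[ℝ] ℝ) fun e => ?_
  refine contMDiffAt_hom_of_apply_ofChartVec (V := Bundle.Trivial M ℝ) fun e' => ?_
  rw [contMDiffAt_section]
  exact h e e'

omit [FiniteDimensional ℝ E] in
theorem contMDiffAt_bilin_apply {g : BilinFieldOn E M} (hg : IsPseudoRiemannianMetric g)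
    {X Y : VectorFieldOn E M} {x : M}
    (hX : ContMDiffAt 𝓘(ℝ, E) 𝓘(ℝ, E).tangent ∞
      (fun x => (⟨x, X x⟩ : TangentBundle 𝓘(ℝ, E) M)) x)
    (hY : ContMDiffAt 𝓘(ℝ, E) 𝓘(ℝ, E).tangent ∞
      (fun x => (⟨x, Y x⟩ : TangentBundle 𝓘(ℝ, E) M)) x) :
    ContMDiffAt 𝓘(ℝ, E) 𝓘(ℝ, ℝ) ∞ (fun y => g y (X y) (Y y)) x := by
  have h := ContMDiffAt.clm_bundle_apply₂ (F₁ := E) (F₂ := E) (F₃ := ℝ)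
    (E₁ := (TangentSpace 𝓘(ℝ, E) : M → Type _)) (E₂ := (TangentSpace 𝓘(ℝ, E) : M → Type _))
    (E₃ := Bundle.Trivial M ℝ) (hg.contMDiff x) hX hY
  rw [contMDiffAt_section] at h
  exact h

omit [FiniteDimensional ℝ E] in
theorem mdifferentiableAt_bilin_apply {g : BilinFieldOn E M} (hg : IsPseudoRiemannianMetric g)
    {X Y : VectorFieldOn E M} {x : M}
    (hX : MDifferentiableAt 𝓘(ℝ, E) 𝓘(ℝ, E).tangent
      (fun x => (⟨x, X x⟩ : TangentBundle 𝓘(ℝ, E) M)) x)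
    (hY : MDifferentiableAt 𝓘(ℝ, E) 𝓘(ℝ, E).tangent
      (fun x => (⟨x, Y x⟩ : TangentBundle 𝓘(ℝ, E) M)) x) :
    MDifferentiableAt 𝓘(ℝ, E) 𝓘(ℝ, ℝ) (fun y => g y (X y) (Y y)) x := by
  have h := MDifferentiableAt.clm_bundle_apply₂ (F₁ := E) (F₂ := E) (F₃ := ℝ)
    (E₁ := (TangentSpace 𝓘(ℝ, E) : M → Type _)) (E₂ := (TangentSpace 𝓘(ℝ, E) : M → Type _))
    (E₃ := Bundle.Trivial M ℝ) ((hg.contMDiff x).mdifferentiableAt (by simp)) hX hY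
  rw [mdifferentiableAt_section] at h
  exact h

end HomSections

/-! ### Torsion coupling as the vanishing of a tensor. -/

section TorsionDefect

variable {E : Type*} [NormedAddCommGroup E] [NormedSpace ℝ E] [FiniteDimensional ℝ E]
  {M : Type*} [TopologicalSpace M] [ChartedSpace E M] [IsManifold 𝓘(ℝ, E) ∞ M]

/-- The tensor `X (g(Y, Z)) - Y (g(X, Z)) - g(Y, ∇_X Z) + g(X, ∇_Y Z) - g([X, Y], Z)`, which
vanishes if and only if `(g, ∇)` is torsion coupled. -/
noncomputable def torsionDefect (g : BilinFieldOn E M) (nab : ConnectionOn E M) (x : M)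
    (X Y Z : VectorFieldOn E M) : ℝ :=
  derivAlong X (fun y => g y (Y y) (Z y)) x - derivAlong Y (fun y => g y (X y) (Z y)) x
    - g x (Y x) (covAlong nab X Z x) + g x (X x) (covAlong nab Y Z x)
    - g x (VectorField.mlieBracket 𝓘(ℝ, E) X Y x) (Z x)

/-- The terms `g(∇_X Y, Z)` and `g(∇_Y X, Z)` occur both in the covariant derivatives of `g` and in
the torsion, and cancel. What remains differentiates only `Z` covariantly. -/
theorem torsionCoupled_iff {g : BilinFieldOn E M} {nab : ConnectionOn E M} :
    TorsionCoupled g nab ↔ ∀ X Y Z : VectorFieldOn E M, IsSmoothVF X → IsSmoothVF Y →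
      IsSmoothVF Z → ∀ x, torsionDefect g nab x X Y Z = 0 := by
  have : CompleteSpace E := FiniteDimensional.complete ℝ E
  unfold TorsionCoupled
  refine forall_congr' fun X => forall_congr' fun Y => forall_congr' fun Z =>
    imp_congr_right fun hX => imp_congr_right fun hY => imp_congr_right fun hZ =>
    forall_congr' fun x => ?_
  rw [nab.torsion_apply ((hX x).mdifferentiableAt (by simp)) ((hY x).mdifferentiableAt (by simp)),
    torsionDefect, covDerivBilin, covDerivBilin]
  simp only [covAlong, map_sub, sub_apply]
  constructor <;> intro h <;> linarith

variable {g : BilinFieldOn E M} {nab : ConnectionOn E M}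

omit [FiniteDimensional ℝ E] in
theorem torsionDefect_swap (x : M) (X Y Z : VectorFieldOn E M) :
    torsionDefect g nab x X Y Z = -torsionDefect g nab x Y X Z := by
  rw [torsionDefect, torsionDefect, VectorField.mlieBracket_swap_apply]
  simp only [map_neg, neg_apply]
  ring

/-- For `f X` the term `-Y(f g(X, Z))` contributes `-(Y f) g(X, Z)`, which cancels against the same
quantity coming from `[f X, Y] = f [X, Y] - (Y f) X`. -/
theorem tensorialAt_torsionDefect_left (hg : IsPseudoRiemannianMetric g) {x : M}
    {Y Z : VectorFieldOn E M} (hZ : MDiffAt (T% Z) x) :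
    TensorialAt 𝓘(ℝ, E) E (fun X => torsionDefect g nab x X Y Z) x := by
  have : CompleteSpace E := FiniteDimensional.complete ℝ E
  constructor
  · intro f X hf hX
    have h1 := mvfderiv_mul hf (mdifferentiableAt_bilin_apply hg hX hZ)
    have e : (fun y => g y ((f • X) y) (Z y)) = f * (fun y => g y (X y) (Z y)) := by
      funext y
      simp
    simp only [torsionDefect, derivAlong, covAlong, e, h1, VectorField.mlieBracket_smul_left hf hX]
    simp
    ring
  · intro X X' hX hX'
    have h1 := mvfderiv_add (mdifferentiableAt_bilin_apply hg hX hZ)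
      (mdifferentiableAt_bilin_apply hg hX' hZ)
    have e : (fun y => g y ((X + X') y) (Z y)) =
        (fun y => g y (X y) (Z y)) + (fun y => g y (X' y) (Z y)) := by
      funext y
      simp
    simp only [torsionDefect, derivAlong, covAlong, e, h1, VectorField.mlieBracket_add_left hX hX']
    simp
    ring

/-- Follows from the first argument by antisymmetry. -/
theorem tensorialAt_torsionDefect_middle (hg : IsPseudoRiemannianMetric g) {x : M}
    {X Z : VectorFieldOn E M} (hZ : MDiffAt (T% Z) x) :
    TensorialAt 𝓘(ℝ, E) E (fun Y => torsionDefect g nab x X Y Z) x := by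
  have h := tensorialAt_torsionDefect_left (Y := X) (nab := nab) hg hZ
  constructor
  · intro f Y hf hY
    rw [torsionDefect_swap, torsionDefect_swap x X Y, h.smul hf hY, smul_neg]
  · intro Y Y' hY hY'
    rw [torsionDefect_swap, torsionDefect_swap x X Y, torsionDefect_swap x X Y', h.add hY hY',
      neg_add]

omit [FiniteDimensional ℝ E] in
-- The term `(X f) g(Y, Z)` from the product rule cancels with the one in `g(Y, ∇_X (f Z))`, and
-- likewise with `X` and `Y` exchanged.
theorem tensorialAt_torsionDefect_right (hg : IsPseudoRiemannianMetric g) {x : M}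
    {X Y : VectorFieldOn E M} (hX : MDiffAt (T% X) x) (hY : MDiffAt (T% Y) x) :
    TensorialAt 𝓘(ℝ, E) E (fun Z => torsionDefect g nab x X Y Z) x := by
  constructor
  · intro f Z hf hZ
    have h1 : ∀ X : VectorFieldOn E M, MDiffAt (T% X) x → _ := fun X hX =>
      mvfderiv_mul hf (mdifferentiableAt_bilin_apply hg (X := X) hX hZ)
    have e : ∀ X : VectorFieldOn E M,
        (fun y => g y (X y) ((f • Z) y)) = f * (fun y => g y (X y) (Z y)) := by
      intro X
      funext y
      simp
    simp only [torsionDefect, derivAlong, covAlong, e, h1 X hX, h1 Y hY,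
      nab.isCovariantDerivativeOnUniv.leibniz hZ hf]
    simp
    ring
  · intro Z Z' hZ hZ'
    have h1 : ∀ X : VectorFieldOn E M, MDiffAt (T% X) x → _ := fun X hX =>
      mvfderiv_add (mdifferentiableAt_bilin_apply hg (X := X) hX hZ)
        (mdifferentiableAt_bilin_apply hg hX hZ')
    have e : ∀ X : VectorFieldOn E M, (fun y => g y (X y) ((Z + Z') y)) =
        (fun y => g y (X y) (Z y)) + (fun y => g y (X y) (Z' y)) := by
      intro X
      funext y
      simp
    simp only [torsionDefect, derivAlong, covAlong, e, h1 X hX, h1 Y hY,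
      nab.isCovariantDerivativeOnUniv.add hZ hZ']
    simp
    ring

/-- A tensorial functional factors through a linear map on the tangent space at `x`, and the kernel
of that map contains a spanning set. -/
theorem TensorialAt.eq_zero_of_span {Φ : VectorFieldOn E M → ℝ} {x : M}
    (hΦ : TensorialAt 𝓘(ℝ, E) E Φ x) {S : Set (VectorFieldOn E M)}
    (hS : ∀ W ∈ S, MDiffAt (T% W) x)
    (hspan : Submodule.span ℝ ((fun W : VectorFieldOn E M => W x) '' S) = ⊤)
    (h0 : ∀ W ∈ S, Φ W = 0) {X : VectorFieldOn E M} (hX : MDiffAt (T% X) x) : Φ X = 0 := by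
  rw [← hΦ.mkHom_apply hX]
  have hle : Submodule.span ℝ ((fun W : VectorFieldOn E M => W x) '' S) ≤
      LinearMap.ker (TensorialAt.mkHom Φ x hΦ).toLinearMap := by
    rw [Submodule.span_le]
    rintro _ ⟨W, hW, rfl⟩
    change TensorialAt.mkHom Φ x hΦ (W x) = 0
    rw [hΦ.mkHom_apply (hS W hW), h0 W hW]
  have : X x ∈ LinearMap.ker (TensorialAt.mkHom Φ x hΦ).toLinearMap :=
    hle (hspan ▸ Submodule.mem_top)
  exact this

theorem torsionDefect_eq_zero_of_span (hg : IsPseudoRiemannianMetric g) {x : M}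
    {S : Set (VectorFieldOn E M)} (hS : ∀ W ∈ S, MDiffAt (T% W) x)
    (hspan : Submodule.span ℝ ((fun W : VectorFieldOn E M => W x) '' S) = ⊤)
    (h0 : ∀ X ∈ S, ∀ Y ∈ S, ∀ Z ∈ S, torsionDefect g nab x X Y Z = 0)
    {X Y Z : VectorFieldOn E M} (hX : MDiffAt (T% X) x) (hY : MDiffAt (T% Y) x)
    (hZ : MDiffAt (T% Z) x) : torsionDefect g nab x X Y Z = 0 :=
  (tensorialAt_torsionDefect_left hg hZ).eq_zero_of_span hS hspan (fun X' hX' =>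
    (tensorialAt_torsionDefect_middle hg hZ).eq_zero_of_span hS hspan (fun Y' hY' =>
      (tensorialAt_torsionDefect_right hg (hS _ hX') (hS _ hY')).eq_zero_of_span hS hspan
        (fun Z' hZ' => h0 X' hX' Y' hY' Z' hZ') hZ) hY) hX

end TorsionDefect

/-! ### Functions and tangent vectors of `T^r M` in jet coordinates. -/

section JetCoordinates

variable {E : Type*} [NormedAddCommGroup E] [NormedSpace ℝ E] [FiniteDimensional ℝ E]
  {M : Type*} [TopologicalSpace M] [ChartedSpace E M] [IsManifold 𝓘(ℝ, E) ∞ M] [T2Space M]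
  {G : Type*} [NormedAddCommGroup G] [NormedSpace ℝ G] {r : ℕ}

theorem chartAt_higherTangentBundle_zero {p q : HigherTangentBundle E M r} :
    chartAt (Fin (r + 1) → E) p q 0 = chartAt E p.proj q.proj := by
  change taylorCoeff _ _ = _
  simp [taylorCoeff_zero, HigherTangentBundle.proj]

omit [FiniteDimensional ℝ E] [T2Space M] in
/-- Smoothness of a map in a chart. -/
theorem ContMDiffOn.contDiffOn_comp_chart_symm {f : M → G} {s : Set M} (hs : IsOpen s)
    (hf : ContMDiffOn 𝓘(ℝ, E) 𝓘(ℝ, G) ∞ f s) (c : M) :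
    ContDiffOn ℝ ∞ (f ∘ (chartAt E c).symm)
      ((chartAt E c).target ∩ (chartAt E c).symm ⁻¹' s) := by
  rintro y ⟨hy, hy'⟩
  have := (contMDiffAt_iff_contDiffAt_chart ((chartAt E c).map_target hy)).1
    ((hf _ hy').contMDiffAt (hs.mem_nhds hy'))
  rw [(chartAt E c).right_inv hy] at this
  exact this.contDiffWithinAt

/-- The representative `q.rep` is an arbitrary choice. Replacing it by the polynomial curve in a
fixed chart makes the dependence on `q` an explicit smooth function of its coordinates. -/
theorem taylorCoeff_comp_rep {s : Set M} (hs : IsOpen s) {f : M → G}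
    (hf : ContMDiffOn 𝓘(ℝ, E) 𝓘(ℝ, G) ∞ f s) {p q : HigherTangentBundle E M r} (hq : q.proj ∈ s)
    (hqp : q.proj ∈ (chartAt E p.proj).source) {k : ℕ} (hk : k ≤ r) :
    taylorCoeff k (f ∘ q.rep) =
      taylorCoeff k ((f ∘ (chartAt E p.proj).symm) ∘
        polyCurve (chartAt (Fin (r + 1) → E) p q)) := by
  have hv : chartAt (Fin (r + 1) → E) p q 0 ∈ (chartAt E p.proj).target := by
    rw [chartAt_higherTangentBundle_zero]
    exact (chartAt E p.proj).map_source hqp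
  obtain ⟨γ, h1, h2⟩ := exists_jetChart_symm (r := r) p.proj hv
  have h3 : (jetChart r p.proj).symm (chartAt (Fin (r + 1) → E) p q) = q :=
    (chartAt (Fin (r + 1) → E) p).left_inv hqp
  have h4 : jet r q.rep = jet r γ := by rw [jet_rep, ← h2, h3]
  rw [taylorCoeff_eq_of_jet_eq hs hf h4 hq hk]
  apply taylorCoeff_congr
  filter_upwards [h1] with t ht
  simp [ht]

theorem contMDiffAt_taylorCoeff_comp_rep {s : Set M} (hs : IsOpen s) {f : M → G}
    (hf : ContMDiffOn 𝓘(ℝ, E) 𝓘(ℝ, G) ∞ f s) {p : HigherTangentBundle E M r} (hp : p.proj ∈ s)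
    {k : ℕ} (hk : k ≤ r) :
    ContMDiffAt 𝓘(ℝ, Fin (r + 1) → E) 𝓘(ℝ, G) ∞
      (fun q : HigherTangentBundle E M r => taylorCoeff k (f ∘ q.rep)) p := by
  have hpp := mem_chart_source (Fin (r + 1) → E) p
  have hD : IsOpen ((chartAt E p.proj).target ∩ (chartAt E p.proj).symm ⁻¹' s) :=
    (chartAt E p.proj).symm.isOpen_inter_preimage hs
  rw [contMDiffAt_iff_contDiffAt_chart hpp]
  have h1 := contDiffOn_taylorCoeff_polyCurve (r := r) hD
    (hf.contDiffOn_comp_chart_symm hs p.proj) k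
  have h0 : chartAt (Fin (r + 1) → E) p p 0 ∈
      (chartAt E p.proj).target ∩ (chartAt E p.proj).symm ⁻¹' s := by
    rw [chartAt_higherTangentBundle_zero]
    refine ⟨(chartAt E p.proj).map_source (mem_chart_source E _), ?_⟩
    rwa [mem_preimage, (chartAt E p.proj).left_inv (mem_chart_source E _)]
  have hD' : {v : Fin (r + 1) → E | v 0 ∈
      (chartAt E p.proj).target ∩ (chartAt E p.proj).symm ⁻¹' s} ∈
      𝓝 (chartAt (Fin (r + 1) → E) p p) :=
    (hD.preimage (continuous_apply 0)).mem_nhds h0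
  refine (h1.contDiffAt hD').congr_of_eventuallyEq ?_
  filter_upwards [hD'] with v hv
  have hv1 : v ∈ (chartAt (Fin (r + 1) → E) p).target := hv.1
  have hpr : ((chartAt (Fin (r + 1) → E) p).symm v).proj = (chartAt E p.proj).symm (v 0) :=
    proj_jetChart_symm p.proj hv.1
  have := taylorCoeff_comp_rep (r := r) (p := p) (q := (chartAt (Fin (r + 1) → E) p).symm v)
    hs hf (by rw [hpr]; exact hv.2) (by rw [hpr]; exact (chartAt E p.proj).map_target hv.1) hk
  rw [(chartAt (Fin (r + 1) → E) p).right_inv hv1] at this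
  exact this

/-- Differentiation under the Taylor coefficient: a tangent vector enters as the polynomial curve
`polyCurve (chartVec p q u)` in `E`, along which the derivative of `f` is taken pointwise in `t`. -/
theorem mvfderiv_taylorCoeff_comp_rep {s : Set M} (hs : IsOpen s) {f : M → G}
    (hf : ContMDiffOn 𝓘(ℝ, E) 𝓘(ℝ, G) ∞ f s) {p q : HigherTangentBundle E M r} (hq : q.proj ∈ s)
    (hqp : q.proj ∈ (chartAt E p.proj).source) {k : ℕ} (hk : k ≤ r)
    (u : TangentSpace 𝓘(ℝ, Fin (r + 1) → E) q) :
    mvfderiv 𝓘(ℝ, Fin (r + 1) → E)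
        (fun q : HigherTangentBundle E M r => taylorCoeff k (f ∘ q.rep)) q u =
      taylorCoeff k (fun t => fderiv ℝ (f ∘ (chartAt E p.proj).symm)
        (polyCurve (chartAt (Fin (r + 1) → E) p q) t) (polyCurve (chartVec p q u) t)) := by
  have hD : IsOpen ((chartAt E p.proj).target ∩ (chartAt E p.proj).symm ⁻¹' s) :=
    (chartAt E p.proj).symm.isOpen_inter_preimage hs
  have h0 : chartAt (Fin (r + 1) → E) p q 0 ∈
      (chartAt E p.proj).target ∩ (chartAt E p.proj).symm ⁻¹' s := by
    rw [chartAt_higherTangentBundle_zero]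
    refine ⟨(chartAt E p.proj).map_source hqp, ?_⟩
    rwa [mem_preimage, (chartAt E p.proj).left_inv hqp]
  have hD' : {v : Fin (r + 1) → E | v 0 ∈
      (chartAt E p.proj).target ∩ (chartAt E p.proj).symm ⁻¹' s} ∈
      𝓝 (chartAt (Fin (r + 1) → E) p q) :=
    (hD.preimage (continuous_apply 0)).mem_nhds h0
  rw [mvfderiv_eq_fderiv (c := p) hqp
    ((contMDiffAt_taylorCoeff_comp_rep hs hf hq hk).mdifferentiableAt (by simp)),
    ← fderiv_taylorCoeff_polyCurve hD (hf.contDiffOn_comp_chart_symm hs p.proj) k h0]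
  congr 1
  refine Filter.EventuallyEq.fderiv_eq ?_
  filter_upwards [hD'] with v hv
  have hv1 : v ∈ (chartAt (Fin (r + 1) → E) p).target := hv.1
  have hpr : ((chartAt (Fin (r + 1) → E) p).symm v).proj = (chartAt E p.proj).symm (v 0) :=
    proj_jetChart_symm p.proj hv.1
  have := taylorCoeff_comp_rep (r := r) (p := p) (q := (chartAt (Fin (r + 1) → E) p).symm v)
    hs hf (by rw [hpr]; exact hv.2) (by rw [hpr]; exact (chartAt E p.proj).map_target hv.1) hk
  rw [(chartAt (Fin (r + 1) → E) p).right_inv hv1] at this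
  exact this

omit [FiniteDimensional ℝ E] [IsManifold 𝓘(ℝ, E) ∞ M] [T2Space M] in
theorem liftFun_natCast (m : ℕ) (f : M → ℝ) :
    liftFun r (m : ℤ) f = fun q : HigherTangentBundle E M r => taylorCoeff m (f ∘ q.rep) := by
  funext q
  simp [liftFun]

omit [FiniteDimensional ℝ E] [IsManifold 𝓘(ℝ, E) ∞ M] [T2Space M] in
theorem liftFun_of_neg {k : ℤ} (hk : k < 0) (f : M → ℝ) :
    liftFun (E := E) r k f = fun _ => 0 := by
  funext q
  simp [liftFun, hk]

theorem contMDiff_liftFun {k : ℤ} (hk : k ≤ r) {f : M → ℝ}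
    (hf : ContMDiff 𝓘(ℝ, E) 𝓘(ℝ, ℝ) ∞ f) :
    ContMDiff 𝓘(ℝ, Fin (r + 1) → E) 𝓘(ℝ, ℝ) ∞ (liftFun (E := E) r k f) := by
  by_cases h : k < 0
  · rw [liftFun_of_neg h]
    exact contMDiff_const
  · lift k to ℕ using not_lt.1 h
    rw [liftFun_natCast]
    exact fun p => contMDiffAt_taylorCoeff_comp_rep isOpen_univ hf.contMDiffOn (mem_univ _)
      (by exact_mod_cast hk)

/-- Lifts are specified through globally defined smooth functions, so coordinates must be extended
from a neighbourhood of `c` to all of `M` before they can serve as test functions. -/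
theorem exists_contMDiff_eventuallyEq_chart (c : M) (l : E →L[ℝ] G) :
    ∃ f : M → G, ContMDiff 𝓘(ℝ, E) 𝓘(ℝ, G) ∞ f ∧ f =ᶠ[𝓝 c] fun x => l (chartAt E c x) :=
  exists_global_extension (chartAt E c).open_source
    (l.contMDiff.comp_contMDiffOn (contMDiffOn_chart (I := 𝓘(ℝ, E)) (n := ∞) (x := c)))
    (mem_chart_source E c)

theorem eventually_proj {p : HigherTangentBundle E M r} {P : M → Prop}
    (h : ∀ᶠ x in 𝓝 p.proj, P x) : ∀ᶠ q in 𝓝 p, P q.proj :=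
  continuous_proj.continuousAt.eventually h

/-- The lifts of a coordinate function are coordinate functions. -/
theorem eventually_mvfderiv_liftFun_eq {p : HigherTangentBundle E M r} {l : E →L[ℝ] ℝ}
    {f : M → ℝ} (hf : ContMDiff 𝓘(ℝ, E) 𝓘(ℝ, ℝ) ∞ f)
    (hfl : f =ᶠ[𝓝 p.proj] fun x => l (chartAt E p.proj x)) :
    ∀ᶠ q in 𝓝 p, ∀ (u : TangentSpace 𝓘(ℝ, Fin (r + 1) → E) q) (m : Fin (r + 1)),
      mvfderiv 𝓘(ℝ, Fin (r + 1) → E) (liftFun r (m : ℕ) f) q u = l (chartVec p q u m) := by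
  filter_upwards [eventually_proj (eventually_eventually_nhds.2 hfl),
    eventually_proj ((chartAt E p.proj).open_source.mem_nhds (mem_chart_source E _))]
    with q hq hqs u m
  rw [liftFun_natCast, mvfderiv_taylorCoeff_comp_rep isOpen_univ hf.contMDiffOn (mem_univ _) hqs
    (Nat.lt_succ_iff.1 m.2)]
  have hqt := (chartAt E p.proj).map_source hqs
  have h1 : ∀ᶠ y in 𝓝 (chartAt E p.proj q.proj), f ((chartAt E p.proj).symm y) = l y := by
    have hc := ((chartAt E p.proj).symm.continuousAt hqt)
    rw [ContinuousAt, (chartAt E p.proj).left_inv hqs] at hc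
    filter_upwards [hc.eventually hq, (chartAt E p.proj).open_target.mem_nhds hqt] with y hy hyt
    rw [hy, (chartAt E p.proj).right_inv hyt]
  -- The derivative of `f` in the chart must be known at each `polyCurve … t`, so `f = l` is
  -- required on a neighbourhood of each such point and not merely along the curve.
  have h2 : ∀ᶠ t in 𝓝 (0 : ℝ), ∀ᶠ y in 𝓝 (polyCurve (chartAt (Fin (r + 1) → E) p q) t),
      f ((chartAt E p.proj).symm y) = l y := by
    have h0 := (contDiff_polyCurve_right (chartAt (Fin (r + 1) → E) p q)).continuous.tendsto 0
    rw [polyCurve_zero, chartAt_higherTangentBundle_zero] at h0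
    exact h0.eventually (eventually_eventually_nhds.2 h1)
  have h3 : (fun t => fderiv ℝ (f ∘ (chartAt E p.proj).symm)
      (polyCurve (chartAt (Fin (r + 1) → E) p q) t) (polyCurve (chartVec p q u) t)) =ᶠ[𝓝 0]
      fun t => l (polyCurve (chartVec p q u) t) := by
    filter_upwards [h2] with t ht
    have : (f ∘ (chartAt E p.proj).symm) =ᶠ[𝓝 (polyCurve (chartAt (Fin (r + 1) → E) p q) t)] l := ht
    rw [this.fderiv_eq, l.fderiv]
  rw [taylorCoeff_congr h3, taylorCoeff_clm (contDiff_polyCurve_right _).contDiffAt,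
    taylorCoeff_polyCurve]

/-- The lifts of functions separate the tangent vectors. -/
theorem eq_of_mvfderiv_liftFun_eq {p : HigherTangentBundle E M r}
    {u u' : TangentSpace 𝓘(ℝ, Fin (r + 1) → E) p}
    (h : ∀ f : M → ℝ, ContMDiff 𝓘(ℝ, E) 𝓘(ℝ, ℝ) ∞ f → ∀ m : ℕ, m ≤ r →
      mvfderiv 𝓘(ℝ, Fin (r + 1) → E) (liftFun r m f) p u =
      mvfderiv 𝓘(ℝ, Fin (r + 1) → E) (liftFun r m f) p u') : u = u' := by
  rw [← chartVec_self p u, ← chartVec_self p u']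
  funext m
  refine (SeparatingDual.eq_iff_forall_dual_eq (R := ℝ)).2 fun l => ?_
  obtain ⟨f, hf, hfl⟩ := exists_contMDiff_eventuallyEq_chart p.proj l
  have := (eventually_mvfderiv_liftFun_eq hf hfl).self_of_nhds
  exact (this u m).symm.trans ((h f hf m (Nat.lt_succ_iff.1 m.2)).trans (this u' m))

theorem contMDiffAt_of_forall_dual {N F : Type*} [NormedAddCommGroup F] [NormedSpace ℝ F]
    [TopologicalSpace N] [ChartedSpace F N] {f : N → E} {x : N}
    (h : ∀ l : E →L[ℝ] ℝ, ContMDiffAt 𝓘(ℝ, F) 𝓘(ℝ, ℝ) ∞ (fun y => l (f y)) x) :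
    ContMDiffAt 𝓘(ℝ, F) 𝓘(ℝ, E) ∞ f x := by
  let b := Module.finBasis ℝ E
  have hf : f = fun y => ∑ i, (LinearMap.toContinuousLinearMap (b.coord i)) (f y) • b i := by
    funext y
    exact (b.sum_repr (f y)).symm
  rw [hf]
  exact ContMDiffAt.sum fun i _ => (h _).smul contMDiffAt_const

/-- A vector field on `T^r M` is smooth if its derivatives of lifts of functions are smooth. -/
theorem contMDiffAt_vectorField_of_derivAlong_liftFun
    {X' : VectorFieldOn (Fin (r + 1) → E) (HigherTangentBundle E M r)}
    {p : HigherTangentBundle E M r}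
    (h : ∀ f : M → ℝ, ContMDiff 𝓘(ℝ, E) 𝓘(ℝ, ℝ) ∞ f → ∀ m : ℕ, m ≤ r →
      ContMDiffAt 𝓘(ℝ, Fin (r + 1) → E) 𝓘(ℝ, ℝ) ∞ (derivAlong X' (liftFun r m f)) p) :
    ContMDiffAt 𝓘(ℝ, Fin (r + 1) → E) 𝓘(ℝ, Fin (r + 1) → E).tangent ∞
      (fun x => (⟨x, X' x⟩ : TangentBundle 𝓘(ℝ, Fin (r + 1) → E) (HigherTangentBundle E M r))) p := by
  rw [contMDiffAt_vectorField_iff (mem_chart_source _ p), contMDiffAt_pi_space]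
  intro m
  refine contMDiffAt_of_forall_dual fun l => ?_
  obtain ⟨f, hf, hfl⟩ := exists_contMDiff_eventuallyEq_chart p.proj l
  refine (h f hf m (Nat.lt_succ_iff.1 m.2)).congr_of_eventuallyEq ?_
  filter_upwards [eventually_mvfderiv_liftFun_eq hf hfl] with q hq using (hq (X' q) m).symm

end JetCoordinates

/-! ### Lifts of vector fields: existence, uniqueness and coordinate frames. -/

section VectorFieldLifts

variable {E : Type*} [NormedAddCommGroup E] [NormedSpace ℝ E] [FiniteDimensional ℝ E]
  {M : Type*} [TopologicalSpace M] [ChartedSpace E M] [IsManifold 𝓘(ℝ, E) ∞ M] [T2Space M]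
  {G : Type*} [NormedAddCommGroup G] [NormedSpace ℝ G] {r : ℕ}

/-- The polynomial curve in the preferred chart at `p.proj` which represents `p`. -/
noncomputable def chartCurve (p : HigherTangentBundle E M r) : ℝ → E :=
  polyCurve (chartAt (Fin (r + 1) → E) p p)

theorem contDiff_chartCurve (p : HigherTangentBundle E M r) : ContDiff ℝ ∞ (chartCurve p) :=
  contDiff_polyCurve_right _

theorem chartCurve_zero (p : HigherTangentBundle E M r) :
    chartCurve p 0 = chartAt E p.proj p.proj := by
  rw [chartCurve, polyCurve_zero, chartAt_higherTangentBundle_zero]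

theorem eventually_chartCurve {p : HigherTangentBundle E M r} {s : Set M} (hs : IsOpen s)
    (hp : p.proj ∈ s) :
    ∀ᶠ t in 𝓝 (0 : ℝ), chartCurve p t ∈ (chartAt E p.proj).target ∧
      (chartAt E p.proj).symm (chartCurve p t) ∈ s := by
  have hD : IsOpen ((chartAt E p.proj).target ∩ (chartAt E p.proj).symm ⁻¹' s) :=
    (chartAt E p.proj).symm.isOpen_inter_preimage hs
  refine (contDiff_chartCurve p).continuous.continuousAt.eventually (hD.mem_nhds ?_)
  rw [chartCurve_zero]
  refine ⟨(chartAt E p.proj).map_source (mem_chart_source E _), ?_⟩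
  rwa [mem_preimage, (chartAt E p.proj).left_inv (mem_chart_source E _)]

theorem contDiffAt_comp_chartCurve {p : HigherTangentBundle E M r} {F : E → G}
    (hF : ContDiffAt ℝ ∞ F (chartAt E p.proj p.proj)) :
    ContDiffAt ℝ ∞ (fun t => F (chartCurve p t)) 0 :=
  ContDiffAt.comp (0 : ℝ) (by rwa [chartCurve_zero]) (contDiff_chartCurve p).contDiffAt

theorem taylorCoeff_comp_rep_eq_chartCurve {s : Set M} (hs : IsOpen s) {f : M → G}
    (hf : ContMDiffOn 𝓘(ℝ, E) 𝓘(ℝ, G) ∞ f s) {p : HigherTangentBundle E M r} (hp : p.proj ∈ s)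
    {k : ℕ} (hk : k ≤ r) :
    taylorCoeff k (f ∘ p.rep) =
      taylorCoeff k (fun t => f ((chartAt E p.proj).symm (chartCurve p t))) :=
  taylorCoeff_comp_rep hs hf hp (mem_chart_source E _) hk

/-- The derivative of a Taylor coefficient of a function along a tangent vector represented by a
curve. -/
theorem mvfderiv_taylorCoeff_of_taylorCoeff {p : HigherTangentBundle E M r} {s : Set M}
    (hs : IsOpen s) {f : M → G} (hf : ContMDiffOn 𝓘(ℝ, E) 𝓘(ℝ, G) ∞ f s) (hp : p.proj ∈ s)
    {u : Fin (r + 1) → E} {h : ℝ → E} (hh : ContDiffAt ℝ ∞ h 0)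
    (hu : ∀ j : Fin (r + 1), u j = taylorCoeff j h) {m : ℕ} (hm : m ≤ r) :
    mvfderiv 𝓘(ℝ, Fin (r + 1) → E)
        (fun q : HigherTangentBundle E M r => taylorCoeff m (f ∘ q.rep)) p u =
      taylorCoeff m (fun t => fderiv ℝ (f ∘ (chartAt E p.proj).symm) (chartCurve p t) (h t)) := by
  refine (mvfderiv_taylorCoeff_comp_rep hs hf hp (mem_chart_source E p.proj) hm u).trans ?_
  rw [chartVec_self p u]
  have h1 : ContDiffAt ℝ ∞ (fderiv ℝ (f ∘ (chartAt E p.proj).symm)) (chartAt E p.proj p.proj) :=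
    ((contMDiffAt_iff_contDiffAt_chart (mem_chart_source E _)).1
      (hf.contMDiffAt (hs.mem_nhds hp))).fderiv_right (by simp)
  have h2 := contDiffAt_comp_chartCurve h1
  refine taylorCoeff_bilin_congr (ContinuousLinearMap.id ℝ (E →L[ℝ] G)) h2 h2
    (contDiff_polyCurve_right u).contDiffAt hh (fun k _ => rfl) fun k hk => ?_
  rw [← hu ⟨k, by omega⟩]
  exact taylorCoeff_polyCurve u ⟨k, by omega⟩

/-- The derivative of the lift of a function along a tangent vector represented by a curve `h`. -/
theorem mvfderiv_liftFun_of_taylorCoeff {f : M → ℝ} (hf : ContMDiff 𝓘(ℝ, E) 𝓘(ℝ, ℝ) ∞ f)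
    {p : HigherTangentBundle E M r} {u : Fin (r + 1) → E} {h : ℝ → E} (hh : ContDiffAt ℝ ∞ h 0)
    (hu : ∀ j : Fin (r + 1), u j = taylorCoeff j h) {m : ℕ} (hm : m ≤ r) :
    mvfderiv 𝓘(ℝ, Fin (r + 1) → E) (liftFun r m f) p u =
      taylorCoeff m (fun t => fderiv ℝ (f ∘ (chartAt E p.proj).symm) (chartCurve p t) (h t)) := by
  rw [liftFun_natCast]
  exact mvfderiv_taylorCoeff_of_taylorCoeff isOpen_univ hf.contMDiffOn (mem_univ _) hh hu hm

/-- The components of a vector field in the preferred chart at `c`. -/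
noncomputable def vfCoord (c : M) (X : VectorFieldOn E M) (x : M) : E := chartVec c x (X x)

omit [FiniteDimensional ℝ E] [T2Space M] in
theorem contMDiffOn_vfCoord {X : VectorFieldOn E M} (hX : IsSmoothVF X) (c : M) :
    ContMDiffOn 𝓘(ℝ, E) 𝓘(ℝ, E) ∞ (vfCoord c X) (chartAt E c).source :=
  fun x hx => ((contMDiffAt_vectorField_iff hx).1 (hX x)).contMDiffWithinAt

omit [FiniteDimensional ℝ E] [T2Space M] in
theorem contDiffAt_vfCoord {X : VectorFieldOn E M} (hX : IsSmoothVF X) (c : M) :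
    ContDiffAt ℝ ∞ (fun y => vfCoord c X ((chartAt E c).symm y)) (chartAt E c c) :=
  (contMDiffAt_iff_contDiffAt_chart (mem_chart_source E c)).1
    ((contMDiffAt_vectorField_iff (mem_chart_source E c)).1 (hX c))

/-- The lift `X^(r - d)` of a vector field. -/
noncomputable def liftVF (r d : ℕ) (X : VectorFieldOn E M) :
    VectorFieldOn (Fin (r + 1) → E) (HigherTangentBundle E M r) :=
  fun p (j : Fin (r + 1)) => taylorCoeff j (fun t => t ^ d • vfCoord p.proj X (p.rep t))

omit [FiniteDimensional ℝ E] [T2Space M] in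
theorem contDiffAt_vfCoord_rep {X : VectorFieldOn E M} (hX : IsSmoothVF X)
    {p q : HigherTangentBundle E M r} (hq : q.proj ∈ (chartAt E p.proj).source) :
    ContDiffAt ℝ ∞ (fun t => vfCoord p.proj X (q.rep t)) 0 :=
  contDiffAt_comp_curve q.rep ((contMDiffAt_vectorField_iff hq).1 (hX _))

/-- Trades the chosen representative for `chartCurve p`, so that the lift is visibly the jet of the
curve `t ^ d • X` along `chartCurve p`. -/
theorem liftVF_apply {X : VectorFieldOn E M} (hX : IsSmoothVF X) (d : ℕ)
    (p : HigherTangentBundle E M r) (j : Fin (r + 1)) :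
    (show Fin (r + 1) → E from liftVF r d X p) j =
      taylorCoeff j (fun t => t ^ d • vfCoord p.proj X ((chartAt E p.proj).symm (chartCurve p t))) := by
  refine (taylorCoeff_pow_smul (contDiffAt_vfCoord_rep hX (mem_chart_source E p.proj))).trans ?_
  rw [taylorCoeff_pow_smul (contDiffAt_comp_chartCurve (contDiffAt_vfCoord hX p.proj))]
  split_ifs with h
  · exact taylorCoeff_comp_rep_eq_chartCurve (chartAt E p.proj).open_source
      (contMDiffOn_vfCoord hX p.proj) (mem_chart_source E _) (by omega)
  · rfl

/-- The factor `t ^ d` treats nonnegative and negative indices `m - d` uniformly; most index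
bookkeeping reduces to this form. -/
theorem liftFun_eq_taylorCoeff_pow_smul {f : M → ℝ} (hf : ContMDiff 𝓘(ℝ, E) 𝓘(ℝ, ℝ) ∞ f)
    {d m : ℕ} (hm : m ≤ r) (p : HigherTangentBundle E M r) :
    liftFun r ((m : ℤ) - d) f p =
      taylorCoeff m (fun t => t ^ d • f ((chartAt E p.proj).symm (chartCurve p t))) := by
  rw [taylorCoeff_pow_smul (contDiffAt_comp_chartCurve
    (F := fun y => f ((chartAt E p.proj).symm y))
    ((contMDiffAt_iff_contDiffAt_chart (mem_chart_source E _)).1 (hf p.proj)))]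
  split_ifs with h
  · rw [← taylorCoeff_comp_rep_eq_chartCurve isOpen_univ hf.contMDiffOn (mem_univ _) (by omega),
      ← Nat.cast_sub h, liftFun_natCast]
  · rw [liftFun_of_neg (by omega)]

/-- Along the curve `t ^ d X(γ(t))` the derivative of `f` is `t ^ d (X f)(γ(t))`; take the
coefficient of `t ^ m`. -/
theorem derivAlong_liftVF {X : VectorFieldOn E M} (hX : IsSmoothVF X) {f : M → ℝ}
    (hf : ContMDiff 𝓘(ℝ, E) 𝓘(ℝ, ℝ) ∞ f) (d : ℕ) {m : ℕ} (hm : m ≤ r) :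
    derivAlong (liftVF r d X) (liftFun r m f) = liftFun r ((m : ℤ) - d) (derivAlong X f) := by
  funext p
  rw [liftFun_eq_taylorCoeff_pow_smul (contMDiff_derivAlong hf hX) hm]
  refine (mvfderiv_liftFun_of_taylorCoeff hf (ContDiffAt.smul (f := fun t : ℝ => t ^ d)
    (by fun_prop) (contDiffAt_comp_chartCurve (contDiffAt_vfCoord hX p.proj)))
    (liftVF_apply hX d p) hm).trans ?_
  apply taylorCoeff_congr
  filter_upwards [eventually_chartCurve isOpen_univ (mem_univ p.proj)] with t ht
  have hs := (chartAt E p.proj).map_target ht.1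
  rw [derivAlong, mvfderiv_eq_fderiv hs ((hf _).mdifferentiableAt (by simp)),
    (chartAt E p.proj).right_inv ht.1]
  exact map_smul _ _ _

/-- Every integer index up to `r` has the form `r - d`. For `d > r` the field `liftVF r d X` is
zero, as it should be, since all Taylor coefficients up to order `r` vanish. -/
theorem isLiftVF_liftVF {X : VectorFieldOn E M} (hX : IsSmoothVF X) (d : ℕ) :
    IsLiftVF r ((r : ℤ) - d) X (liftVF r d X) := by
  refine ⟨fun p => contMDiffAt_vectorField_of_derivAlong_liftFun fun f hf m hm => ?_,
    fun f hf m hm => ?_⟩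
  · rw [derivAlong_liftVF hX hf d hm]
    exact contMDiff_liftFun (by omega) (contMDiff_derivAlong hf hX) p
  · rw [derivAlong_liftVF hX hf d hm]
    congr 1
    omega

theorem IsLiftVF.unique {k : ℤ} {X : VectorFieldOn E M}
    {X' X'' : VectorFieldOn (Fin (r + 1) → E) (HigherTangentBundle E M r)}
    (h' : IsLiftVF r k X X') (h'' : IsLiftVF r k X X'') : X' = X'' := by
  funext p
  refine eq_of_mvfderiv_liftFun_eq fun f hf m hm => ?_
  exact congrFun ((h'.2 f hf m hm).trans (h''.2 f hf m hm).symm) p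

theorem IsLiftVF.eq_liftVF {d : ℕ} {X : VectorFieldOn E M} (hX : IsSmoothVF X)
    {X' : VectorFieldOn (Fin (r + 1) → E) (HigherTangentBundle E M r)}
    (h : IsLiftVF r ((r : ℤ) - d) X X') : X' = liftVF r d X :=
  h.unique (isLiftVF_liftVF hX d)

/-- The components of the lift of a vector field in a fixed chart of `T^r M`. -/
theorem eventually_chartVec_liftVF {X : VectorFieldOn E M} (hX : IsSmoothVF X) (d : ℕ)
    (p : HigherTangentBundle E M r) :
    ∀ᶠ q in 𝓝 p, ∀ j : Fin (r + 1), chartVec p q (liftVF r d X q) j =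
      taylorCoeff j (fun t => t ^ d • vfCoord p.proj X (q.rep t)) := by
  let b := Module.finBasis ℝ E
  -- At `q` the lift is defined by the chart at `q.proj`, but its components are wanted in the chart
  -- at `p`. The passage goes through its action on lifted coordinate functions, which refers to no
  -- chart.
  have key : ∀ i, ∀ᶠ q in 𝓝 p, ∀ j : Fin (r + 1), b.coord i (chartVec p q (liftVF r d X q) j) =
      b.coord i (taylorCoeff j (fun t => t ^ d • vfCoord p.proj X (q.rep t))) := by
    intro i
    let l : E →L[ℝ] ℝ := LinearMap.toContinuousLinearMap (b.coord i)
    obtain ⟨f, hf, hfl⟩ := exists_contMDiff_eventuallyEq_chart p.proj l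
    have h1 : ∀ᶠ x in 𝓝 p.proj, derivAlong X f x = l (vfCoord p.proj X x) := by
      filter_upwards [eventually_eventually_nhds.2 hfl,
        (chartAt E p.proj).open_source.mem_nhds (mem_chart_source E _)] with x hx hxs
      rw [derivAlong, mvfderiv_eq_fderiv hxs ((hf x).mdifferentiableAt (by simp))]
      have h2 : f ∘ (chartAt E p.proj).symm =ᶠ[𝓝 (chartAt E p.proj x)] l := by
        have hxt := (chartAt E p.proj).map_source hxs
        have hc := ((chartAt E p.proj).symm.continuousAt hxt)
        rw [ContinuousAt, (chartAt E p.proj).left_inv hxs] at hc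
        filter_upwards [hc.eventually hx, (chartAt E p.proj).open_target.mem_nhds hxt] with y hy hyt
        rw [Function.comp_apply, hy, (chartAt E p.proj).right_inv hyt]
      rw [h2.fderiv_eq, l.fderiv]
      rfl
    filter_upwards [eventually_mvfderiv_liftFun_eq hf hfl,
      eventually_proj (eventually_eventually_nhds.2 h1),
      eventually_proj ((chartAt E p.proj).open_source.mem_nhds (mem_chart_source E _))]
      with q hq hq1 hqs j
    have hj : (j : ℕ) ≤ r := Nat.lt_succ_iff.1 j.2
    have hc := contDiffAt_vfCoord_rep hX hqs
    have h3 : taylorCoeff (j - d) (derivAlong X f ∘ q.rep) =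
        taylorCoeff (j - d) (fun t => l (vfCoord p.proj X (q.rep t))) :=
      taylorCoeff_congr (curve_eventually q.rep hq1)
    change l _ = l _
    rw [← hq, taylorCoeff_pow_smul hc]
    have h4 := congrFun (derivAlong_liftVF hX hf d hj) q
    refine h4.trans ?_
    split_ifs with h
    · rw [← taylorCoeff_clm hc, ← h3, ← Nat.cast_sub h, liftFun_natCast]
    · rw [liftFun_of_neg (by omega), map_zero]
  filter_upwards [eventually_all.2 key] with q hq j
  exact b.ext_elem fun i => hq i j

/-- A smooth vector field which has constant components `e` in the preferred chart at `c`,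
near `c`. -/
noncomputable def coordField (c : M) (e : E) : VectorFieldOn E M :=
  fun x => (Classical.arbitrary (SmoothBumpFunction 𝓘(ℝ, E) c)) x • ofChartVec c x e

theorem isSmoothVF_coordField (c : M) (e : E) : IsSmoothVF (coordField c e) := by
  intro x
  by_cases hx : x ∈ tsupport (Classical.arbitrary (SmoothBumpFunction 𝓘(ℝ, E) c))
  · have hxs := (Classical.arbitrary (SmoothBumpFunction 𝓘(ℝ, E) c)).tsupport_subset_chartAt_source hx
    exact ((Classical.arbitrary (SmoothBumpFunction 𝓘(ℝ, E) c)).contMDiffAt).smul_section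
      (contMDiffAt_ofChartVec hxs e)
  · have h0 : ∀ᶠ y in 𝓝 x, coordField c e y = 0 := by
      filter_upwards [(isClosed_tsupport _).isOpen_compl.mem_nhds hx] with y hy
      rw [coordField, image_eq_zero_of_notMem_tsupport hy, zero_smul]
    rw [contMDiffAt_vectorField_iff (mem_chart_source E x)]
    refine (contMDiffAt_const (c := (0 : E))).congr_of_eventuallyEq ?_
    filter_upwards [h0] with y hy
    rw [hy, map_zero]

omit [T2Space M] in
theorem eventually_coordField (c : M) (e : E) :
    ∀ᶠ x in 𝓝 c, coordField c e x = ofChartVec c x e := by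
  filter_upwards [(Classical.arbitrary (SmoothBumpFunction 𝓘(ℝ, E) c)).eventuallyEq_one] with x hx
  rw [coordField, hx, Pi.one_apply, one_smul]

omit [T2Space M] in
theorem eventually_vfCoord_coordField (c : M) (e : E) :
    ∀ᶠ x in 𝓝 c, vfCoord c (coordField c e) x = e := by
  filter_upwards [eventually_coordField c e,
    (chartAt E c).open_source.mem_nhds (mem_chart_source E c)] with x hx hxs
  rw [vfCoord, hx, chartVec_ofChartVec hxs]

/-- The lifts of coordinate fields are coordinate fields. -/
theorem eventually_liftVF_coordField (p : HigherTangentBundle E M r) (i : Fin (r + 1)) (e : E) :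
    ∀ᶠ q in 𝓝 p, liftVF r i (coordField p.proj e) q = ofChartVec p q (Pi.single i e) := by
  filter_upwards [eventually_chartVec_liftVF (isSmoothVF_coordField p.proj e) i p,
    eventually_proj (eventually_eventually_nhds.2 (eventually_vfCoord_coordField p.proj e)),
    (chartAt (Fin (r + 1) → E) p).open_source.mem_nhds (mem_chart_source _ p)] with q hq hq1 hqs
  rw [← ofChartVec_chartVec hqs (liftVF r i (coordField p.proj e) q)]
  congr 1
  funext j
  rw [hq j]
  have h1 : (fun t : ℝ => t ^ (i : ℕ) • vfCoord p.proj (coordField p.proj e) (q.rep t)) =ᶠ[𝓝 0]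
      fun t => t ^ (i : ℕ) • e := by
    filter_upwards [curve_eventually q.rep hq1] with t ht
    rw [ht]
  rw [taylorCoeff_congr h1, taylorCoeff_pow_smul_const]
  by_cases hij : j = i
  · subst hij
    simp
  · rw [if_neg fun h => hij (Fin.ext h), Pi.single_eq_of_ne hij]

end VectorFieldLifts

/-! ### Bilinear forms on jets obtained from a curve of bilinear maps. -/

section TaylorBilin

variable {E : Type*} [NormedAddCommGroup E] [NormedSpace ℝ E]
  {G : Type*} [NormedAddCommGroup G] [NormedSpace ℝ G] {r : ℕ}

/-- The `n`-th Taylor coefficient of `t ↦ Γ t (u t) (w t)`, as a bilinear map in the jets of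
`u` and `w`. -/
noncomputable def taylorBilin (r n : ℕ) (Γ : ℝ → E →L[ℝ] E →L[ℝ] G) :
    (Fin (r + 1) → E) →L[ℝ] (Fin (r + 1) → E) →L[ℝ] G :=
  ∑ i : Fin (r + 1), ∑ j : Fin (r + 1), if (i : ℕ) + j ≤ n then
    (taylorCoeff (n - (i + j)) Γ).bilinearComp
      (ContinuousLinearMap.proj i) (ContinuousLinearMap.proj j) else 0

theorem taylorBilin_apply (n : ℕ) (Γ : ℝ → E →L[ℝ] E →L[ℝ] G) (u w : Fin (r + 1) → E) :
    taylorBilin r n Γ u w = ∑ i : Fin (r + 1), ∑ j : Fin (r + 1), if (i : ℕ) + j ≤ n then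
      taylorCoeff (n - (i + j)) Γ (u i) (w j) else 0 := by
  simp only [taylorBilin, sum_apply]
  refine Finset.sum_congr rfl fun i _ => Finset.sum_congr rfl fun j _ => ?_
  split_ifs <;> rfl

set_option synthInstance.maxHeartbeats 200000 in
theorem taylorCoeff_bilin_curves_congr {n : ℕ} {Γ : ℝ → E →L[ℝ] E →L[ℝ] G}
    (hΓ : ContDiffAt ℝ ∞ Γ 0) {u u' w w' : ℝ → E} (hu : ContDiffAt ℝ ∞ u 0)
    (hu' : ContDiffAt ℝ ∞ u' 0) (hw : ContDiffAt ℝ ∞ w 0) (hw' : ContDiffAt ℝ ∞ w' 0)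
    (h : ∀ k ≤ n, taylorCoeff k u = taylorCoeff k u')
    (h' : ∀ k ≤ n, taylorCoeff k w = taylorCoeff k w') :
    taylorCoeff n (fun t => Γ t (u t) (w t)) = taylorCoeff n (fun t => Γ t (u' t) (w' t)) :=
  taylorCoeff_bilin_congr (ContinuousLinearMap.id ℝ (E →L[ℝ] G)) (hΓ.clm_apply hu)
    (hΓ.clm_apply hu') hw hw' (fun _ hk =>
      taylorCoeff_bilin_congr (ContinuousLinearMap.id ℝ (E →L[ℝ] E →L[ℝ] G)) hΓ hΓ hu hu'
        (fun _ _ => rfl) fun l hl => h l (hl.trans hk)) h'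

set_option synthInstance.maxHeartbeats 200000 in
-- The representing curves need not be polynomial: only coefficients up to `n ≤ r` enter, and those
-- are recorded by `u` and `u'`. This allows evaluation on lifts, whose natural curves are `t ^ d
-- X(γ(t))`.
theorem taylorBilin_of_taylorCoeff {n : ℕ} (hn : n ≤ r) {Γ : ℝ → E →L[ℝ] E →L[ℝ] G}
    (hΓ : ContDiffAt ℝ ∞ Γ 0) {u u' : Fin (r + 1) → E} {h h' : ℝ → E}
    (hh : ContDiffAt ℝ ∞ h 0) (hh' : ContDiffAt ℝ ∞ h' 0)
    (hu : ∀ j : Fin (r + 1), u j = taylorCoeff j h)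
    (hu' : ∀ j : Fin (r + 1), u' j = taylorCoeff j h') :
    taylorBilin r n Γ u u' = taylorCoeff n (fun t => Γ t (h t) (h' t)) := by
  have e1 : taylorCoeff n (fun t => Γ t (h t) (h' t)) =
      taylorCoeff n (fun t => Γ t (polyCurve u t) (polyCurve u' t)) := by
    refine taylorCoeff_bilin_curves_congr hΓ hh (contDiff_polyCurve_right u).contDiffAt hh'
      (contDiff_polyCurve_right u').contDiffAt (fun k hk => ?_) fun k hk => ?_
    · rw [← hu ⟨k, by omega⟩]
      exact (taylorCoeff_polyCurve u ⟨k, by omega⟩).symm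
    · rw [← hu' ⟨k, by omega⟩]
      exact (taylorCoeff_polyCurve u' ⟨k, by omega⟩).symm
  have e2 : (fun t => Γ t (polyCurve u t) (polyCurve u' t)) =
      fun t => ∑ i : Fin (r + 1), ∑ j : Fin (r + 1), t ^ ((i : ℕ) + j) • Γ t (u i) (u' j) := by
    funext t
    simp only [polyCurve, map_sum, map_smul, sum_apply, smul_apply, pow_add]
    rw [Finset.sum_comm]
    refine Finset.sum_congr rfl fun i _ => ?_
    rw [Finset.smul_sum]
    refine Finset.sum_congr rfl fun j _ => ?_
    rw [smul_smul, mul_comm]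
  have hc : ∀ i j : Fin (r + 1), ContDiffAt ℝ ∞ (fun t => Γ t (u i) (u' j)) 0 := fun i j =>
    (hΓ.clm_apply contDiffAt_const).clm_apply contDiffAt_const
  have hc' : ∀ i j : Fin (r + 1),
      ContDiffAt ℝ ∞ (fun t => t ^ ((i : ℕ) + j) • Γ t (u i) (u' j)) 0 := fun i j =>
    ContDiffAt.smul (f := fun t : ℝ => t ^ ((i : ℕ) + j)) (by fun_prop) (hc i j)
  rw [e1, e2, taylorCoeff_sum fun i _ => ContDiffAt.sum fun j _ => hc' i j, taylorBilin_apply]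
  refine Finset.sum_congr rfl fun i _ => ?_
  rw [taylorCoeff_sum fun j _ => hc' i j]
  refine Finset.sum_congr rfl fun j _ => ?_
  rw [taylorCoeff_pow_smul (hc i j)]
  split_ifs with hij
  -- Evaluation at the fixed pair `(u i, u' j)` is a continuous linear map, hence commutes with
  -- Taylor coefficients.
  · let L : (E →L[ℝ] E →L[ℝ] G) →L[ℝ] G :=
      (ContinuousLinearMap.apply ℝ G (u' j)).comp (ContinuousLinearMap.apply ℝ (E →L[ℝ] G) (u i))
    exact (taylorCoeff_clm hΓ L).symm
  · rfl

end TaylorBilin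

/-! ### The complete lift of the metric. -/

section BilinLifts

variable {E : Type*} [NormedAddCommGroup E] [NormedSpace ℝ E] [FiniteDimensional ℝ E]
  {M : Type*} [TopologicalSpace M] [ChartedSpace E M] [IsManifold 𝓘(ℝ, E) ∞ M] {r : ℕ}

/-- The components of a field of bilinear forms in the preferred chart at `c`. -/
noncomputable def bilinCoord (c : M) (g : BilinFieldOn E M) (x : M) : E →L[ℝ] E →L[ℝ] ℝ :=
  (show E →L[ℝ] E →L[ℝ] ℝ from g x).bilinearComp (show E →L[ℝ] E from ofChartVec c x)
    (show E →L[ℝ] E from ofChartVec c x)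

omit [FiniteDimensional ℝ E] in
theorem bilinCoord_apply {c : M} {g : BilinFieldOn E M} {x : M} (e e' : E) :
    bilinCoord c g x e e' = g x (ofChartVec c x e) (ofChartVec c x e') := rfl

theorem contMDiffOn_bilinCoord {g : BilinFieldOn E M} (hg : IsPseudoRiemannianMetric g) (c : M) :
    ContMDiffOn 𝓘(ℝ, E) 𝓘(ℝ, E →L[ℝ] E →L[ℝ] ℝ) ∞ (bilinCoord c g) (chartAt E c).source := by
  intro x hx
  refine ContMDiffAt.contMDiffWithinAt ?_
  exact contMDiffAt_clm_of_apply fun e => contMDiffAt_clm_of_apply fun e' =>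
    contMDiffAt_bilin_apply hg (contMDiffAt_ofChartVec hx e) (contMDiffAt_ofChartVec hx e')

omit [FiniteDimensional ℝ E] in
theorem bilinCoord_vfCoord {c : M} {g : BilinFieldOn E M} {x : M} (hx : x ∈ (chartAt E c).source)
    (X Y : VectorFieldOn E M) :
    bilinCoord c g x (vfCoord c X x) (vfCoord c Y x) = g x (X x) (Y x) := by
  rw [bilinCoord_apply, vfCoord, vfCoord, ofChartVec_chartVec hx, ofChartVec_chartVec hx]

variable [T2Space M]

/-- The complete lift of a field of bilinear forms. -/
noncomputable def liftBilin (r : ℕ) (g : BilinFieldOn E M) :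
    BilinFieldOn (Fin (r + 1) → E) (HigherTangentBundle E M r) :=
  fun p => taylorBilin r r (fun t => bilinCoord p.proj g
    ((chartAt E p.proj).symm (chartCurve p t)))

theorem liftBilin_apply (g : BilinFieldOn E M) (p : HigherTangentBundle E M r)
    (u w : Fin (r + 1) → E) :
    liftBilin r g p u w = ∑ i : Fin (r + 1), ∑ j : Fin (r + 1), if (i : ℕ) + j ≤ r then
      taylorCoeff (r - (i + j)) (fun t => bilinCoord p.proj g
        ((chartAt E p.proj).symm (chartCurve p t))) (u i) (w j) else 0 :=
  taylorBilin_apply _ _ u w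

set_option synthInstance.maxHeartbeats 200000 in
theorem contDiffAt_bilinCoord_chartCurve {g : BilinFieldOn E M} (hg : IsPseudoRiemannianMetric g)
    (p : HigherTangentBundle E M r) :
    ContDiffAt ℝ ∞ (fun t => bilinCoord p.proj g ((chartAt E p.proj).symm (chartCurve p t))) 0 :=
  contDiffAt_comp_chartCurve (F := fun y => bilinCoord p.proj g ((chartAt E p.proj).symm y))
    ((contMDiffAt_iff_contDiffAt_chart (mem_chart_source E _)).1
      ((contMDiffOn_bilinCoord hg p.proj).contMDiffAt
        ((chartAt E p.proj).open_source.mem_nhds (mem_chart_source E _))))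

/-- The complete lift of a metric evaluated on tangent vectors represented by curves. -/
theorem liftBilin_of_taylorCoeff {g : BilinFieldOn E M} (hg : IsPseudoRiemannianMetric g)
    {p : HigherTangentBundle E M r} {u u' : Fin (r + 1) → E} {h h' : ℝ → E}
    (hh : ContDiffAt ℝ ∞ h 0) (hh' : ContDiffAt ℝ ∞ h' 0)
    (hu : ∀ j : Fin (r + 1), u j = taylorCoeff j h)
    (hu' : ∀ j : Fin (r + 1), u' j = taylorCoeff j h') :
    liftBilin r g p u u' = taylorCoeff r (fun t => bilinCoord p.proj g
        ((chartAt E p.proj).symm (chartCurve p t)) (h t) (h' t)) :=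
  taylorBilin_of_taylorCoeff le_rfl (contDiffAt_bilinCoord_chartCurve hg p) hh hh' hu hu'

theorem liftBilin_polyCurve {g : BilinFieldOn E M} (hg : IsPseudoRiemannianMetric g)
    (p : HigherTangentBundle E M r) (u u' : Fin (r + 1) → E) :
    liftBilin r g p u u' = taylorCoeff r (fun t => bilinCoord p.proj g
        ((chartAt E p.proj).symm (chartCurve p t)) (polyCurve u t) (polyCurve u' t)) :=
  liftBilin_of_taylorCoeff hg (contDiff_polyCurve_right u).contDiffAt
    (contDiff_polyCurve_right u').contDiffAt (fun j => (taylorCoeff_polyCurve u j).symm)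
    fun j => (taylorCoeff_polyCurve u' j).symm

theorem liftBilin_symm {g : BilinFieldOn E M} (hg : IsPseudoRiemannianMetric g)
    (p : HigherTangentBundle E M r) (u u' : Fin (r + 1) → E) :
    liftBilin r g p u u' = liftBilin r g p u' u := by
  rw [liftBilin_polyCurve hg, liftBilin_polyCurve hg]
  congr 1
  funext t
  exact hg.symm _ _ _

/-- The `(i, j)` block of the lift is the Taylor coefficient of `g` of order `r - (i + j)`: zero for
`i + j > r`, and `g` at the base point for `i + j = r`. Such an antitriangular form is
nondegenerate, by solving for the components of `u` one after another. -/
theorem liftBilin_nondegenerate {g : BilinFieldOn E M} (hg : IsPseudoRiemannianMetric g)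
    (p : HigherTangentBundle E M r) (u : Fin (r + 1) → E)
    (hu : ∀ w : Fin (r + 1) → E, liftBilin r g p u w = 0) : u = 0 := by
  have hs := mem_chart_source E p.proj
  suffices h : ∀ n : ℕ, ∀ hn : n < r + 1, u ⟨n, hn⟩ = 0 from funext fun i => h i i.2
  intro n
  induction n using Nat.strong_induction_on with
  | _ n ih =>
    intro hn
    have key : ∀ e : E, bilinCoord p.proj g p.proj (u ⟨n, hn⟩) e = 0 := by
      intro e
      -- A vector in slot `r - n` meets slot `n` on the antidiagonal.
      have h1 := hu (Pi.single ⟨r - n, by omega⟩ e)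
      rw [liftBilin_apply, Finset.sum_eq_single ⟨n, hn⟩, Finset.sum_eq_single ⟨r - n, by omega⟩]
        at h1
      · have h2 : r - (n + (r - n)) = 0 := by omega
        have h3 : n + (r - n) ≤ r := by omega
        simpa only [h2, h3, if_true, taylorCoeff_zero, chartCurve_zero, Pi.single_eq_same,
          (chartAt E p.proj).left_inv hs] using h1
      · intro j _ hj
        rw [Pi.single_eq_of_ne hj, map_zero, ite_self]
      · simp
      · intro i _ hi
        refine Finset.sum_eq_zero fun j _ => ?_
        -- Slots below `n` vanish by induction; slots above `n` lie beyond the antidiagonal, since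
        -- `i + (r - n) > r`.
        by_cases hin : (i : ℕ) < n
        · have := ih i hin i.2
          simp only [Fin.eta] at this
          rw [this]
          simp
        · have hin' : n < i := lt_of_le_of_ne (not_lt.1 hin) fun h => hi (Fin.ext h.symm)
          by_cases hj : j = ⟨r - n, by omega⟩
          · subst hj
            rw [if_neg (by simp only; omega)]
          · rw [Pi.single_eq_of_ne hj, map_zero, ite_self]
      · simp
    have h0 : ofChartVec p.proj p.proj (u ⟨n, hn⟩) = 0 := by
      refine hg.nondegenerate p.proj _ fun w => ?_
      have := key (chartVec p.proj p.proj w)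
      rwa [bilinCoord_apply, ofChartVec_chartVec hs] at this
    rw [← chartVec_ofChartVec hs (u ⟨n, hn⟩), h0, map_zero]

omit [FiniteDimensional ℝ E] [T2Space M] in
theorem contMDiff_bilin_apply {g : BilinFieldOn E M} (hg : IsPseudoRiemannianMetric g)
    {X Y : VectorFieldOn E M} (hX : IsSmoothVF X) (hY : IsSmoothVF Y) :
    ContMDiff 𝓘(ℝ, E) 𝓘(ℝ, ℝ) ∞ (fun x => g x (X x) (Y x)) :=
  fun x => contMDiffAt_bilin_apply hg (hX x) (hY x)

/-- `g^c(X^(k), Y^(l)) = (g(X, Y))^(k + l - r)`. -/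
theorem liftBilin_liftVF {g : BilinFieldOn E M} (hg : IsPseudoRiemannianMetric g)
    {X Y : VectorFieldOn E M} (hX : IsSmoothVF X) (hY : IsSmoothVF Y) (d d' : ℕ) :
    (fun p => liftBilin r g p (liftVF r d X p) (liftVF r d' Y p)) =
      liftFun r ((r : ℤ) - (d + d' : ℕ)) (fun x => g x (X x) (Y x)) := by
  funext p
  have hp : ∀ n : ℕ, ContDiffAt ℝ ∞ (fun t : ℝ => t ^ n) 0 := fun n => by fun_prop
  rw [liftFun_eq_taylorCoeff_pow_smul (contMDiff_bilin_apply hg hX hY) le_rfl]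
  refine (liftBilin_of_taylorCoeff hg
    ((hp d).smul (contDiffAt_comp_chartCurve (contDiffAt_vfCoord hX p.proj)))
    ((hp d').smul (contDiffAt_comp_chartCurve (contDiffAt_vfCoord hY p.proj)))
    (liftVF_apply hX d p) (liftVF_apply hY d' p)).trans ?_
  apply taylorCoeff_congr
  filter_upwards [eventually_chartCurve isOpen_univ (mem_univ p.proj)] with t ht
  have hs := (chartAt E p.proj).map_target ht.1
  rw [← bilinCoord_vfCoord hs X Y, pow_add]
  simp only [Pi.smul_apply', map_smul, smul_apply, smul_smul]
  rw [mul_comm]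

/-- Along the curve, `g(u, w)` is `∑ f dh(u) dk(w)`. Two applications of the Leibniz rule to its `t
^ r` coefficient give the sum over `a + b + c = r`. -/
theorem isCompleteLiftBilin_liftBilin {g : BilinFieldOn E M} (hg : IsPseudoRiemannianMetric g) :
    IsCompleteLiftBilin r g (liftBilin r g) := by
  intro U hU n f h k hf hh hk hg' p hp u w
  have hps := mem_chart_source E p.proj
  set c := p.proj with hc
  have hcd : ∀ f : M → ℝ, ContMDiff 𝓘(ℝ, E) 𝓘(ℝ, ℝ) ∞ f →
      ContDiffAt ℝ ∞ (fun t => f ((chartAt E c).symm (chartCurve p t))) 0 := fun f hf =>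
    contDiffAt_comp_chartCurve (F := fun y => f ((chartAt E c).symm y))
      ((contMDiffAt_iff_contDiffAt_chart hps).1 (hf c))
  have hcd' : ∀ f : M → ℝ, ContMDiff 𝓘(ℝ, E) 𝓘(ℝ, ℝ) ∞ f → ∀ u : Fin (r + 1) → E,
      ContDiffAt ℝ ∞ (fun t => fderiv ℝ (f ∘ (chartAt E c).symm) (chartCurve p t)
        (polyCurve u t)) 0 := fun f hf u =>
    (contDiffAt_comp_chartCurve (((contMDiffAt_iff_contDiffAt_chart hps).1
      (hf c)).fderiv_right (by simp))).clm_apply (contDiff_polyCurve_right u).contDiffAt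
  have hd : ∀ f : M → ℝ, ContMDiff 𝓘(ℝ, E) 𝓘(ℝ, ℝ) ∞ f → ∀ u : Fin (r + 1) → E,
      ∀ m : ℕ, m ≤ r → mvfderiv 𝓘(ℝ, Fin (r + 1) → E) (liftFun r m f) p u =
      taylorCoeff m (fun t => fderiv ℝ (f ∘ (chartAt E c).symm) (chartCurve p t)
        (polyCurve u t)) := fun f hf u m hm =>
    mvfderiv_liftFun_of_taylorCoeff hf (contDiff_polyCurve_right u).contDiffAt
      (fun j => (taylorCoeff_polyCurve u j).symm) hm
  have e1 : (fun t => bilinCoord c g ((chartAt E c).symm (chartCurve p t)) (polyCurve u t)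
      (polyCurve w t)) =ᶠ[𝓝 0] fun t => ∑ i, f i ((chartAt E c).symm (chartCurve p t)) *
        (fderiv ℝ (h i ∘ (chartAt E c).symm) (chartCurve p t) (polyCurve u t) *
          fderiv ℝ (k i ∘ (chartAt E c).symm) (chartCurve p t) (polyCurve w t)) := by
    filter_upwards [eventually_chartCurve hU hp] with t ht
    have hs := (chartAt E c).map_target ht.1
    rw [bilinCoord_apply, hg' _ ht.2]
    refine Finset.sum_congr rfl fun i _ => ?_
    rw [mvfderiv_eq_fderiv hs ((hh i _).mdifferentiableAt (by simp)),
      mvfderiv_eq_fderiv hs ((hk i _).mdifferentiableAt (by simp)), chartVec_ofChartVec hs,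
      chartVec_ofChartVec hs, (chartAt E c).right_inv ht.1, mul_assoc]
  refine (liftBilin_polyCurve hg p u w).trans ?_
  rw [taylorCoeff_congr e1, taylorCoeff_sum fun i _ =>
    (hcd _ (hf i)).mul ((hcd' _ (hh i) u).mul (hcd' _ (hk i) w))]
  refine Finset.sum_congr rfl fun i _ => ?_
  have e2 := taylorCoeff_bilin (ContinuousLinearMap.mul ℝ ℝ) (hcd _ (hf i))
    ((hcd' _ (hh i) u).mul (hcd' _ (hk i) w)) r
  simp only [ContinuousLinearMap.mul_apply'] at e2
  refine e2.trans (Finset.sum_congr rfl fun a ha => ?_)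
  have ha' := Finset.HasAntidiagonal.mem_antidiagonal.1 ha
  have e3 := taylorCoeff_bilin (ContinuousLinearMap.mul ℝ ℝ) (hcd' _ (hh i) u)
    (hcd' _ (hk i) w) a.2
  simp only [ContinuousLinearMap.mul_apply'] at e3
  have e4 : taylorCoeff a.1 (fun t => f i ((chartAt E c).symm (chartCurve p t))) =
      liftFun r a.1 (f i) p := by
    rw [liftFun_natCast]
    exact (taylorCoeff_comp_rep_eq_chartCurve isOpen_univ (hf i).contMDiffOn (mem_univ _)
      (by omega)).symm
  rw [e4]
  refine (congrArg _ e3).trans ?_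
  rw [Finset.mul_sum]
  refine Finset.sum_congr rfl fun b hb => ?_
  have hb' := Finset.HasAntidiagonal.mem_antidiagonal.1 hb
  rw [hd _ (hh i) u _ (by omega), hd _ (hk i) w _ (by omega), mul_assoc]

/-- This is `g = ∑ g_ij dx^i ⊗ dx^j` near `c`, with components and coordinates extended to global
functions. It shows that the defining property of a complete lift applies at every jet, which yields
uniqueness. -/
theorem exists_local_expression {g : BilinFieldOn E M} (hg : IsPseudoRiemannianMetric g) (c : M) :
    ∃ (U : Set M) (n : ℕ) (f h k : Fin n → M → ℝ), IsOpen U ∧ c ∈ U ∧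
      (∀ i, ContMDiff 𝓘(ℝ, E) 𝓘(ℝ, ℝ) ∞ (f i)) ∧ (∀ i, ContMDiff 𝓘(ℝ, E) 𝓘(ℝ, ℝ) ∞ (h i)) ∧
      (∀ i, ContMDiff 𝓘(ℝ, E) 𝓘(ℝ, ℝ) ∞ (k i)) ∧
      ∀ x ∈ U, ∀ u v : TangentSpace 𝓘(ℝ, E) x, g x u v =
        ∑ i, f i x * mvfderiv 𝓘(ℝ, E) (h i) x u * mvfderiv 𝓘(ℝ, E) (k i) x v := by
  let b := Module.finBasis ℝ E
  let l : Fin (Module.finrank ℝ E) → E →L[ℝ] ℝ := fun i =>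
    LinearMap.toContinuousLinearMap (b.coord i)
  choose y hy hyl using fun i => exists_contMDiff_eventuallyEq_chart (M := M) c (l i)
  have hgc : ∀ i j, ContMDiffOn 𝓘(ℝ, E) 𝓘(ℝ, ℝ) ∞ (fun x => bilinCoord c g x (b i) (b j))
      (chartAt E c).source := fun i j x hx =>
    (contMDiffAt_bilin_apply hg (contMDiffAt_ofChartVec hx (b i))
      (contMDiffAt_ofChartVec hx (b j))).contMDiffWithinAt
  choose a ha hag using fun i j => exists_global_extension (chartAt E c).open_source (hgc i j)
    (mem_chart_source E c)
  have hdy : ∀ i, ∀ᶠ x in 𝓝 c, ∀ u, mvfderiv 𝓘(ℝ, E) (y i) x u = l i (chartVec c x u) := by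
    intro i
    filter_upwards [eventually_eventually_nhds.2 (hyl i),
      (chartAt E c).open_source.mem_nhds (mem_chart_source E c)] with x hx hxs u
    have hxt := (chartAt E c).map_source hxs
    have h2 : y i ∘ (chartAt E c).symm =ᶠ[𝓝 (chartAt E c x)] l i := by
      have hc := ((chartAt E c).symm.continuousAt hxt)
      rw [ContinuousAt, (chartAt E c).left_inv hxs] at hc
      filter_upwards [hc.eventually hx, (chartAt E c).open_target.mem_nhds hxt] with z hz hzt
      rw [Function.comp_apply, hz, (chartAt E c).right_inv hzt]
    rw [mvfderiv_eq_fderiv hxs ((hy i x).mdifferentiableAt (by simp)), h2.fderiv_eq, (l i).fderiv]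
  have hall : ∀ᶠ x in 𝓝 c, ∀ u v : TangentSpace 𝓘(ℝ, E) x, g x u v =
      ∑ q : Fin (Module.finrank ℝ E * Module.finrank ℝ E),
        a (finProdFinEquiv.symm q).1 (finProdFinEquiv.symm q).2 x *
        mvfderiv 𝓘(ℝ, E) (y (finProdFinEquiv.symm q).1) x u *
        mvfderiv 𝓘(ℝ, E) (y (finProdFinEquiv.symm q).2) x v := by
    filter_upwards [eventually_all.2 hdy, eventually_all.2 fun i => eventually_all.2 (hag i),
      (chartAt E c).open_source.mem_nhds (mem_chart_source E c)] with x h1 h2 hxs u v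
    rw [finProdFinEquiv.symm.sum_comp (fun q : Fin (Module.finrank ℝ E) × Fin (Module.finrank ℝ E)
      => a q.1 q.2 x * mvfderiv 𝓘(ℝ, E) (y q.1) x u * mvfderiv 𝓘(ℝ, E) (y q.2) x v),
      Fintype.sum_prod_type]
    simp only [h1, h2]
    have h3 : g x u v = bilinCoord c g x (chartVec c x u) (chartVec c x v) := by
      rw [bilinCoord_apply, ofChartVec_chartVec hxs, ofChartVec_chartVec hxs]
    rw [h3]
    conv_lhs => rw [← b.sum_repr (chartVec c x u), ← b.sum_repr (chartVec c x v)]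
    simp only [map_sum, map_smul, sum_apply, smul_apply, smul_eq_mul]
    rw [Finset.sum_comm]
    refine Finset.sum_congr rfl fun i _ => ?_
    rw [Finset.mul_sum]
    refine Finset.sum_congr rfl fun j _ => ?_
    simp only [l, LinearMap.coe_toContinuousLinearMap', Module.Basis.coord_apply]
    ring
  obtain ⟨U, hUsub, hUo, hcU⟩ := mem_nhds_iff.1 hall
  exact ⟨U, _, _, _, _, hUo, hcU, fun q => ha _ _, fun q => hy _, fun q => hy _,
    fun x hx => hUsub hx⟩

theorem IsCompleteLiftBilin.eq_liftBilin {g : BilinFieldOn E M} (hg : IsPseudoRiemannianMetric g)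
    {g' : BilinFieldOn (Fin (r + 1) → E) (HigherTangentBundle E M r)}
    (h : IsCompleteLiftBilin r g g') : g' = liftBilin r g := by
  funext p
  obtain ⟨U, n, f, h', k, hU, hp, hf, hh, hk, hgU⟩ := exists_local_expression hg p.proj
  ext u v
  rw [h U hU n f h' k hf hh hk hgU p hp u v,
    isCompleteLiftBilin_liftBilin hg U hU n f h' k hf hh hk hgU p hp u v]

theorem isPseudoRiemannianMetric_liftBilin {g : BilinFieldOn E M}
    (hg : IsPseudoRiemannianMetric g) : IsPseudoRiemannianMetric (liftBilin r g) := by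
  refine ⟨fun p u w => liftBilin_symm hg p u w, fun p u hu => liftBilin_nondegenerate hg p u hu,
    fun p => contMDiffAt_bilin_of_apply_ofChartVec fun e e' => ?_⟩
  -- Near `p` the coordinate fields of `T^r M` are sums of lifts, on which the lifted metric takes
  -- values that are lifts of smooth functions. Smoothness thus needs no explicit change of charts.
  have hX := isSmoothVF_coordField (E := E) p.proj
  have h1 : ∀ e : Fin (r + 1) → E, ∀ᶠ q in 𝓝 p, ofChartVec p q e =
      ∑ i : Fin (r + 1), liftVF r i (coordField p.proj (e i)) q := by
    intro e
    filter_upwards [eventually_all.2 fun i => eventually_liftVF_coordField p i (e i)] with q hq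
    simp only [hq]
    rw [← map_sum, Finset.univ_sum_single]
  have h2 : ContMDiffAt 𝓘(ℝ, Fin (r + 1) → E) 𝓘(ℝ, ℝ) ∞ (fun q => ∑ i : Fin (r + 1),
      ∑ j : Fin (r + 1), liftBilin r g q (liftVF r i (coordField p.proj (e i)) q)
        (liftVF r j (coordField p.proj (e' j)) q)) p := by
    refine ContMDiffAt.sum fun i _ => ContMDiffAt.sum fun j _ => ?_
    rw [liftBilin_liftVF hg (hX _) (hX _)]
    exact contMDiff_liftFun (by omega) (contMDiff_bilin_apply hg (hX _) (hX _)) p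
  refine h2.congr_of_eventuallyEq ?_
  filter_upwards [h1 e, h1 e'] with q hq hq'
  rw [hq, hq']
  simp only [map_sum, sum_apply]
  rw [Finset.sum_comm]

end BilinLifts

/-! ### Connections evaluated on local expansions of vector fields. -/

section LocalConnection

variable {E : Type*} [NormedAddCommGroup E] [NormedSpace ℝ E]
  {M : Type*} [TopologicalSpace M] [ChartedSpace E M]
  {G H : Type*} [NormedAddCommGroup G] [NormedSpace ℝ G] [NormedAddCommGroup H] [NormedSpace ℝ H]

theorem mvfderiv_congr {f f' : M → G} {x : M} (h : f =ᶠ[𝓝 x] f') :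
    mvfderiv 𝓘(ℝ, E) f x = mvfderiv 𝓘(ℝ, E) f' x := by
  rw [mvfderiv, mvfderiv, h.mfderiv_eq, h.self_of_nhds]

theorem mvfderiv_clm_comp (L : G →L[ℝ] H) {f : M → G} {x : M}
    (hf : MDifferentiableAt 𝓘(ℝ, E) 𝓘(ℝ, G) f x) (u : TangentSpace 𝓘(ℝ, E) x) :
    mvfderiv 𝓘(ℝ, E) (fun y => L (f y)) x u = L (mvfderiv 𝓘(ℝ, E) f x u) := by
  have h := mfderiv_comp x (L.mdifferentiableAt (x := f x)) hf
  have h2 : mfderiv 𝓘(ℝ, E) 𝓘(ℝ, H) (fun y => L (f y)) x u =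
      (mfderiv 𝓘(ℝ, G) 𝓘(ℝ, H) L (f x)) (mfderiv 𝓘(ℝ, E) 𝓘(ℝ, G) f x u) := by
    rw [← ContinuousLinearMap.comp_apply, ← h]
    rfl
  rw [L.mfderiv_eq] at h2
  exact h2

variable [IsManifold 𝓘(ℝ, E) ∞ M]

theorem mdifferentiableAt_vectorField_iff {X : VectorFieldOn E M} {c x : M}
    (hx : x ∈ (chartAt E c).source) :
    MDifferentiableAt 𝓘(ℝ, E) 𝓘(ℝ, E).tangent
        (fun x => (⟨x, X x⟩ : TangentBundle 𝓘(ℝ, E) M)) x ↔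
      MDifferentiableAt 𝓘(ℝ, E) 𝓘(ℝ, E) (fun y => chartVec c y (X y)) x := by
  have hb : x ∈ (trivializationAt E (TangentSpace 𝓘(ℝ, E) : M → Type _) c).baseSet := by
    simpa using hx
  rw [(trivializationAt E (TangentSpace 𝓘(ℝ, E) : M → Type _) c).mdifferentiableAt_section_iff _ _
    hb]
  refine Filter.EventuallyEq.mdifferentiableAt_iff ?_
  filter_upwards [(trivializationAt E (TangentSpace 𝓘(ℝ, E) : M → Type _) c).open_baseSet.mem_nhds
    hb] with y hy
  rw [chartVec, Trivialization.continuousLinearMapAt_apply, Trivialization.linearMapAt_apply,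
    if_pos hy]

theorem mdifferentiableAt_sum_smul {ι : Type*} (s : Finset ι)
    {a : ι → M → ℝ} {W : ι → VectorFieldOn E M} {x : M}
    (ha : ∀ i, MDifferentiableAt 𝓘(ℝ, E) 𝓘(ℝ, ℝ) (a i) x) (hW : ∀ i, MDiffAt (T% (W i)) x) :
    MDiffAt (T% (∑ i ∈ s, a i • W i)) x := by
  classical
  induction s using Finset.induction_on with
  | empty => exact mdifferentiableAt_zeroSection ..
  | insert i s hi ih =>
    rw [Finset.sum_insert hi]
    exact mdifferentiableAt_add_section ((ha i).smul_section (hW i)) ih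

theorem CovariantDerivative.sum_smul_apply (nab : ConnectionOn E M) {ι : Type*} (s : Finset ι)
    {a : ι → M → ℝ} {W : ι → VectorFieldOn E M} {x : M}
    (ha : ∀ i, MDifferentiableAt 𝓘(ℝ, E) 𝓘(ℝ, ℝ) (a i) x) (hW : ∀ i, MDiffAt (T% (W i)) x)
    (u : TangentSpace 𝓘(ℝ, E) x) :
    nab (∑ i ∈ s, a i • W i) x u =
      ∑ i ∈ s, (a i x • nab (W i) x u + mvfderiv 𝓘(ℝ, E) (a i) x u • W i x) := by
  classical
  induction s using Finset.induction_on with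
  | empty => simp
  | insert i s hi ih =>
    rw [Finset.sum_insert hi, Finset.sum_insert hi, ← ih,
      nab.isCovariantDerivativeOnUniv.add ((ha i).smul_section (hW i))
        (mdifferentiableAt_sum_smul s ha hW),
      nab.isCovariantDerivativeOnUniv.leibniz (hW i) (ha i)]
    rfl

/-- A connection in terms of a local expansion of the differentiated field. -/
theorem CovariantDerivative.apply_of_eventually_eq_sum (nab : ConnectionOn E M) {ι : Type*}
    [Fintype ι] {a : ι → M → ℝ} {W : ι → VectorFieldOn E M} {Y : VectorFieldOn E M} {x : M}
    (ha : ∀ i, MDifferentiableAt 𝓘(ℝ, E) 𝓘(ℝ, ℝ) (a i) x) (hW : ∀ i, MDiffAt (T% (W i)) x)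
    (hY : MDiffAt (T% Y) x) (h : ∀ᶠ y in 𝓝 x, Y y = ∑ i, a i y • W i y)
    (u : TangentSpace 𝓘(ℝ, E) x) :
    nab Y x u = ∑ i, (a i x • nab (W i) x u + mvfderiv 𝓘(ℝ, E) (a i) x u • W i x) := by
  rw [← nab.sum_smul_apply Finset.univ ha hW u,
    nab.isCovariantDerivativeOnUniv.congr_of_eventuallyEq hY
      (mdifferentiableAt_sum_smul Finset.univ ha hW) univ_mem]
  filter_upwards [h] with y hy
  rw [hy]
  simp

theorem contMDiff_connection_apply {nab : ConnectionOn E M} [nab.ContMDiffCovariantDerivative ∞]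
    {Y : VectorFieldOn E M} (hY : IsSmoothVF Y) {X : VectorFieldOn E M} {x : M}
    (hX : ContMDiffAt 𝓘(ℝ, E) 𝓘(ℝ, E).tangent ∞
      (fun x => (⟨x, X x⟩ : TangentBundle 𝓘(ℝ, E) M)) x) :
    ContMDiffAt 𝓘(ℝ, E) 𝓘(ℝ, E).tangent ∞
      (fun x => (⟨x, nab Y x (X x)⟩ : TangentBundle 𝓘(ℝ, E) M)) x := by
  have h := (CovariantDerivative.ContMDiffCovariantDerivative.contMDiff (cov := nab)
    (k := ∞)).contMDiff (σ := Y) (by simpa using! hY.contMDiffOn)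
  exact ContMDiffAt.clm_bundle_apply (h.contMDiffAt univ_mem) hX

theorem isSmoothVF_covAlong {nab : ConnectionOn E M} [nab.ContMDiffCovariantDerivative ∞]
    {X Y : VectorFieldOn E M} (hX : IsSmoothVF X) (hY : IsSmoothVF Y) :
    IsSmoothVF (covAlong nab X Y) :=
  fun x => contMDiff_connection_apply hY (hX x)

end LocalConnection

/-! ### The complete lift of the connection. -/

section ConnectionLift

variable {E : Type*} [NormedAddCommGroup E] [NormedSpace ℝ E] [FiniteDimensional ℝ E]
  {M : Type*} [TopologicalSpace M] [ChartedSpace E M] [IsManifold 𝓘(ℝ, E) ∞ M] [T2Space M]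
  {r : ℕ}

/-- The Christoffel symbols of a connection near `c`, in the preferred chart at `c`. -/
noncomputable def connCoord (c : M) (nab : ConnectionOn E M) (x : M) : E →L[ℝ] E →L[ℝ] E :=
  ∑ i, (LinearMap.toContinuousLinearMap ((Module.finBasis ℝ E).coord i)).smulRight
    ((chartVec c x).comp ((nab (coordField c (Module.finBasis ℝ E i)) x).comp (ofChartVec c x)))

omit [T2Space M] in
theorem connCoord_apply (c : M) (nab : ConnectionOn E M) (x : M) (e e' : E) :
    connCoord c nab x e e' = ∑ i, (Module.finBasis ℝ E).coord i e •
      chartVec c x (nab (coordField c (Module.finBasis ℝ E i)) x (ofChartVec c x e')) := by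
  simp only [connCoord, sum_apply]
  rfl

/-- The fields `coordField c` are smooth on all of `M`, so smoothness holds on the whole chart
domain, although these values are the Christoffel symbols only near `c`. -/
theorem contMDiffOn_connCoord {nab : ConnectionOn E M} [nab.ContMDiffCovariantDerivative ∞]
    (c : M) : ContMDiffOn 𝓘(ℝ, E) 𝓘(ℝ, E →L[ℝ] E →L[ℝ] E) ∞ (connCoord c nab)
      (chartAt E c).source := by
  intro x hx
  refine ContMDiffAt.contMDiffWithinAt ?_
  refine contMDiffAt_clm_of_apply fun e => contMDiffAt_clm_of_apply fun e' => ?_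
  simp only [connCoord_apply]
  have h := fun i => (contMDiffAt_vectorField_iff hx).1
    (contMDiff_connection_apply (nab := nab)
      (isSmoothVF_coordField c (Module.finBasis ℝ E i)) (contMDiffAt_ofChartVec hx e'))
  refine ContMDiffAt.sum fun i _ => ?_
  have h0 : ContMDiffAt 𝓘(ℝ, E) 𝓘(ℝ, ℝ) ∞ (fun _ : M => (Module.finBasis ℝ E).coord i e) x :=
    contMDiffAt_const
  exact h0.smul (h i)

/-- The coordinate expression of a connection. -/
theorem eventually_vfCoord_covAlong (nab : ConnectionOn E M) {X Y : VectorFieldOn E M}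
    (hY : IsSmoothVF Y) (c : M) :
    ∀ᶠ x in 𝓝 c, vfCoord c (covAlong nab X Y) x =
      fderiv ℝ (vfCoord c Y ∘ (chartAt E c).symm) (chartAt E c x) (vfCoord c X x) +
        connCoord c nab x (vfCoord c Y x) (vfCoord c X x) := by
  let b := Module.finBasis ℝ E
  filter_upwards [(chartAt E c).open_source.mem_nhds (mem_chart_source E c),
    eventually_all.2 fun i => eventually_eventually_nhds.2 (eventually_coordField c (b i))]
    with x hx hb
  have hYc : MDifferentiableAt 𝓘(ℝ, E) 𝓘(ℝ, E) (vfCoord c Y) x :=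
    (((contMDiffOn_vfCoord hY c).contMDiffAt ((chartAt E c).open_source.mem_nhds hx))).mdifferentiableAt
      (by simp)
  let l : Fin (Module.finrank ℝ E) → E →L[ℝ] ℝ := fun i =>
    LinearMap.toContinuousLinearMap (b.coord i)
  have hsum : ∀ e : E, ∑ i, l i e • b i = e := b.sum_repr
  have h1 := nab.apply_of_eventually_eq_sum (a := fun i y => l i (vfCoord c Y y))
    (W := fun i => coordField c (b i)) (Y := Y) (x := x)
    (fun i => (l i).mdifferentiableAt.comp x hYc)
    (fun i => (isSmoothVF_coordField c (b i) x).mdifferentiableAt (by simp))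
    ((hY x).mdifferentiableAt (by simp)) (by
      filter_upwards [eventually_all.2 hb, (chartAt E c).open_source.mem_nhds hx] with y hy hys
      simp only [hy]
      rw [← ofChartVec_chartVec hys (Y y)]
      conv_lhs => rw [← hsum (chartVec c y (Y y)), map_sum]
      refine Finset.sum_congr rfl fun i _ => ?_
      rw [map_smul]
      rfl) (X x)
  have h2 : ∀ i, chartVec c x (coordField c (b i) x) = b i := fun i => by
    rw [(hb i).self_of_nhds, chartVec_ofChartVec hx]
  have h3 : mvfderiv 𝓘(ℝ, E) (vfCoord c Y) x (X x) =
      fderiv ℝ (vfCoord c Y ∘ (chartAt E c).symm) (chartAt E c x) (vfCoord c X x) :=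
    mvfderiv_eq_fderiv hx hYc (X x)
  rw [vfCoord, covAlong, h1, map_sum, ← h3, connCoord_apply, vfCoord, vfCoord,
    ofChartVec_chartVec hx, ← hsum (mvfderiv 𝓘(ℝ, E) (vfCoord c Y) x (X x)),
    ← Finset.sum_add_distrib]
  refine Finset.sum_congr rfl fun i _ => ?_
  rw [map_add, map_smul, map_smul, h2, mvfderiv_clm_comp (l i) hYc, add_comm]
  rfl

set_option synthInstance.maxHeartbeats 200000 in
theorem contDiffAt_connCoord_chartCurve {nab : ConnectionOn E M}
    [nab.ContMDiffCovariantDerivative ∞] (p : HigherTangentBundle E M r) :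
    ContDiffAt ℝ ∞ (fun t => connCoord p.proj nab ((chartAt E p.proj).symm (chartCurve p t))) 0 :=
  contDiffAt_comp_chartCurve (F := fun y => connCoord p.proj nab ((chartAt E p.proj).symm y))
    ((contMDiffAt_iff_contDiffAt_chart (mem_chart_source E _)).1
      ((contMDiffOn_connCoord p.proj).contMDiffAt
        ((chartAt E p.proj).open_source.mem_nhds (mem_chart_source E _))))

/-- The connection form of the complete lift of a connection, at the centre of a chart. -/
noncomputable def liftConnForm (nab : ConnectionOn E M) (p : HigherTangentBundle E M r)
    (w : Fin (r + 1) → E) : (Fin (r + 1) → E) →L[ℝ] (Fin (r + 1) → E) :=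
  ContinuousLinearMap.pi fun k : Fin (r + 1) => taylorBilin r k
    (fun t => connCoord p.proj nab ((chartAt E p.proj).symm (chartCurve p t))) w

/-- The complete lift of a connection. -/
noncomputable def liftConn (r : ℕ) (nab : ConnectionOn E M) :
    ConnectionOn (Fin (r + 1) → E) (HigherTangentBundle E M r) where
  -- At each `p` the formula uses the chart centred at `p`, where the components of a tangent vector
  -- are the vector itself. No compatibility between charts is required: additivity and the Leibniz
  -- rule are pointwise, and smoothness is obtained later from the values on lifted frames.
  toFun σ p := (show (Fin (r + 1) → E) →L[ℝ] (Fin (r + 1) → E) from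
    mvfderiv 𝓘(ℝ, Fin (r + 1) → E) (fun q => chartVec p q (σ q)) p) + liftConnForm nab p (σ p)
  isCovariantDerivativeOnUniv := by
    constructor
    · intro σ σ' p hσ hσ' _
      have hp := mem_chart_source (Fin (r + 1) → E) p
      have h1 := mvfderiv_add ((mdifferentiableAt_vectorField_iff hp).1 hσ)
        ((mdifferentiableAt_vectorField_iff hp).1 hσ')
      have e : (fun q => chartVec p q ((σ + σ') q)) =
          (fun q => chartVec p q (σ q)) + fun q => chartVec p q (σ' q) := by
        funext q
        exact map_add _ _ _
      have h2 : liftConnForm nab p ((σ + σ') p) =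
          liftConnForm nab p (σ p) + liftConnForm nab p (σ' p) := by
        ext u k
        exact congrArg (fun A : (Fin (r + 1) → E) →L[ℝ] E => A u) (map_add _ _ _)
      rw [e, h1, h2]
      exact add_add_add_comm _ _ _ _
    · intro σ f p hσ hf _
      have hp := mem_chart_source (Fin (r + 1) → E) p
      have h1 := mvfderiv_smul hf ((mdifferentiableAt_vectorField_iff hp).1 hσ)
      have e : (fun q => chartVec p q ((f • σ) q)) =
          f • (fun q => chartVec p q (σ q)) := by
        funext q
        exact (chartVec p q).map_smul (f q) (σ q)
      have h2 : liftConnForm nab p ((f • σ) p) = f p • liftConnForm nab p (σ p) := by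
        ext u k
        exact congrArg (fun A : (Fin (r + 1) → E) →L[ℝ] E => A u)
          ((taylorBilin r k _).map_smul (f p) _)
      rw [e, h1, h2, chartVec_self]
      refine (add_right_comm _ _ _).trans (congrArg₂ _ ?_ rfl)
      exact (smul_add _ _ _).symm

theorem liftConn_apply (nab : ConnectionOn E M)
    (σ : VectorFieldOn (Fin (r + 1) → E) (HigherTangentBundle E M r))
    (p : HigherTangentBundle E M r) (u : Fin (r + 1) → E) :
    liftConn r nab σ p u = (show Fin (r + 1) → E from
      mvfderiv 𝓘(ℝ, Fin (r + 1) → E) (fun q => chartVec p q (σ q)) p u) +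
      liftConnForm nab p (σ p) u := rfl

/-- The derivative of the components of the lift of a vector field. -/
theorem mvfderiv_chartVec_liftVF {X Y : VectorFieldOn E M} (hX : IsSmoothVF X)
    (hY : IsSmoothVF Y) (d d' : ℕ) (p : HigherTangentBundle E M r) (k : Fin (r + 1)) :
    (show Fin (r + 1) → E from mvfderiv 𝓘(ℝ, Fin (r + 1) → E)
        (fun q => chartVec p q (liftVF r d' Y q)) p (liftVF r d X p)) k =
      taylorCoeff k (fun t => t ^ (d + d') •
        fderiv ℝ (vfCoord p.proj Y ∘ (chartAt E p.proj).symm) (chartCurve p t)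
          (vfCoord p.proj X ((chartAt E p.proj).symm (chartCurve p t)))) := by
  have hps := mem_chart_source E p.proj
  have hYp := contMDiffOn_vfCoord hY p.proj
  have hFd : MDifferentiableAt 𝓘(ℝ, Fin (r + 1) → E) 𝓘(ℝ, Fin (r + 1) → E)
      (fun q => chartVec p q (liftVF r d' Y q)) p :=
    (mdifferentiableAt_vectorField_iff (mem_chart_source _ p)).1
      (((isLiftVF_liftVF hY d').1 p).mdifferentiableAt (by simp))
  have h1 := mvfderiv_clm_comp (ContinuousLinearMap.proj (R := ℝ) (φ := fun _ : Fin (r + 1) => E) k)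
    hFd (liftVF r d X p)
  refine h1.symm.trans ?_
  have hXc := contDiffAt_comp_chartCurve (contDiffAt_vfCoord hX p.proj)
  have h1 : ContDiffAt ℝ ∞ (fderiv ℝ (vfCoord p.proj Y ∘ (chartAt E p.proj).symm))
      (chartAt E p.proj p.proj) := (contDiffAt_vfCoord hY p.proj).fderiv_right (by simp)
  have hDc := (contDiffAt_comp_chartCurve h1).clm_apply hXc
  rw [taylorCoeff_pow_smul hDc]
  -- Near `p` the `k`-th component of the lift is itself a Taylor coefficient of the component map
  -- of `Y`, so the formula for derivatives of Taylor coefficients applies, with the tangent vector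
  -- represented by `t ^ d X(γ(t))`.
  have h2 : (fun q => ContinuousLinearMap.proj (R := ℝ) (φ := fun _ : Fin (r + 1) => E) k
      (chartVec p q (liftVF r d' Y q))) =ᶠ[𝓝 p] fun q => if d' ≤ (k : ℕ) then
        taylorCoeff (k - d') (vfCoord p.proj Y ∘ q.rep) else 0 := by
    filter_upwards [eventually_chartVec_liftVF hY d' p,
      eventually_proj ((chartAt E p.proj).open_source.mem_nhds hps)] with q hq hqs
    exact (hq k).trans (taylorCoeff_pow_smul (contDiffAt_vfCoord_rep hY hqs))
  rw [mvfderiv_congr h2]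
  have hk : (k : ℕ) ≤ r := Nat.lt_succ_iff.1 k.2
  by_cases hd' : d' ≤ (k : ℕ)
  · simp only [if_pos hd']
    refine (mvfderiv_taylorCoeff_of_taylorCoeff (chartAt E p.proj).open_source hYp hps
      (ContDiffAt.smul (f := fun t : ℝ => t ^ d) (by fun_prop) hXc) (liftVF_apply hX d p)
      (by omega)).trans ?_
    have e : (fun t => fderiv ℝ (vfCoord p.proj Y ∘ (chartAt E p.proj).symm) (chartCurve p t)
        (t ^ d • vfCoord p.proj X ((chartAt E p.proj).symm (chartCurve p t)))) =
        fun t => t ^ d • fderiv ℝ (vfCoord p.proj Y ∘ (chartAt E p.proj).symm) (chartCurve p t)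
        (vfCoord p.proj X ((chartAt E p.proj).symm (chartCurve p t))) := by
      funext t
      exact map_smul _ _ _
    refine (congrArg _ e).trans ?_
    rw [taylorCoeff_pow_smul hDc]
    by_cases hd : d + d' ≤ (k : ℕ)
    · rw [if_pos hd, if_pos (by omega), Nat.sub_sub, Nat.add_comm d']
    · rw [if_neg hd, if_neg (by omega)]
  · simp only [if_neg hd']
    rw [if_neg (by omega), mvfderiv_const]
    rfl

/-- Both sides are Taylor coefficients of `t ^ (d + d') (DY(X) + Γ(Y, X))` along `chartCurve p`: the
derivative and the connection form are each linear over powers of `t`. -/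
theorem liftConn_liftVF {nab : ConnectionOn E M} [nab.ContMDiffCovariantDerivative ∞]
    {X Y : VectorFieldOn E M} (hX : IsSmoothVF X) (hY : IsSmoothVF Y) (d d' : ℕ) :
    covAlong (liftConn r nab) (liftVF r d X) (liftVF r d' Y) =
      liftVF r (d + d') (covAlong nab X Y) := by
  funext p
  have hps := mem_chart_source E p.proj
  have hp : ∀ n : ℕ, ContDiffAt ℝ ∞ (fun t : ℝ => t ^ n) 0 := fun n => by fun_prop
  have hXc := contDiffAt_comp_chartCurve (contDiffAt_vfCoord hX p.proj)
  have hYc := contDiffAt_comp_chartCurve (contDiffAt_vfCoord hY p.proj)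
  have hΓ := contDiffAt_connCoord_chartCurve (nab := nab) p
  have h1 : ContDiffAt ℝ ∞ (fderiv ℝ (vfCoord p.proj Y ∘ (chartAt E p.proj).symm))
      (chartAt E p.proj p.proj) := (contDiffAt_vfCoord hY p.proj).fderiv_right (by simp)
  have hDc := (contDiffAt_comp_chartCurve h1).clm_apply hXc
  obtain ⟨s, hs, hso, hps'⟩ := eventually_nhds_iff.1
    (eventually_vfCoord_covAlong nab (X := X) hY p.proj)
  refine (liftConn_apply nab _ p _).trans (funext fun k => ?_)
  refine Eq.trans ?_ (liftVF_apply (isSmoothVF_covAlong hX hY) (d + d') p k).symm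
  have h2 : liftConnForm nab p (liftVF r d' Y p) (liftVF r d X p) k = _ :=
    taylorBilin_of_taylorCoeff (Nat.lt_succ_iff.1 k.2) hΓ ((hp d').smul hYc) ((hp d).smul hXc)
    (liftVF_apply hY d' p) (liftVF_apply hX d p)
  refine (congrArg₂ (· + ·) (mvfderiv_chartVec_liftVF hX hY d d' p k) h2).trans ?_
  refine (taylorCoeff_add ((hp (d + d')).smul hDc)
    ((hΓ.clm_apply ((hp d').smul hYc)).clm_apply ((hp d).smul hXc))).symm.trans ?_
  apply taylorCoeff_congr
  filter_upwards [eventually_chartCurve hso hps'] with t ht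
  rw [hs _ ht.2, (chartAt E p.proj).right_inv ht.1, smul_add]
  simp only [Pi.smul_apply', map_smul, smul_apply, smul_smul, pow_add]

theorem isCompleteLiftConnection_liftConn {nab : ConnectionOn E M}
    [nab.ContMDiffCovariantDerivative ∞] :
    IsCompleteLiftConnection r nab (liftConn r nab) := by
  intro X Y hX hY l m hl hm X' Y' Z' hX' hY' hZ'
  -- In terms of the codegrees `d = r - l` and `d' = r - m`, the index `l + m - r` is `r - (d +
  -- d')`, so codegrees simply add.
  rw [show (l : ℤ) = r - (r - l : ℕ) by omega] at hX'
  rw [show (m : ℤ) = r - (r - m : ℕ) by omega] at hY'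
  rw [show (l : ℤ) + m - r = r - ((r - l) + (r - m) : ℕ) by omega] at hZ'
  rw [hX'.eq_liftVF hX, hY'.eq_liftVF hY, hZ'.eq_liftVF (isSmoothVF_covAlong hX hY),
    liftConn_liftVF hX hY]

end ConnectionLift

/-! ### Smoothness of a connection and spanning, tested on local frames. -/

section Frames

variable {F : Type*} [NormedAddCommGroup F] [NormedSpace ℝ F] [FiniteDimensional ℝ F]
  {N : Type*} [TopologicalSpace N] [ChartedSpace F N] [IsManifold 𝓘(ℝ, F) ∞ N]

/-- A connection is smooth if the covariant derivatives of coordinate frames along themselves are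
smooth. -/
theorem contMDiffCovariantDerivative_of_frame {nab : ConnectionOn F N} {ι : Type*} [Fintype ι]
    (B : Module.Basis ι ℝ F) (W : N → ι → VectorFieldOn F N) (hW : ∀ p i, IsSmoothVF (W p i))
    (hWB : ∀ p i, ∀ᶠ q in 𝓝 p, W p i q = ofChartVec p q (B i))
    (hnab : ∀ p i j, IsSmoothVF (covAlong nab (W p i) (W p j))) :
    nab.ContMDiffCovariantDerivative ∞ := by
  refine ⟨⟨fun {σ} hσ p _ => ContMDiffAt.contMDiffWithinAt ?_⟩⟩
  have hσ' : IsSmoothVF σ := contMDiffOn_univ.1 hσ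
  refine contMDiffAt_hom_of_apply_ofChartVec (V := (TangentSpace 𝓘(ℝ, F) : N → Type _))
    fun e => ?_
  let l : ι → F →L[ℝ] ℝ := fun i => LinearMap.toContinuousLinearMap (B.coord i)
  have hsum : ∀ e : F, ∑ i, l i e • B i = e := B.sum_repr
  let a : ι → N → ℝ := fun i q => l i (chartVec p q (σ q))
  have ha : ∀ i, ∀ q ∈ (chartAt F p).source, ContMDiffAt 𝓘(ℝ, F) 𝓘(ℝ, ℝ) ∞ (a i) q :=
    fun i q hq => (l i).contMDiff.contMDiffAt.comp q ((contMDiffAt_vectorField_iff hq).1 (hσ' q))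
  have hps := mem_chart_source F p
  -- With `σ = ∑ a_i W_i`, this is the Leibniz expansion `∑_j e_j ∑_i (a_i ∇_{W_j} W_i + (W_j a_i)
  -- W_i)` of the derivative of `σ` along the constant field `e`; each factor is smooth.
  have hV : ContMDiffAt 𝓘(ℝ, F) 𝓘(ℝ, F).tangent ∞ (fun q => (⟨q, ∑ j, l j e •
      ∑ i, (a i q • covAlong nab (W p j) (W p i) q + mvfderiv 𝓘(ℝ, F) (a i) q (W p j q) • W p i q)⟩
      : TangentBundle 𝓘(ℝ, F) N)) p := by
    refine ContMDiffAt.sum_section fun j _ => ContMDiffAt.smul_section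
      (f := fun _ => l j e) contMDiffAt_const (ContMDiffAt.sum_section fun i _ => ?_)
    exact ((ha i p hps).smul_section (hnab p j i p)).add_section
      ((contMDiffAt_mvfderiv_apply (ha i p hps) (hW p j p)).smul_section (hW p i p))
  refine hV.congr_of_eventuallyEq ?_
  have hWB' := eventually_eventually_nhds.2 (eventually_all.2 (hWB p))
  filter_upwards [(chartAt F p).open_source.mem_nhds hps, hWB'] with q hq hqB
  refine congrArg (TotalSpace.mk' F q) ?_
  have h1 := fun u => nab.apply_of_eventually_eq_sum (a := a) (W := W p) (Y := σ) (x := q)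
    (fun i => (ha i q hq).mdifferentiableAt (by simp))
    (fun i => (hW p i q).mdifferentiableAt (by simp))
    ((hσ' q).mdifferentiableAt (by simp)) (by
      filter_upwards [hqB, (chartAt F p).open_source.mem_nhds hq] with y hy hys
      simp only [hy]
      conv_lhs => rw [← ofChartVec_chartVec hys (σ y), ← hsum (chartVec p y (σ y)), map_sum]
      exact Finset.sum_congr rfl fun i _ => map_smul _ _ _) u
  conv_lhs => rw [← hsum e, map_sum, map_sum]
  refine Finset.sum_congr rfl fun j _ => ?_
  rw [map_smul, map_smul, ← hqB.self_of_nhds j, h1]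
  rfl

omit [FiniteDimensional ℝ F] in
theorem span_frame {ι : Type*} (B : Module.Basis ι ℝ F) {W : ι → VectorFieldOn F N} {p : N}
    (hWB : ∀ i, W i p = ofChartVec p p (B i)) :
    Submodule.span ℝ ((fun W : VectorFieldOn F N => W p) '' range W) = ⊤ := by
  have hps := mem_chart_source F p
  refine eq_top_iff.2 fun u _ => ?_
  rw [← ofChartVec_chartVec hps u, ← range_comp]
  have h : chartVec p p u ∈ Submodule.span ℝ (range B) := B.mem_span _
  have h2 := Submodule.mem_map_of_mem (f := (ofChartVec p p).toLinearMap) h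
  rw [Submodule.map_span, ← range_comp] at h2
  have e : (fun W : VectorFieldOn F N => W p) ∘ W = (ofChartVec p p).toLinearMap ∘ B :=
    funext hWB
  rw [e]
  exact h2

end Frames

/-! ### Lifted brackets, the lifted torsion defect, and the theorem. -/

section LiftedStructure

variable {E : Type*} [NormedAddCommGroup E] [NormedSpace ℝ E] [FiniteDimensional ℝ E]
  {M : Type*} [TopologicalSpace M] [ChartedSpace E M] [IsManifold 𝓘(ℝ, E) ∞ M] [T2Space M]
  {r : ℕ}

omit [FiniteDimensional ℝ E] [IsManifold 𝓘(ℝ, E) ∞ M] [T2Space M] in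
theorem liftFun_add (k : ℤ) {f f' : M → ℝ} (hf : ContMDiff 𝓘(ℝ, E) 𝓘(ℝ, ℝ) ∞ f)
    (hf' : ContMDiff 𝓘(ℝ, E) 𝓘(ℝ, ℝ) ∞ f') (p : HigherTangentBundle E M r) :
    liftFun r k (fun x => f x + f' x) p = liftFun r k f p + liftFun r k f' p := by
  by_cases hk : 0 ≤ k
  · simp only [liftFun, if_pos hk]
    exact taylorCoeff_add (contDiffAt_comp_curve p.rep (hf _)) (contDiffAt_comp_curve p.rep (hf' _))
  · simp [liftFun, if_neg hk]

/-- Iterated derivatives of lifts can have negative index, where both sides vanish; this version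
lets the rule be applied repeatedly. -/
theorem derivAlong_liftVF_int {X : VectorFieldOn E M} (hX : IsSmoothVF X) {f : M → ℝ}
    (hf : ContMDiff 𝓘(ℝ, E) 𝓘(ℝ, ℝ) ∞ f) (d : ℕ) {k : ℤ} (hk : k ≤ r) :
    derivAlong (liftVF r d X) (liftFun r k f) = liftFun r (k - d) (derivAlong X f) := by
  by_cases h : k < 0
  · rw [liftFun_of_neg h, liftFun_of_neg (by omega)]
    funext p
    rw [derivAlong, mvfderiv_const]
    rfl
  · lift k to ℕ using not_lt.1 h
    exact derivAlong_liftVF hX hf d (by exact_mod_cast hk)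

omit [T2Space M] in
theorem isSmoothVF_mlieBracket {X Y : VectorFieldOn E M} (hX : IsSmoothVF X)
    (hY : IsSmoothVF Y) : IsSmoothVF (VectorField.mlieBracket 𝓘(ℝ, E) X Y) := by
  have : CompleteSpace E := FiniteDimensional.complete ℝ E
  have : IsManifold 𝓘(ℝ, E) (minSmoothness ℝ 2) M := by
    rw [minSmoothness_of_isRCLikeNormedField]
    infer_instance
  have : IsManifold 𝓘(ℝ, E) ((⊤ : ℕ∞) + 1) M := by
    change IsManifold 𝓘(ℝ, E) ∞ M
    infer_instance
  exact fun x => ContMDiffAt.mlieBracket_vectorField (m := ⊤) (n := ⊤) (hX x) (hY x) (by simp)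

/-- `[X^(k), Y^(l)] = [X, Y]^(k + l - r)`. -/
theorem mlieBracket_liftVF {X Y : VectorFieldOn E M} (hX : IsSmoothVF X) (hY : IsSmoothVF Y)
    (d d' : ℕ) :
    VectorField.mlieBracket 𝓘(ℝ, Fin (r + 1) → E) (liftVF r d X) (liftVF r d' Y) =
      liftVF r (d + d') (VectorField.mlieBracket 𝓘(ℝ, E) X Y) := by
  have : CompleteSpace E := FiniteDimensional.complete ℝ E
  funext p
  refine eq_of_mvfderiv_liftFun_eq fun f hf m hm => ?_
  have hXf := contMDiff_derivAlong hf hX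
  have hYf := contMDiff_derivAlong hf hY
  have h1 := derivAlong_mlieBracket (isLiftVF_liftVF (r := r) hX d).1
    (isLiftVF_liftVF (r := r) hY d').1 (contMDiff_liftFun (k := m) (by omega) hf) p
  rw [derivAlong_liftVF_int hX hf d (by omega), derivAlong_liftVF_int hY hf d' (by omega),
    derivAlong_liftVF_int hX hYf d (by omega), derivAlong_liftVF_int hY hXf d' (by omega)] at h1
  have h2 := congrFun (derivAlong_liftVF (r := r) (isSmoothVF_mlieBracket hX hY) hf (d + d') hm) p
  refine h1.trans (Eq.trans ?_ h2.symm)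
  -- The commutator identity is lifted in the additive form `[X, Y] f + Y (X f) = X (Y f)`.
  have h3 := liftFun_add ((m : ℤ) - (d + d' : ℕ))
    (contMDiff_derivAlong hf (isSmoothVF_mlieBracket hX hY)) (contMDiff_derivAlong hXf hY) p
  have e : (fun x => derivAlong (VectorField.mlieBracket 𝓘(ℝ, E) X Y) f x +
      derivAlong Y (derivAlong X f) x) = derivAlong X (derivAlong Y f) := by
    funext x
    rw [derivAlong_mlieBracket hX hY hf, sub_add_cancel]
  rw [e] at h3
  rw [show (m : ℤ) - d' - d = m - (d + d' : ℕ) by omega,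
    show (m : ℤ) - d - d' = m - (d + d' : ℕ) by omega, h3, add_sub_cancel_right]

/-- Stated for an arbitrary complete lift, so the remaining argument needs no uniqueness theorem for
connections. The sum `d + d'` may exceed `r`, in which case the result is zero. -/
theorem IsCompleteLiftConnection.covAlong_liftVF {nab : ConnectionOn E M}
    [nab.ContMDiffCovariantDerivative ∞]
    {nab' : ConnectionOn (Fin (r + 1) → E) (HigherTangentBundle E M r)}
    (h : IsCompleteLiftConnection r nab nab') {X Y : VectorFieldOn E M} (hX : IsSmoothVF X)
    (hY : IsSmoothVF Y) {d d' : ℕ} (hd : d ≤ r) (hd' : d' ≤ r) :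
    covAlong nab' (liftVF r d X) (liftVF r d' Y) = liftVF r (d + d') (covAlong nab X Y) := by
  refine h X Y hX hY (r - d) (r - d') (by omega) (by omega) _ _ _ ?_ ?_ ?_
  · rw [show ((r - d : ℕ) : ℤ) = r - d by omega]
    exact isLiftVF_liftVF hX d
  · rw [show ((r - d' : ℕ) : ℤ) = r - d' by omega]
    exact isLiftVF_liftVF hY d'
  · rw [show ((r - d : ℕ) : ℤ) + (r - d' : ℕ) - r = r - (d + d' : ℕ) by omega]
    exact isLiftVF_liftVF (isSmoothVF_covAlong hX hY) (d + d')

/-- The lifts of coordinate fields, indexed by a basis of the model space of `T^r M`. -/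
noncomputable def liftFrame (p : HigherTangentBundle E M r)
    (i : (_ : Fin (r + 1)) × Fin (Module.finrank ℝ E)) :
    VectorFieldOn (Fin (r + 1) → E) (HigherTangentBundle E M r) :=
  liftVF r i.1 (coordField p.proj (Module.finBasis ℝ E i.2))

theorem isSmoothVF_liftFrame (p : HigherTangentBundle E M r)
    (i : (_ : Fin (r + 1)) × Fin (Module.finrank ℝ E)) : IsSmoothVF (liftFrame p i) :=
  (isLiftVF_liftVF (isSmoothVF_coordField _ _) i.1).1

theorem eventually_liftFrame (p : HigherTangentBundle E M r)
    (i : (_ : Fin (r + 1)) × Fin (Module.finrank ℝ E)) :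
    ∀ᶠ q in 𝓝 p, liftFrame p i q =
      ofChartVec p q (Pi.basis (fun _ : Fin (r + 1) => Module.finBasis ℝ E) i) := by
  filter_upwards [eventually_liftVF_coordField p i.1 (Module.finBasis ℝ E i.2)] with q hq
  rw [Pi.basis_apply]
  exact hq

/-- Smoothness is not part of being a complete lift; it is forced by the values on lifted coordinate
fields, which form a local frame and have smooth lifts as covariant derivatives. -/
theorem IsCompleteLiftConnection.contMDiffCovariantDerivative {nab : ConnectionOn E M}
    [nab.ContMDiffCovariantDerivative ∞]
    {nab' : ConnectionOn (Fin (r + 1) → E) (HigherTangentBundle E M r)}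
    (h : IsCompleteLiftConnection r nab nab') : nab'.ContMDiffCovariantDerivative ∞ := by
  refine contMDiffCovariantDerivative_of_frame _ liftFrame isSmoothVF_liftFrame
    eventually_liftFrame fun p i j => ?_
  rw [liftFrame, liftFrame, h.covAlong_liftVF (isSmoothVF_coordField _ _)
    (isSmoothVF_coordField _ _) (Nat.lt_succ_iff.1 i.1.2) (Nat.lt_succ_iff.1 j.1.2)]
  exact (isLiftVF_liftVF (isSmoothVF_covAlong (isSmoothVF_coordField _ _)
    (isSmoothVF_coordField _ _)) _).1

/-- Each of the five terms of the defect becomes the lift, with the same index `r - (d₁ + d₂ + d₃)`,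
of the corresponding term on `M`. Their combination is the lift of the defect on `M`, which is zero.
-/
theorem torsionDefect_liftVF {g : BilinFieldOn E M} {nab : ConnectionOn E M} (hg : IsSMAT g nab)
    {nab' : ConnectionOn (Fin (r + 1) → E) (HigherTangentBundle E M r)}
    (h : IsCompleteLiftConnection r nab nab') {X Y Z : VectorFieldOn E M} (hX : IsSmoothVF X)
    (hY : IsSmoothVF Y) (hZ : IsSmoothVF Z) {d₁ d₂ d₃ : ℕ} (h₁ : d₁ ≤ r) (h₂ : d₂ ≤ r)
    (h₃ : d₃ ≤ r) (p : HigherTangentBundle E M r) :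
    torsionDefect (liftBilin r g) nab' p (liftVF r d₁ X) (liftVF r d₂ Y) (liftVF r d₃ Z) = 0 := by
  have := hg.smooth
  have hm := hg.metric
  have hXZ := isSmoothVF_covAlong (nab := nab) hX hZ
  have hYZ := isSmoothVF_covAlong (nab := nab) hY hZ
  have hXY := isSmoothVF_mlieBracket hX hY
  have hgYZ := contMDiff_bilin_apply hm hY hZ
  have hgXZ := contMDiff_bilin_apply hm hX hZ
  have eB : ∀ {X Y : VectorFieldOn E M}, IsSmoothVF X → IsSmoothVF Y → ∀ d d' : ℕ,
      liftBilin r g p (liftVF r d X p) (liftVF r d' Y p) = _ := fun hX hY d d' =>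
    congrFun (liftBilin_liftVF hm hX hY d d') p
  rw [torsionDefect, liftBilin_liftVF hm hY hZ, liftBilin_liftVF hm hX hZ,
    derivAlong_liftVF_int hX hgYZ d₁ (by omega), derivAlong_liftVF_int hY hgXZ d₂ (by omega),
    h.covAlong_liftVF hX hZ h₁ h₃, h.covAlong_liftVF hY hZ h₂ h₃, mlieBracket_liftVF hX hY,
    eB hY hXZ, eB hX hYZ, eB hXY hZ]
  rw [show (r : ℤ) - (d₂ + d₃ : ℕ) - d₁ = r - (d₁ + d₂ + d₃ : ℕ) by omega,
    show (r : ℤ) - (d₁ + d₃ : ℕ) - d₂ = r - (d₁ + d₂ + d₃ : ℕ) by omega,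
    show d₂ + (d₁ + d₃) = d₁ + d₂ + d₃ by omega, show d₁ + (d₂ + d₃) = d₁ + d₂ + d₃ by omega]
  -- The identity on `M` is arranged with only sums on both sides, so that additivity of lifts
  -- suffices.
  have e : (fun x => derivAlong X (fun y => g y (Y y) (Z y)) x +
        g x (X x) (covAlong nab Y Z x)) =
      fun x => (derivAlong Y (fun y => g y (X y) (Z y)) x + g x (Y x) (covAlong nab X Z x)) +
        g x (VectorField.mlieBracket 𝓘(ℝ, E) X Y x) (Z x) := by
    funext x
    have := torsionCoupled_iff.1 hg.torsionCoupled X Y Z hX hY hZ x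
    rw [torsionDefect] at this
    linarith
  have h1 := liftFun_add (r := r) (r - (d₁ + d₂ + d₃ : ℕ)) (contMDiff_derivAlong hgYZ hX)
    (contMDiff_bilin_apply hm hX hYZ) p
  have h2 := liftFun_add (r := r) (r - (d₁ + d₂ + d₃ : ℕ)) (contMDiff_derivAlong hgXZ hY)
    (contMDiff_bilin_apply hm hY hXZ) p
  have h3 := liftFun_add (r := r) (r - (d₁ + d₂ + d₃ : ℕ)) ((contMDiff_derivAlong hgXZ hY).add
    (contMDiff_bilin_apply hm hY hXZ)) (contMDiff_bilin_apply hm hXY hZ) p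
  rw [e] at h1
  have h4 := h1.symm.trans h3
  rw [show (derivAlong Y (fun y => g y (X y) (Z y)) + fun x => g x (Y x) (covAlong nab X Z x)) =
    fun x => derivAlong Y (fun y => g y (X y) (Z y)) x + g x (Y x) (covAlong nab X Z x) from rfl,
    h2] at h4
  linarith

/-- By tensoriality the defect is determined by its values on the lifted coordinate frame at `p`,
where it vanishes. -/
theorem IsSMAT.lift {g : BilinFieldOn E M} {nab : ConnectionOn E M} (hg : IsSMAT g nab)
    {nab' : ConnectionOn (Fin (r + 1) → E) (HigherTangentBundle E M r)}
    (h : IsCompleteLiftConnection r nab nab') : IsSMAT (liftBilin r g) nab' := by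
  have := hg.smooth
  refine ⟨isPseudoRiemannianMetric_liftBilin hg.metric, h.contMDiffCovariantDerivative,
    torsionCoupled_iff.2 fun X Y Z hX hY hZ p => ?_⟩
  refine torsionDefect_eq_zero_of_span (isPseudoRiemannianMetric_liftBilin hg.metric)
    (S := range (liftFrame p)) ?_ (span_frame _ fun i => (eventually_liftFrame p i).self_of_nhds)
    ?_ ((hX p).mdifferentiableAt (by simp)) ((hY p).mdifferentiableAt (by simp))
    ((hZ p).mdifferentiableAt (by simp))
  · rintro _ ⟨i, rfl⟩
    exact (isSmoothVF_liftFrame p i p).mdifferentiableAt (by simp)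
  · rintro _ ⟨i, rfl⟩ _ ⟨j, rfl⟩ _ ⟨k, rfl⟩
    exact torsionDefect_liftVF hg h (isSmoothVF_coordField _ _) (isSmoothVF_coordField _ _)
      (isSmoothVF_coordField _ _) (Nat.lt_succ_iff.1 i.1.2) (Nat.lt_succ_iff.1 j.1.2)
      (Nat.lt_succ_iff.1 k.1.2) p

end LiftedStructure

theorem mainTheorem3
    {E : Type*} [NormedAddCommGroup E] [NormedSpace ℝ E] [FiniteDimensional ℝ E]
    {M : Type*} [TopologicalSpace M] [ChartedSpace E M] [IsManifold 𝓘(ℝ, E) ∞ M] [T2Space M]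
    (r : ℕ) (g : BilinFieldOn E M) (nab : ConnectionOn E M) (h : IsSMAT g nab) :
    (∃ (g' : BilinFieldOn (Fin (r + 1) → E) (HigherTangentBundle E M r))
      (nab' : ConnectionOn (Fin (r + 1) → E) (HigherTangentBundle E M r)),
      IsCompleteLiftBilin r g g' ∧ IsCompleteLiftConnection r nab nab') ∧
    ∀ (g' : BilinFieldOn (Fin (r + 1) → E) (HigherTangentBundle E M r))
      (nab' : ConnectionOn (Fin (r + 1) → E) (HigherTangentBundle E M r)),
      IsCompleteLiftBilin r g g' → IsCompleteLiftConnection r nab nab' → IsSMAT g' nab' := by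
  have := h.smooth
  refine ⟨⟨liftBilin r g, liftConn r nab, isCompleteLiftBilin_liftBilin h.metric,
    isCompleteLiftConnection_liftConn⟩, fun g' nab' hg' hnab' => ?_⟩
  -- The lifted metric is unique and may be taken to be `liftBilin r g`; the lifted connection stays
  -- arbitrary.
  rw [hg'.eq_liftBilin h.metric]
  exact h.lift hnab'
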